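/- **Model and conventions.** Arrays have entries in a totally ordered set; equal entries are ordered by their positions (for a $2\times n$ array, lexicographically by row, then column). For a range $R$ of positions, the *sorted Top-$k$ query* on $R$ asks for the positions of the $k$ largest entries in $R$ (all positions of $R$, if $|R|<k$), in decreasing order of the entries. A *2-sided* query on a 1D array $B[1\dots n]$ has a range $B[a\dots b]$ with $1\le a\le b\le n$; a *4-sided* query on a $2\times n$ array $A$ has a range $A[i\dots j][a\dots b]$ with $1\le i\le j\le 2$ and $1\le a\le b\le n$. We work in the encoding model on the word RAM with words of $\Theta(\log n)$ bits: an $s$-bit encoding (data structure) for arrays of a given shape assigns to every array a string of at most $s$ bits, and one fixed word-RAM program, which is given $n$, $k$, the word length and the query, and has access to this string but not to the array, outputs the answer. The time of a query is the number of unit-cost instructions executed, and working memory is not counted as space. **Theorem.** Suppose that, for 1D arrays of size $n$, there is an $S(n,k)$-bit encoding which answers sorted 2-sided Top-$k$ queries in at most $T(n,k)$ time. Then, for $2\times n$ arrays, there is a data structure of at most $$2S(n,k)+(4k+7)\,n+k\cdot g(n)\ \text{ bits},\qquad g(n)=o(n),$$ which answers sorted 4-sided Top-$k$ queries in $O\bigl(k^2+k\,T(n,k)\bigr)$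 time. More precisely, for every program $Q$ and every constant $c$ in the word length of $Q$ there are a program $Q'$, a constant $c'$ in the word length of $Q'$, a constant $C$ and a function $g(n)=o(n)$ such that the following holds for all $n$, all $1\le k\le 2n$, every totally ordered set of entries, and all $S,T$: if with $Q$ the 1D arrays of size $n$ have an $S(n,k)$-bit encoding with query time at most $T(n,k)$, then with $Q'$ the $2\times n$ arrays have an encoding of at most $2S(n,k)+(4k+7)n+k\,g(n)$ bits with query time at most $C\,(k^2+k\,T(n,k))$. -/

import Mathlib

/-! Word-RAM programs with unit-cost instructions. -/

namespace WordRAM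

/-- Binary word operations. Comparisons return `1` or `0`. -/
inductive Op where
  | add | sub | mul | div | and | or | xor | shl | shr | lt | eq

def Op.eval : Op → ℕ → ℕ → ℕ
  | .add, x, y => x + y
  | .sub, x, y => x - y
  | .mul, x, y => x * y
  | .div, x, y => x / y
  | .and, x, y => x &&& y
  | .or, x, y => x ||| y
  | .xor, x, y => x ^^^ y
  | .shl, x, y => x <<< y
  | .shr, x, y => x >>> y
  | .lt, x, y => if x < y then 1 else 0
  | .eq, x, y => if x = y then 1 else 0

/-- Programs. Registers are named by natural numbers; a program mentions finitely many of them.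
Besides the registers there is a working memory (addressed indirectly by `load` and `store`), a
read-only bit string, the data structure (accessed by `read`), and an output tape (`emit`). -/
inductive Prog where
  /-- `r := v` -/
  | const (r v : ℕ)
  /-- `r := x o y` for registers `x`, `y` -/
  | op (o : Op) (r x y : ℕ)
  /-- `r := mem[x]` -/
  | load (r x : ℕ)
  /-- `mem[x] := r` -/
  | store (x r : ℕ)
  /-- `r :=` the number written in the `y` bits of the data structure that start at position `x` -/
  | read (r x y : ℕ)
  /-- append the content of `r` to the output -/
  | emit (r : ℕ)
  | skip
  | seq (p q : Prog)
  /-- run `p` if the register `r` is nonzero, and `q` otherwise -/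
  | ite (r : ℕ) (p q : Prog)
  /-- run `p` as long as the register `r` is nonzero -/
  | loop (r : ℕ) (p : Prog)

structure State where
  reg : ℕ → ℕ
  mem : ℕ → ℕ
  out : List ℕ

/-- The number whose binary digits, least significant first, are the bits
`D[x], D[x + 1], …, D[x + len - 1]`; positions after the end of `D` hold the bit `0`. -/
def readBits (D : List Bool) (x len : ℕ) : ℕ :=
  ∑ t ∈ Finset.range len, (D.getD (x + t) false).toNat * 2 ^ t

def State.setReg (s : State) (r v : ℕ) : State :=
  { s with reg := Function.update s.reg r v }

def State.setMem (s : State) (x v : ℕ) : State :=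
  { s with mem := Function.update s.mem x v }

/-- `Exec w D p s t s'`: on a machine with `w`-bit words and with the data structure `D`, the
program `p`, started in the state `s`, halts after exactly `t` steps in the state `s'`. An
instruction whose result is not a `w`-bit word has no execution, and one `read` accesses at most
`w` bits. Every instruction, and every evaluation of a branching or loop condition, is a step. -/
inductive Exec (w : ℕ) (D : List Bool) : Prog → State → ℕ → State → Prop where
  | const (r v : ℕ) (s : State) (h : v < 2 ^ w) :
      Exec w D (.const r v) s 1 (s.setReg r v)
  | op (o : Op) (r x y : ℕ) (s : State) (h : o.eval (s.reg x) (s.reg y) < 2 ^ w) :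
      Exec w D (.op o r x y) s 1 (s.setReg r (o.eval (s.reg x) (s.reg y)))
  | load (r x : ℕ) (s : State) :
      Exec w D (.load r x) s 1 (s.setReg r (s.mem (s.reg x)))
  | store (x r : ℕ) (s : State) :
      Exec w D (.store x r) s 1 (s.setMem (s.reg x) (s.reg r))
  | read (r x y : ℕ) (s : State) (h : s.reg y ≤ w) :
      Exec w D (.read r x y) s 1 (s.setReg r (readBits D (s.reg x) (s.reg y)))
  | emit (r : ℕ) (s : State) :
      Exec w D (.emit r) s 1 { s with out := s.out ++ [s.reg r] }
  | skip (s : State) : Exec w D .skip s 1 s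
  | seq {p q : Prog} {s s' s'' : State} {t t' : ℕ} (h : Exec w D p s t s')
      (h' : Exec w D q s' t' s'') : Exec w D (.seq p q) s (t + t') s''
  | ite_true {r : ℕ} {p q : Prog} {s s' : State} {t : ℕ} (hr : s.reg r ≠ 0)
      (h : Exec w D p s t s') : Exec w D (.ite r p q) s (t + 1) s'
  | ite_false {r : ℕ} {p q : Prog} {s s' : State} {t : ℕ} (hr : s.reg r = 0)
      (h : Exec w D q s t s') : Exec w D (.ite r p q) s (t + 1) s'
  | loop_done {r : ℕ} {p : Prog} {s : State} (hr : s.reg r = 0) :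
      Exec w D (.loop r p) s 1 s
  | loop_step {r : ℕ} {p : Prog} {s s' s'' : State} {t t' : ℕ} (hr : s.reg r ≠ 0)
      (h : Exec w D p s t s') (h' : Exec w D (.loop r p) s' t' s'') :
      Exec w D (.loop r p) s (t + 1 + t') s''

/-- The initial state: the numbers of the list `input` are in registers `0, 1, 2, …`, all other
registers and the whole working memory contain `0`, and the output is empty. -/
def initState (input : List ℕ) : State where
  reg r := input.getD r 0
  mem _ := 0
  out := []

/-- On `w`-bit words, with the data structure `D`, the program `p` turns the input `input` into the
output `output` in at most `T` steps. The word length `w` is available to the program: it is passed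
in register `0`, before the input. -/
def Computes (p : Prog) (w : ℕ) (D : List Bool) (input : List ℕ) (T : ℕ)
    (output : List ℕ) : Prop :=
  ∃ t ≤ T, ∃ s : State, Exec w D p (initState (w :: input)) t s ∧ s.out = output

/-- `c · (⌊log₂ n⌋ + 2)`, a word length of order `log n`, which for `c ≥ 1` is enough for the
numbers `0, …, 2n`. -/
def wordSize (c n : ℕ) : ℕ := c * (Nat.log 2 n + 2)

end WordRAM

namespace RangeTopK

/-- `L` lists the `k` positions of the range `R` with the largest keys (all positions of `R` if
there are fewer than `k`), in decreasing order of their keys. -/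
def IsSortedTopK {P β : Type*} [LinearOrder β] (key : P → β) (R : Finset P) (k : ℕ)
    (L : List P) : Prop :=
  L.Pairwise (fun p q => key q < key p) ∧ (∀ p ∈ L, p ∈ R) ∧ L.length = min k R.card ∧
    ∀ p ∈ R, p ∉ L → ∀ q ∈ L, key p < key q

/-- The elements of a one-dimensional array, equal elements being ordered by their positions. -/
def key1 {α : Type*} {n : ℕ} (A : Fin n → α) (p : Fin n) : α ×ₗ Fin n :=
  toLex (A p, p)

/-- The elements of a `2 × n` array, equal elements being ordered by the lexicographic order
of their positions (row, column). -/
def key2 {α : Type*} {n : ℕ} (A : Fin 2 → Fin n → α) (p : Fin 2 × Fin n) :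
    α ×ₗ (Fin 2 ×ₗ Fin n) :=
  toLex (A p.1 p.2, toLex p)

open WordRAM in
/-- Every array `A[0 … n-1]` over `α` has an encoding of at most `S` bits from which the program
`Q`, on words of length `wordSize c n`, answers every sorted 2-sided Top-`k` query on `A` in at most
`T` steps. The query `(a, b)` asks for the range `A[a … b]`. -/
def HasEncoding1D (α : Type*) [LinearOrder α] (Q : Prog) (c n k S T : ℕ) : Prop :=
  ∀ A : Fin n → α, ∃ D : List Bool, D.length ≤ S ∧
    ∀ a b : Fin n, a ≤ b → ∃ L : List (Fin n),
      IsSortedTopK (key1 A) (Finset.Icc a b) k L ∧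
      Computes Q (wordSize c n) D [n, k, a, b] T (L.map fun p => (p : ℕ))

open WordRAM in
/-- Every `2 × n` array `A` over `α` has an encoding of at most `S` bits from which the program `Q`,
on words of length `wordSize c n`, answers every sorted 4-sided Top-`k` query on `A` in at most
`T` steps. The query `(i, j, a, b)` asks for the rows `i, …, j` and the columns `a, …, b`. A
position is output as its row followed by its column. -/
def HasEncoding2D (α : Type*) [LinearOrder α] (Q : Prog) (c n k S T : ℕ) : Prop :=
  ∀ A : Fin 2 → Fin n → α, ∃ D : List Bool, D.length ≤ S ∧
    ∀ (i j : Fin 2) (a b : Fin n), i ≤ j → a ≤ b → ∃ L : List (Fin 2 × Fin n),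
      IsSortedTopK (key2 A) (Finset.Icc i j ×ˢ Finset.Icc a b) k L ∧
      Computes Q (wordSize c n) D [n, k, i, j, a, b] T
        (L.flatMap fun p => [(p.1 : ℕ), (p.2 : ℕ)])

end RangeTopK

/-! Number the cells column by column, row `r` and column `c` receiving the number `2c + r`; this
turns the array into one sequence `v` of `2n` pairwise different keys (`numKey`). The 1D encodings
of the two rows give, for each row of the query, its sorted Top-`k` list, and the answer consists of
the first `k` elements of the merge of these lists. Only comparisons between entries of different
rows are missing, and only those that occur during the merge: between the current heads, at numbers
`x < y`, when the list `l` of positions strictly between them has already been put out. All elements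
at `l` are larger than both heads. Every other position in between is smaller than the head of its
own row, hence smaller than `max (v x) (v y)`.

Such a comparison is decided by counting. `levelCount v j y` is the number of `z < y` with `v y ≤ v
z` and exactly `j` elements larger than `v z` in between. `height v x l` is the number of `z < x`
with `v x < v z` for which exactly `|l|` elements larger than `v z` lie after `z` before `x` or in
`l`. If `v x < v y`, everything counted by `levelCount v |l| y` lies before `x` and is counted by
`height v x l`. If `v y < v x`, then `levelCount v |l| y` counts everything that the height counts
and also `x` itself, whose larger elements before `y` are exactly `l`. Hence `v y < v x` if and only
if `1 + height v x l ≤ levelCount v |l| y`. The height is in turn a combination of level counts: it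
starts as `levelCount v 0 x` for the empty list, and appending `e` to a prefix of length `i` adds
`levelCount v (i + 1) e - levelCount v i e` (`height_append`, `height_levelSum`). So
`lt_iff_levelSum` decides a comparison with `O(k)` level counts, and merging takes `O(k²)` time.

Level counts are differences of monotone functions: `levelCount v j y = surpassed v j y - surpassed
v (j + 1) (y + 1)` (`surpassed_eq`). Only the `k + 1` functions `surpassed v 0, …, surpassed v k` on
`0, …, 2n` are needed. Put one after the other they form the monotone function `profile`, whose
values do not exceed their arguments. `exists_layout` stores the first `M` values of such a function
in `2M` bits plus lower-order terms, with constant access time. For `M = (k + 1)(2n + 1)` the main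
term is `(4k + 4)n + 2k + 2`.

The query program runs the given program once per row of the query, with constant slowdown
(`Exec.sim`), and then merges. `hasEncoding2D_queryProg` assembles the data structure under
numerical conditions on its parameters; `layout_fits`, `layoutSize_le` and `overhead_isLittleO`
verify these conditions and the space bound for block sizes depending on `log log n`. -/

namespace WordRAM

/-! ### States -/

@[simp] lemma State.setReg_reg (s : State) (r v r' : ℕ) :
    (s.setReg r v).reg r' = if r' = r then v else s.reg r' := by
  simp [State.setReg, Function.update_apply]

@[simp] lemma State.setReg_mem (s : State) (r v : ℕ) : (s.setReg r v).mem = s.mem := rfl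

@[simp] lemma State.setReg_out (s : State) (r v : ℕ) : (s.setReg r v).out = s.out := rfl

@[simp] lemma State.setMem_reg (s : State) (r v : ℕ) : (s.setMem r v).reg = s.reg := rfl

@[simp] lemma State.setMem_mem (s : State) (a v a' : ℕ) :
    (s.setMem a v).mem a' = if a' = a then v else s.mem a' := by
  simp [State.setMem, Function.update_apply]

@[simp] lemma State.setMem_out (s : State) (r v : ℕ) : (s.setMem r v).out = s.out := rfl

lemma State.ext' {s s' : State} (h₁ : ∀ r, s.reg r = s'.reg r) (h₂ : ∀ a, s.mem a = s'.mem a)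
    (h₃ : s.out = s'.out) : s = s' := by
  cases s; cases s'
  simp only [State.mk.injEq]
  exact ⟨funext h₁, funext h₂, h₃⟩

/-- Append `v` to the output. -/
def State.emit (s : State) (v : ℕ) : State := { s with out := s.out ++ [v] }

@[simp] lemma State.emit_reg (s : State) (v : ℕ) : (s.emit v).reg = s.reg := rfl

@[simp] lemma State.emit_mem (s : State) (v : ℕ) : (s.emit v).mem = s.mem := rfl

@[simp] lemma State.emit_out (s : State) (v : ℕ) : (s.emit v).out = s.out ++ [v] := rfl

lemma readBits_lt (D : List Bool) (x len : ℕ) : readBits D x len < 2 ^ len := by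
  induction len with
  | zero => simp [readBits]
  | succ l ih =>
    have h : readBits D x (l + 1)
        = readBits D x l + (D.getD (x + l) false).toNat * 2 ^ l := by
      simp [readBits, Finset.sum_range_succ]
    have h2 : (D.getD (x + l) false).toNat ≤ 1 := Bool.toNat_le _
    rw [h, pow_succ]
    nlinarith [Nat.mul_le_mul_right (2 ^ l) h2]

/-! ### Executions with a time bound and a postcondition -/

/-- From `s`, the program `p` halts after at most `n` steps in a state that satisfies `P`. -/
def Runs (w : ℕ) (D : List Bool) (p : Prog) (s : State) (n : ℕ) (P : State → Prop) : Prop :=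
  ∃ t ≤ n, ∃ s', Exec w D p s t s' ∧ P s'

infixr:60 " ;; " => Prog.seq

section Runs

variable {w : ℕ} {D : List Bool} {p q : Prog} {s s' : State} {n m : ℕ} {P P' : State → Prop}

lemma Exec.runs (h : Exec w D p s n s') (hP : P s') : Runs w D p s n P :=
  ⟨n, le_rfl, s', h, hP⟩

lemma Runs.mono (h : Runs w D p s n P) (hn : n ≤ m) (hP : ∀ s', P s' → P' s') :
    Runs w D p s m P' := by
  obtain ⟨t, ht, s', he, hs⟩ := h
  exact ⟨t, ht.trans hn, s', he, hP _ hs⟩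

lemma Runs.le (h : Runs w D p s n P) (hn : n ≤ m) : Runs w D p s m P :=
  h.mono hn fun _ => id

lemma Runs.seq (h : Runs w D p s n fun s' => Runs w D q s' m P) :
    Runs w D (p ;; q) s (n + m) P := by
  obtain ⟨t, ht, s', he, t', ht', s'', he', hP⟩ := h
  exact ⟨t + t', by omega, s'', .seq he he', hP⟩

lemma Runs.bind (h : Runs w D p s n P') (h' : ∀ s', P' s' → Runs w D q s' m P) :
    Runs w D (p ;; q) s (n + m) P :=
  Runs.seq (h.mono le_rfl h')

lemma Runs.skip (h : P s) : Runs w D .skip s 1 P :=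
  (Exec.skip s).runs h

end Runs

/-! ### Expressions -/

/-- Expressions over the registers, the memory and the data structure. -/
inductive Ex where
  | lit (v : ℕ)
  | var (r : ℕ)
  | bin (o : Op) (a b : Ex)
  | rd (x y : Ex)
  | ld (x : Ex)

/-- `Ev w D s e v`: on `w`-bit words, the expression `e` can be evaluated in the state `s`, and its
value is `v`. -/
inductive Ev (w : ℕ) (D : List Bool) (s : State) : Ex → ℕ → Prop where
  | lit {v : ℕ} (h : v < 2 ^ w) : Ev w D s (.lit v) v
  | var {r : ℕ} (hr : r < 49) (h : s.reg r < 2 ^ w) : Ev w D s (.var r) (s.reg r)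
  | bin {o : Op} {a b : Ex} {x y : ℕ} (ha : Ev w D s a x) (hb : Ev w D s b y)
      (h : o.eval x y < 2 ^ w) : Ev w D s (.bin o a b) (o.eval x y)
  | rd {a b : Ex} {x y : ℕ} (ha : Ev w D s a x) (hb : Ev w D s b y) (h : y ≤ w) :
      Ev w D s (.rd a b) (readBits D x y)
  | ld {a : Ex} {x : ℕ} (ha : Ev w D s a x) (h : s.mem x < 2 ^ w) : Ev w D s (.ld a) (s.mem x)

lemma Ev.lt {w : ℕ} {D : List Bool} {s : State} {e : Ex} {v : ℕ} (h : Ev w D s e v) :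
    v < 2 ^ w := by
  cases h with
  | lit h => exact h
  | var _ h => exact h
  | bin _ _ h => exact h
  | rd _ _ h => exact (readBits_lt _ _ _).trans_le (Nat.pow_le_pow_right two_pos h)
  | ld _ h => exact h

lemma Ev.unique {w : ℕ} {D : List Bool} {s : State} {e : Ex} {v v' : ℕ} (h : Ev w D s e v)
    (h' : Ev w D s e v') : v = v' := by
  induction h generalizing v' with
  | lit _ => cases h'; rfl
  | var _ _ => cases h'; rfl
  | bin _ _ _ h1 h2 => cases h' with | bin a b => rw [h1 a, h2 b]
  | rd _ _ _ h1 h2 => cases h' with | rd a b => rw [h1 a, h2 b]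
  | ld _ _ h1 => cases h' with | ld a => rw [h1 a]

/-- The number of registers used for the evaluation. -/
def Ex.depth : Ex → ℕ
  | .lit _ => 1
  | .var _ => 1
  | .bin _ a b => max a.depth (b.depth + 1)
  | .rd a b => max a.depth (b.depth + 1)
  | .ld a => a.depth

/-- The number of steps of the evaluation. -/
def Ex.cost : Ex → ℕ
  | .lit _ => 1
  | .var _ => 1
  | .bin _ a b => a.cost + b.cost + 1
  | .rd a b => a.cost + b.cost + 1
  | .ld a => a.cost + 1

/-- A program that leaves the value of the expression in register `t`. -/
def Ex.comp : Ex → ℕ → Prog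
  | .lit v, t => .const t v
  | .var r, t => .op .or t r r
  | .bin o a b, t => (a.comp t ;; b.comp (t + 1)) ;; .op o t t (t + 1)
  | .rd a b, t => (a.comp t ;; b.comp (t + 1)) ;; .read t t (t + 1)
  | .ld a, t => a.comp t ;; .load t t

lemma Ex.depth_pos (e : Ex) : 1 ≤ e.depth := by
  induction e <;> simp_all [Ex.depth]

/-- The running state `σ` is decoupled from `s`: when a right operand is evaluated, register `t`
already holds the left one, and only the variables and the memory still agree with `s`. -/
lemma Ev.exec {w : ℕ} {D : List Bool} {s : State} {e : Ex} {v : ℕ} (h : Ev w D s e v) :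
    ∀ t, 49 ≤ t → ∀ σ : State, (∀ r < 49, σ.reg r = s.reg r) → σ.mem = s.mem →
      ∃ σ', Exec w D (e.comp t) σ e.cost σ' ∧ σ'.mem = σ.mem ∧ σ'.out = σ.out ∧ σ'.reg t = v ∧
        ∀ r, r < t ∨ t + e.depth ≤ r → σ'.reg r = σ.reg r := by
  induction h with
  | lit h =>
    intro t ht σ _ _
    refine ⟨_, .const t _ σ h, rfl, rfl, by simp, fun r hr => ?_⟩
    simp only [Ex.depth] at hr
    simp; omega
  | @var r hr h =>
    intro t ht σ hσ _
    refine ⟨_, .op .or t r r σ ?_, rfl, rfl, ?_, fun r hr => ?_⟩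
    · simpa [Op.eval, hσ r hr] using h
    · simp [Op.eval, hσ r hr]
    · simp only [Ex.depth] at hr
      simp; omega
  | @bin o a b x y ha hb h iha ihb =>
    intro t ht σ hσ hm
    obtain ⟨σ₁, e₁, m₁, o₁, v₁, r₁⟩ := iha t ht σ hσ hm
    obtain ⟨σ₂, e₂, m₂, o₂, v₂, r₂⟩ := ihb (t + 1) (by omega) σ₁
      (fun r hr => by rw [r₁ r (by omega), hσ r hr]) (m₁.trans hm)
    have hx : σ₂.reg t = x := by rw [r₂ t (by omega), v₁]
    refine ⟨_, .seq (.seq e₁ e₂) (.op o t t (t + 1) σ₂ (by rw [hx, v₂]; exact h)), ?_, ?_, ?_, ?_⟩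
    · simp [m₂, m₁]
    · simp [o₂, o₁]
    · simp [hx, v₂]
    · intro r hr
      have := a.depth_pos
      simp only [Ex.depth] at hr
      rw [State.setReg_reg, if_neg (by omega), r₂ r (by omega), r₁ r (by omega)]
  | @rd a b x y ha hb h iha ihb =>
    intro t ht σ hσ hm
    obtain ⟨σ₁, e₁, m₁, o₁, v₁, r₁⟩ := iha t ht σ hσ hm
    obtain ⟨σ₂, e₂, m₂, o₂, v₂, r₂⟩ := ihb (t + 1) (by omega) σ₁
      (fun r hr => by rw [r₁ r (by omega), hσ r hr]) (m₁.trans hm)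
    have hx : σ₂.reg t = x := by rw [r₂ t (by omega), v₁]
    refine ⟨_, .seq (.seq e₁ e₂) (.read t t (t + 1) σ₂ (by rw [v₂]; exact h)), ?_, ?_, ?_, ?_⟩
    · simp [m₂, m₁]
    · simp [o₂, o₁]
    · simp [hx, v₂]
    · intro r hr
      have := a.depth_pos
      simp only [Ex.depth] at hr
      rw [State.setReg_reg, if_neg (by omega), r₂ r (by omega), r₁ r (by omega)]
  | @ld a x ha h iha =>
    intro t ht σ hσ hm
    obtain ⟨σ₁, e₁, m₁, o₁, v₁, r₁⟩ := iha t ht σ hσ hm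
    refine ⟨_, .seq e₁ (.load t t σ₁), ?_, ?_, ?_, ?_⟩
    · simp [m₁]
    · simp [o₁]
    · simp [v₁, m₁, hm]
    · intro r hr
      have := a.depth_pos
      simp only [Ex.depth] at hr
      rw [State.setReg_reg, if_neg (by omega), r₁ r (by omega)]

/-! ### Structured programs

Registers `0, …, 48` hold variables; register `49` holds conditions and the registers `50, …, 99`
intermediate results. The latter are `0` between any two statements. -/

/-- The auxiliary registers contain `0`. -/
def Clean (s : State) : Prop := ∀ r, 49 ≤ r → r < 100 → s.reg r = 0

lemma Clean.setReg {s : State} (h : Clean s) {r : ℕ} (hr : r < 49) (v : ℕ) :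
    Clean (s.setReg r v) := fun r' h₁ h₂ => by
  rw [State.setReg_reg, if_neg (by omega), h r' h₁ h₂]

lemma Clean.setMem {s : State} (h : Clean s) (a v : ℕ) : Clean (s.setMem a v) := h

lemma Clean.emit {s : State} (h : Clean s) (v : ℕ) : Clean (s.emit v) := h

/-- Set the registers `50, …, 49 + d` to `0`. -/
def clear : ℕ → Prog
  | 0 => .skip
  | d + 1 => clear d ;; .const (50 + d) 0

lemma exec_clear (w : ℕ) (D : List Bool) (s : State) (d : ℕ) :
    Exec w D (clear d) s (d + 1)
      { s with reg := fun r => if 50 ≤ r ∧ r < 50 + d then 0 else s.reg r } := by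
  induction d with
  | zero =>
    have : ({ s with reg := fun r => if 50 ≤ r ∧ r < 50 + 0 then 0 else s.reg r } : State) = s :=
      State.ext' (fun r => by simp) (fun _ => rfl) rfl
    rw [this]
    exact .skip s
  | succ d ih =>
    have := Exec.seq ih (.const (50 + d) 0 _ (by positivity))
    refine (congrArg (Exec w D _ s _) (State.ext' (fun r => ?_) (fun _ => ?_) ?_)).mp this
    rotate_left
    · rfl
    · rfl
    simp only [State.setReg_reg]
    by_cases h : r = 50 + d
    · simp [h]
    · by_cases h2 : 50 ≤ r ∧ r < 50 + d
      · rw [if_neg h, if_pos h2, if_pos (by omega)]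
      · rw [if_neg h, if_neg h2, if_neg (by omega)]

/-- `r := e` -/
def set (r : ℕ) (e : Ex) : Prog := e.comp 50 ;; (.op .or r 50 50 ;; clear e.depth)

/-- `mem[a] := e` -/
def put (a e : Ex) : Prog :=
  (a.comp 50 ;; e.comp 51) ;; (.store 50 51 ;; clear (max a.depth (e.depth + 1)))

/-- output `e` -/
def outp (e : Ex) : Prog := e.comp 50 ;; (.emit 50 ;; clear e.depth)

/-- run `p` if `e` is nonzero, and `q` otherwise -/
def cond (e : Ex) (p q : Prog) : Prog :=
  set 49 e ;; .ite 49 (.const 49 0 ;; p) (.const 49 0 ;; q)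

/-- run `p` as long as `e` is nonzero -/
def whl (e : Ex) (p : Prog) : Prog :=
  set 49 e ;; .loop 49 (.const 49 0 ;; (p ;; set 49 e))

/-- A time bound for runs in which every loop makes at most `N` iterations. -/
def Prog.time (N : ℕ) : Prog → ℕ
  | .seq p q => p.time N + q.time N
  | .ite _ p q => p.time N + q.time N + 1
  | .loop _ p => N * (p.time N + 1) + 1
  | _ => 1

/-- The nesting depth of the loops. -/
def Prog.nesting : Prog → ℕ
  | .seq p q => max p.nesting q.nesting
  | .ite _ p q => max p.nesting q.nesting
  | .loop _ p => p.nesting + 1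
  | _ => 0

/-- Each level of loops costs one factor `N`. With nesting depth two and `N = k` this is the source
of the quadratic term in the query time. -/
lemma Prog.time_le {N : ℕ} (hN : 1 ≤ N) (p : Prog) : p.time N ≤ N ^ p.nesting * p.time 1 := by
  induction p with
  | seq p q hp hq =>
    have h1 : N ^ p.nesting ≤ N ^ max p.nesting q.nesting := Nat.pow_le_pow_right hN (le_max_left _ _)
    have h2 : N ^ q.nesting ≤ N ^ max p.nesting q.nesting := Nat.pow_le_pow_right hN (le_max_right _ _)
    simp only [Prog.time, Prog.nesting, mul_add]
    exact add_le_add (hp.trans (Nat.mul_le_mul_right _ h1)) (hq.trans (Nat.mul_le_mul_right _ h2))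
  | ite r p q hp hq =>
    have h1 : N ^ p.nesting ≤ N ^ max p.nesting q.nesting := Nat.pow_le_pow_right hN (le_max_left _ _)
    have h2 : N ^ q.nesting ≤ N ^ max p.nesting q.nesting := Nat.pow_le_pow_right hN (le_max_right _ _)
    have h3 : 1 ≤ N ^ max p.nesting q.nesting := Nat.one_le_pow _ _ hN
    simp only [Prog.time, Prog.nesting, mul_add]
    exact add_le_add (add_le_add (hp.trans (Nat.mul_le_mul_right _ h1))
      (hq.trans (Nat.mul_le_mul_right _ h2))) (by omega)
  | loop r p hp =>
    have h3 : 1 ≤ N ^ p.nesting := Nat.one_le_pow _ _ hN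
    have h4 : N ≤ N ^ p.nesting * N := Nat.le_mul_of_pos_left N h3
    simp only [Prog.time, Prog.nesting, pow_succ]
    calc N * (p.time N + 1) + 1 ≤ N * (N ^ p.nesting * p.time 1 + 1) + 1 := by gcongr
      _ = N ^ p.nesting * N * p.time 1 + N + 1 := by ring
      _ ≤ N ^ p.nesting * N * p.time 1 + N ^ p.nesting * N + N ^ p.nesting * N := by omega
      _ = N ^ p.nesting * N * (1 * (p.time 1 + 1) + 1) := by ring
  | _ => simp [Prog.time, Prog.nesting]

/-- A time bound for assignments and conditions. -/
def Ex.setTime (e : Ex) : ℕ := e.cost + (1 + (e.depth + 1))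

lemma clear_time (N d : ℕ) : (clear d).time N = d + 1 := by
  induction d with
  | zero => rfl
  | succ d ih => simp [clear, Prog.time, ih]

lemma Ex.comp_time (N : ℕ) (e : Ex) (t : ℕ) : (e.comp t).time N = e.cost := by
  induction e generalizing t <;> simp_all [Ex.comp, Ex.cost, Prog.time]

lemma set_time (N r : ℕ) (e : Ex) : (set r e).time N = e.setTime := by
  simp [set, Prog.time, Ex.comp_time, clear_time, Ex.setTime]

section Statements

variable {w : ℕ} {D : List Bool} {p q : Prog} {s : State} {e a : Ex} {n m v x r N : ℕ}
  {P : State → Prop}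

lemma exec_set (hc : ∀ r, 50 ≤ r → r < 100 → s.reg r = 0) (he : Ev w D s e v)
    (hd : e.depth ≤ 50) (hr : r < 50) : Exec w D (set r e) s e.setTime (s.setReg r v) := by
  obtain ⟨σ₁, e₁, m₁, o₁, v₁, r₁⟩ := he.exec 50 (by norm_num) s (fun _ _ => rfl) rfl
  have := Exec.seq e₁ (.seq (.op .or r 50 50 σ₁ (by simpa [Op.eval, v₁] using he.lt))
    (exec_clear w D _ e.depth))
  refine (congrArg (Exec w D _ s _) (State.ext' (fun r' => ?_) (fun _ => ?_) ?_)).mp this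
  rotate_left
  · simp [m₁]
  · simp [o₁]
  simp only [State.setReg_reg, Op.eval, v₁, Nat.or_self]
  by_cases h : r' = r
  · rw [if_pos h, if_neg (by omega), if_pos h]
  · rw [if_neg h, if_neg h]
    split_ifs with h2
    · rw [hc r' (by omega) (by omega)]
    · rw [r₁ r' (by omega)]

lemma Runs.set (hc : Clean s) (he : Ev w D s e v) (hd : e.depth ≤ 50) (hr : r < 49)
    (hP : P (s.setReg r v)) : Runs w D (set r e) s ((WordRAM.set r e).time N) P :=
  set_time N r e ▸ (exec_set (fun r h₁ h₂ => hc r (by omega) h₂) he hd (by omega)).runs hP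

lemma Runs.put (hc : Clean s) (ha : Ev w D s a x) (he : Ev w D s e v) (hda : a.depth ≤ 50)
    (hd : e.depth ≤ 49) (hP : P (s.setMem x v)) : Runs w D (put a e) s ((WordRAM.put a e).time N) P := by
  obtain ⟨σ₁, e₁, m₁, o₁, v₁, r₁⟩ := ha.exec 50 (by norm_num) s (fun _ _ => rfl) rfl
  obtain ⟨σ₂, e₂, m₂, o₂, v₂, r₂⟩ := he.exec 51 (by norm_num) σ₁
    (fun r hr => r₁ r (by omega)) m₁
  have := Exec.seq (.seq e₁ e₂) (.seq (.store 50 51 σ₂) (exec_clear w D _ (max a.depth (e.depth + 1))))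
  have ht : a.cost + e.cost + (1 + (max a.depth (e.depth + 1) + 1)) = (WordRAM.put a e).time N := by
    simp [WordRAM.put, Prog.time, Ex.comp_time, clear_time]
  rw [ht] at this
  refine Exec.runs ?_ hP
  have h50 : σ₂.reg 50 = x := by rw [r₂ 50 (by omega), v₁]
  refine (congrArg (Exec w D _ s _) (State.ext' (fun r' => ?_) (fun _ => ?_) ?_)).mp this
  rotate_left
  · simp [m₁, m₂, h50, v₂]
  · simp [o₁, o₂]
  simp only [State.setMem_reg]
  split_ifs with h
  · rw [hc r' (by omega) (by omega)]
  · have := a.depth_pos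
    rw [r₂ r' (by omega), r₁ r' (by omega)]

lemma Runs.outp (hc : Clean s) (he : Ev w D s e v) (hd : e.depth ≤ 50) (hP : P (s.emit v)) :
    Runs w D (outp e) s ((WordRAM.outp e).time N) P := by
  obtain ⟨σ₁, e₁, m₁, o₁, v₁, r₁⟩ := he.exec 50 (by norm_num) s (fun _ _ => rfl) rfl
  have := Exec.seq e₁ (.seq (.emit 50 σ₁) (exec_clear w D _ e.depth))
  have ht : e.cost + (1 + (e.depth + 1)) = (WordRAM.outp e).time N := by
    simp [WordRAM.outp, Prog.time, Ex.comp_time, clear_time]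
  rw [ht] at this
  refine Exec.runs ?_ hP
  refine (congrArg (Exec w D _ s _) (State.ext' (fun r' => ?_) (fun _ => ?_) ?_)).mp this
  rotate_left
  · simp [m₁]
  · simp [o₁, v₁]
  simp only [State.emit_reg]
  split_ifs with h
  · rw [hc r' (by omega) (by omega)]
  · rw [r₁ r' (by omega)]

lemma Clean.reset (hc : Clean s) (v : ℕ) : (s.setReg 49 v).setReg 49 0 = s := by
  refine State.ext' (fun r => ?_) (fun _ => rfl) rfl
  simp only [State.setReg_reg]
  split_ifs with h
  · rw [h, hc 49 (by norm_num) (by norm_num)]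
  · rfl

/-- The guard register is reset before a branch starts, so both branches run from `s` itself. -/
lemma Runs.cond (hc : Clean s) (he : Ev w D s e v) (hd : e.depth ≤ 50)
    (hp : v ≠ 0 → Runs w D p s n P) (hq : v = 0 → Runs w D q s n P) :
    Runs w D (cond e p q) s (e.setTime + (n + 2)) P := by
  have h := exec_set (r := 49) (fun r h₁ h₂ => hc r (by omega) h₂) he hd (by omega)
  have h0 : Exec w D (.const 49 0) (s.setReg 49 v) 1 s := by
    have := Exec.const (w := w) (D := D) 49 0 (s.setReg 49 v) (by positivity)
    rwa [hc.reset] at this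
  by_cases hv : v = 0
  · obtain ⟨t, ht, s', hs, hP⟩ := hq hv
    exact ⟨_, by omega, s', .seq h (.ite_false (by simpa using hv) (.seq h0 hs)), hP⟩
  · obtain ⟨t, ht, s', hs, hP⟩ := hp hv
    exact ⟨_, by omega, s', .seq h (.ite_true (by simpa using hv) (.seq h0 hs)), hP⟩

lemma Runs.cond' (hc : Clean s) (he : Ev w D s e v) (hd : e.depth ≤ 50)
    (hp : v ≠ 0 → Runs w D p s (p.time N) P)
    (hq : v = 0 → Runs w D q s (q.time N) P) :
    Runs w D (WordRAM.cond e p q) s ((WordRAM.cond e p q).time N) P :=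
  (Runs.cond (n := p.time N + q.time N) hc he hd (fun h => (hp h).le (by omega))
    (fun h => (hq h).le (by omega))).le (by simp [WordRAM.cond, Prog.time, set_time]; omega)

/-- The invariant `I i` speaks of clean states, although register `49` holds the value of the guard
whenever the loop tests it. The proof therefore keeps this value apart, as an update of a clean
state. -/
lemma Runs.whl {I : ℕ → State → Prop} {c : ℕ} (hd : e.depth ≤ 50) (h0 : I 0 s)
    (hstep : ∀ i < N, ∀ s, I i s →
      Clean s ∧ ∃ v, v ≠ 0 ∧ Ev w D s e v ∧ Runs w D p s c (I (i + 1)))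
    (hend : ∀ s, I N s → Clean s ∧ Ev w D s e 0) :
    Runs w D (whl e p) s (e.setTime + 1 + N * (c + e.setTime + 2)) (I N) := by
  -- Downward induction on `i`: the bound counts the `N - i` iterations that remain.
  have key : ∀ i ≤ N, ∀ s, I i s → ∀ v, Ev w D s e v →
      Runs w D (.loop 49 (.const 49 0 ;; (p ;; WordRAM.set 49 e))) (s.setReg 49 v)
        (1 + (N - i) * (c + e.setTime + 2)) (I N) := by
    intro i hi
    induction hi using Nat.decreasingInduction with
    | self =>
      intro s hs v hv
      have hv0 : v = 0 := hv.unique (hend s hs).2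
      subst hv0
      have : s.setReg 49 0 = s := State.ext' (fun r => by
        simp only [State.setReg_reg]
        split_ifs with h
        · rw [h, (hend s hs).1 49 (by norm_num) (by norm_num)]
        · rfl) (fun _ => rfl) rfl
      rw [this]
      exact ⟨1, by omega, s, .loop_done ((hend s hs).1 49 (by norm_num) (by norm_num)), hs⟩
    | of_succ i hi ih =>
      intro s hs v hv
      obtain ⟨hc, v', hv0, hv', hrun⟩ := hstep i hi s hs
      have hvv : v = v' := hv.unique hv'
      subst hvv
      have hconst : Exec w D (.const 49 0) (s.setReg 49 v) 1 s := by
        have := Exec.const (w := w) (D := D) 49 0 (s.setReg 49 v) (by positivity)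
        rwa [hc.reset] at this
      obtain ⟨t, ht, s', hs', hI⟩ := hrun
      have : Clean s' ∧ ∃ v, Ev w D s' e v := by
        rcases Nat.lt_or_ge (i + 1) N with h | h
        · obtain ⟨h1, v, -, h2, -⟩ := hstep (i + 1) h s' hI
          exact ⟨h1, v, h2⟩
        · obtain rfl : i + 1 = N := by omega
          obtain ⟨h1, h2⟩ := hend s' hI
          exact ⟨h1, 0, h2⟩
      obtain ⟨hc', u, hu⟩ := this
      have hset := exec_set (r := 49) (fun r h₁ h₂ => hc' r (by omega) h₂) hu hd (by omega)
      obtain ⟨t', ht', s'', hs'', hI'⟩ := ih s' hI u hu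
      refine ⟨_, ?_, s'', .loop_step (by simpa using hv0) (.seq hconst (.seq hs' hset)) hs'', hI'⟩
      have : N - i = (N - (i + 1)) + 1 := by omega
      rw [this, Nat.add_mul]
      omega
  have h1 : Clean s ∧ ∃ v, Ev w D s e v := by
    rcases Nat.eq_zero_or_pos N with h | h
    · subst h
      obtain ⟨h1, h2⟩ := hend s h0
      exact ⟨h1, 0, h2⟩
    · obtain ⟨h1, v, -, h2, -⟩ := hstep 0 h s h0
      exact ⟨h1, v, h2⟩
  obtain ⟨hc, v, hv⟩ := h1
  have hset := exec_set (r := 49) (fun r h₁ h₂ => hc r (by omega) h₂) hv hd (by omega)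
  obtain ⟨t, ht, s', hs', hI⟩ := key 0 (Nat.zero_le _) s h0 v hv
  exact ⟨_, by simp at ht; omega, s', .seq hset hs', hI⟩

lemma Runs.whl' {I : ℕ → State → Prop} (hn : n ≤ N) (hd : e.depth ≤ 50) (h0 : I 0 s)
    (hstep : ∀ i < n, ∀ s, I i s →
      Clean s ∧ ∃ v, v ≠ 0 ∧ Ev w D s e v ∧ Runs w D p s (p.time N) (I (i + 1)))
    (hend : ∀ s, I n s → Clean s ∧ Ev w D s e 0) :
    Runs w D (WordRAM.whl e p) s ((WordRAM.whl e p).time N) (I n) := by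
  refine (Runs.whl hd h0 hstep hend).le ?_
  have : n * (p.time N + e.setTime + 2) ≤ N * (p.time N + e.setTime + 2) :=
    Nat.mul_le_mul_right _ hn
  simp only [WordRAM.whl, Prog.time, set_time]
  rw [show 1 + (p.time N + e.setTime) + 1 = p.time N + e.setTime + 2 by ring]
  omega

lemma Runs.seq' (h : Runs w D p s (p.time N) fun s' => Runs w D q s' (q.time N) P) :
    Runs w D (p ;; q) s ((p ;; q).time N) P := h.seq

lemma Runs.bind' {P' : State → Prop} (h : Runs w D p s (p.time N) P')
    (h' : ∀ s', P' s' → Runs w D q s' (q.time N) P) :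
    Runs w D (p ;; q) s ((p ;; q).time N) P := h.bind h'

lemma Runs.skip' (h : P s) : Runs w D .skip s (Prog.skip.time N) P := .skip h

end Statements

/-! ### Simulation of a program inside a larger program -/

/-- The register that holds register `r` of the `i`-th simulated program. -/
def simReg (i r : ℕ) : ℕ := 100 + 2 * r + i

/-- Simulation of a program. Memory cell `a` is kept in the cell `5 a + i`, the `j`-th output is
written to the cell `5 j + 2 + i`, the number of outputs is in register `20 + i`, and the data
structure is a substring of the given one, whose position and length are in the registers `7` and
`8`. -/
def sim (i : ℕ) : Prog → Prog
  | .const r v => .const (simReg i r) v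
  | .op o r x y => .op o (simReg i r) (simReg i x) (simReg i y)
  | .load r x => .const 50 5 ;; .op .mul 50 50 (simReg i x) ;; .const 51 i ;; .op .add 50 50 51 ;;
      .load (simReg i r) 50
  | .store x r => .const 50 5 ;; .op .mul 50 50 (simReg i x) ;; .const 51 i ;; .op .add 50 50 51 ;;
      .store 50 (simReg i r)
  | .read r x y => .op .sub 50 8 (simReg i x) ;; .op .lt 51 50 (simReg i y) ;;
      .ite 51 (.op .or 52 50 50) (.op .or 52 (simReg i y) (simReg i y)) ;;
      .op .add 53 7 (simReg i x) ;; .read (simReg i r) 53 52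
  | .emit r => .const 50 5 ;; .op .mul 50 50 (20 + i) ;; .const 51 (2 + i) ;; .op .add 50 50 51 ;;
      .store 50 (simReg i r) ;; .const 51 1 ;; .op .add (20 + i) (20 + i) 51
  | .skip => .skip
  | .seq p q => sim i p ;; sim i q
  | .ite r p q => .ite (simReg i r) (sim i p) (sim i q)
  | .loop r p => .loop (simReg i r) (sim i p)

/-- The state `σ` represents the state `s` of the `i`-th simulated program. -/
structure Sim (i : ℕ) (s σ : State) : Prop where
  reg : ∀ r, σ.reg (simReg i r) = s.reg r
  mem : ∀ a, σ.mem (5 * a + i) = s.mem a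
  cnt : σ.reg (20 + i) = s.out.length
  out : ∀ j (h : j < s.out.length), σ.mem (5 * j + 2 + i) = s.out[j]

/-- Everything that is not used by the `i`-th simulated program is the same in both states. -/
structure SimFrame (i : ℕ) (σ σ' : State) : Prop where
  low : ∀ r < 50, r ≠ 20 + i → σ'.reg r = σ.reg r
  mid : ∀ r, 54 ≤ r → r < 100 → σ'.reg r = σ.reg r
  reg : ∀ r, σ'.reg (simReg (1 - i) r) = σ.reg (simReg (1 - i) r)
  mem : ∀ a, a % 5 ≠ i → a % 5 ≠ 2 + i → σ'.mem a = σ.mem a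
  out : σ'.out = σ.out

lemma SimFrame.refl (i : ℕ) (σ : State) : SimFrame i σ σ :=
  ⟨fun _ _ _ => rfl, fun _ _ _ => rfl, fun _ => rfl, fun _ _ _ => rfl, rfl⟩

lemma SimFrame.trans {i : ℕ} {σ₁ σ₂ σ₃ : State} (h : SimFrame i σ₁ σ₂) (h' : SimFrame i σ₂ σ₃) :
    SimFrame i σ₁ σ₃ :=
  ⟨fun r h₁ h₂ => (h'.low r h₁ h₂).trans (h.low r h₁ h₂),
    fun r h₁ h₂ => (h'.mid r h₁ h₂).trans (h.mid r h₁ h₂),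
    fun r => (h'.reg r).trans (h.reg r),
    fun a h₁ h₂ => (h'.mem a h₁ h₂).trans (h.mem a h₁ h₂), h'.out.trans h.out⟩

/-- All words of the state are smaller than `V`. -/
def State.Below (s : State) (V : ℕ) : Prop := (∀ r, s.reg r < V) ∧ ∀ a, s.mem a < V

lemma State.Below.setReg {s : State} {V : ℕ} (h : s.Below V) (r : ℕ) {v : ℕ} (hv : v < V) :
    (s.setReg r v).Below V := by
  refine ⟨fun r' => ?_, h.2⟩
  rw [State.setReg_reg]
  split_ifs
  exacts [hv, h.1 _]

lemma State.Below.setMem {s : State} {V : ℕ} (h : s.Below V) (a : ℕ) {v : ℕ} (hv : v < V) :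
    (s.setMem a v).Below V := by
  refine ⟨h.1, fun r' => ?_⟩
  rw [State.setMem_mem]
  split_ifs
  exacts [hv, h.2 _]

/-- A bound on the length of the final output thus holds at all earlier times, which keeps the
addresses of simulated outputs within a word. -/
lemma Exec.out_length_le {w : ℕ} {D : List Bool} {p : Prog} {s s' : State} {n : ℕ}
    (h : Exec w D p s n s') : s.out.length ≤ s'.out.length := by
  induction h with
  | emit r s => simp
  | seq _ _ h1 h2 => exact h1.trans h2
  | loop_step _ _ _ h1 h2 => exact h1.trans h2
  | ite_true _ _ h => exact h
  | ite_false _ _ h => exact h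
  | _ => simp

section Simulation

variable {w w' V base len i : ℕ} {D D' : List Bool}

/-- The simulation of a single instruction or of a composite program. -/
def SimGoal (w' : ℕ) (D' : List Bool) (i V : ℕ) (p : Prog) (n : ℕ) (s' σ : State) : Prop :=
  ∃ n' ≤ 7 * n, ∃ σ', Exec w' D' (sim i p) σ n' σ' ∧ Sim i s' σ' ∧ SimFrame i σ σ' ∧ s'.Below V

/-- The common beginning of a simulated `load` and `store`: it computes the address `5 * x + i` in
register `50`. -/
lemma sim_load_store_aux {s σ : State} {x : ℕ} (hi : i ≤ 1) (hV' : 5 * V + 5 < 2 ^ w')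
    (hx : s.reg x < V) (hσ : Sim i s σ) :
    ∃ σ', (∀ q t σ'', Exec w' D' q σ' t σ'' → Exec w' D' (.const 50 5 ;;
      .op .mul 50 50 (simReg i x) ;; .const 51 i ;; .op .add 50 50 51 ;; q) σ (4 + t) σ'') ∧
      σ'.reg 50 = 5 * s.reg x + i ∧ σ'.mem = σ.mem ∧ σ'.out = σ.out ∧
      ∀ r, r ≠ 50 → r ≠ 51 → σ'.reg r = σ.reg r := by
  have hne : simReg i x ≠ 50 := by unfold simReg; omega
  let σ₁ := ((σ.setReg 50 5).setReg 50 (5 * s.reg x)).setReg 51 i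
  refine ⟨σ₁.setReg 50 (5 * s.reg x + i), ?_, by simp, rfl, rfl, fun r h1 h2 => by
    simp [σ₁, h1, h2]⟩
  intro q t σ'' hq
  have e1 : Exec w' D' (.const 50 5) σ 1 _ := .const 50 5 σ (by omega)
  have e2 := Exec.op (w := w') (D := D') .mul 50 50 (simReg i x) (σ.setReg 50 5) (by
    simp [Op.eval, hne, hσ.reg]; omega)
  have e3 : Exec w' D' (.const 51 i) ((σ.setReg 50 5).setReg 50 (5 * s.reg x)) 1 σ₁ :=
    .const 51 i _ (by omega)
  have e4 := Exec.op (w := w') (D := D') .add 50 50 51 σ₁ (by simp [Op.eval, σ₁]; omega)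
  simp only [Op.eval, State.setReg_reg, hne, hσ.reg, if_true, if_false] at e2
  simp [Op.eval, σ₁] at e4
  have := Exec.seq e1 (.seq e2 (.seq e3 (.seq e4 hq)))
  rw [show 4 + t = 1 + (1 + (1 + (1 + t))) by ring]
  exact this

/-- Instruction by instruction; the factor `7` in `SimGoal` is the cost of the longest one, `emit`.
The simulated string is surrounded by foreign bits, so a read beyond its end would not return zeros;
clamping the read to `min y (len - x)` bits restores them, and `hread` expresses just this. No
overflow has to be detected, because the given execution guarantees that results fit into `w` bits.
-/
lemma Exec.sim {p : Prog} {s s' : State} {n : ℕ} (h : Exec w D p s n s') (hi : i ≤ 1)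
    (hV : 2 ^ w ≤ V) (hV' : 5 * V + 5 < 2 ^ w') (hw : w ≤ w') (hlen : len < 2 ^ w')
    (hbase : base + V < 2 ^ w')
    (hread : ∀ x y, x < V → y ≤ w →
      readBits D' (base + x) (min y (len - x)) = readBits D x y) :
    s.Below V → s'.out.length < V → ∀ σ : State, Sim i s σ → σ.reg 7 = base → σ.reg 8 = len →
      SimGoal w' D' i V p n s' σ := by
  induction h with
  | const r v s h =>
    intro hs _ σ hσ _ _
    refine ⟨1, by omega, _, .const _ v σ (by omega), ⟨fun r' => ?_, hσ.mem, ?_, hσ.out⟩,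
      ⟨fun r' h1 h2 => ?_, fun r' h1 h2 => ?_, fun r' => ?_, fun _ _ _ => rfl, rfl⟩,
      hs.setReg r (by omega)⟩
    · simp only [State.setReg_reg, simReg]
      by_cases h : r' = r
      · simp [h]
      · rw [if_neg (by omega), if_neg h]
        exact hσ.reg r'
    · rw [State.setReg_reg, if_neg (by unfold simReg; omega)]
      exact hσ.cnt
    · rw [State.setReg_reg, if_neg (by unfold simReg; omega)]
    · rw [State.setReg_reg, if_neg (by unfold simReg; omega)]
    · rw [State.setReg_reg, if_neg (by unfold simReg; omega)]
  | op o r x y s h =>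
    intro hs _ σ hσ _ _
    refine ⟨1, by omega, _, .op o _ _ _ σ (by rw [hσ.reg, hσ.reg]; omega),
      ⟨fun r' => ?_, hσ.mem, ?_, hσ.out⟩,
      ⟨fun r' h1 h2 => ?_, fun r' h1 h2 => ?_, fun r' => ?_, fun _ _ _ => rfl, rfl⟩,
      hs.setReg r (by omega)⟩
    · simp only [State.setReg_reg, hσ.reg]
      by_cases h : r' = r
      · simp [h]
      · rw [if_neg (by unfold simReg; omega), if_neg h]
    · rw [State.setReg_reg, if_neg (by unfold simReg; omega)]
      exact hσ.cnt
    · rw [State.setReg_reg, if_neg (by unfold simReg; omega)]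
    · rw [State.setReg_reg, if_neg (by unfold simReg; omega)]
    · rw [State.setReg_reg, if_neg (by unfold simReg; omega)]
  | load r x s =>
    intro hs _ σ hσ _ _
    obtain ⟨σ', hex, h50, hm, ho, hr⟩ := sim_load_store_aux (D' := D') hi hV' (hs.1 x) hσ
    refine ⟨_, by omega, _, hex _ _ _ (.load _ 50 σ'), ⟨fun r' => ?_, fun a => ?_, ?_, fun j h => ?_⟩,
      ⟨fun r' h1 h2 => ?_, fun r' h1 h2 => ?_, fun r' => ?_, fun _ _ _ => ?_, ho⟩,
      hs.setReg r (hs.2 _)⟩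
    · simp only [State.setReg_reg, h50, hm, hσ.mem]
      by_cases h : r' = r
      · simp [h]
      · rw [if_neg (by unfold simReg; omega), if_neg h, hr _ (by unfold simReg; omega)
          (by unfold simReg; omega), hσ.reg]
    · simp [hm, hσ.mem]
    · rw [State.setReg_reg, if_neg (by unfold simReg; omega), hr _ (by omega) (by omega), hσ.cnt]
      rfl
    · simp only [State.setReg_mem, hm]
      exact hσ.out j h
    · rw [State.setReg_reg, if_neg (by unfold simReg; omega), hr _ (by omega) (by omega)]
    · rw [State.setReg_reg, if_neg (by unfold simReg; omega), hr _ (by omega) (by omega)]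
    · rw [State.setReg_reg, if_neg (by unfold simReg; omega), hr _ (by unfold simReg; omega)
        (by unfold simReg; omega)]
    · simp [hm]
  | store x r s =>
    intro hs _ σ hσ _ _
    obtain ⟨σ', hex, h50, hm, ho, hr⟩ := sim_load_store_aux (D' := D') hi hV' (hs.1 x) hσ
    refine ⟨_, by omega, _, hex _ _ _ (.store 50 _ σ'), ⟨fun r' => ?_, fun a => ?_, ?_, fun j h => ?_⟩,
      ⟨fun r' h1 h2 => ?_, fun r' h1 h2 => ?_, fun r' => ?_, fun a h1 h2 => ?_, ho⟩,
      hs.setMem _ (hs.1 _)⟩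
    · rw [State.setMem_reg, State.setMem_reg, hr _ (by unfold simReg; omega)
        (by unfold simReg; omega), hσ.reg]
    · rw [State.setMem_mem, State.setMem_mem, h50, hm, hr _ (by unfold simReg; omega)
        (by unfold simReg; omega), hσ.reg, hσ.mem]
      by_cases h : a = s.reg x
      · simp [h]
      · rw [if_neg (by omega), if_neg h]
    · rw [State.setMem_reg, hr _ (by omega) (by omega), hσ.cnt]
      rfl
    · rw [State.setMem_mem, h50, hm, if_neg (by omega)]
      exact hσ.out j h
    · rw [State.setMem_reg, hr _ (by omega) (by omega)]
    · rw [State.setMem_reg, hr _ (by omega) (by omega)]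
    · rw [State.setMem_reg, hr _ (by unfold simReg; omega) (by unfold simReg; omega)]
    · rw [State.setMem_mem, h50, hm, if_neg (by omega)]
  | read r x y s h =>
    intro hs _ σ hσ h7 h8
    have hx := hs.1 x
    have hy := hs.1 y
    have hlt : s.reg y < 2 ^ w' := by omega
    have n1 : ∀ r, simReg i r ≠ 50 := fun r => by unfold simReg; omega
    have n2 : ∀ r, simReg i r ≠ 51 := fun r => by unfold simReg; omega
    have n3 : ∀ r, simReg i r ≠ 52 := fun r => by unfold simReg; omega
    have n4 : ∀ r, simReg i r ≠ 53 := fun r => by unfold simReg; omega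
    let b := if len - s.reg x < s.reg y then 1 else 0
    let σ₁ := (σ.setReg 50 (len - s.reg x)).setReg 51 b
    let σ₂ := σ₁.setReg 52 (min (s.reg y) (len - s.reg x))
    let σ₃ := σ₂.setReg 53 (base + s.reg x)
    have e1 := Exec.op (w := w') (D := D') .sub 50 8 (simReg i x) σ (by
      simp only [Op.eval, h8]; omega)
    simp only [Op.eval, h8, hσ.reg] at e1
    have hb : b < 2 ^ w' := by
      have : b ≤ 1 := by simp only [b]; split_ifs <;> omega
      omega
    have e2 : Exec w' D' (.op .lt 51 50 (simReg i y)) (σ.setReg 50 (len - s.reg x)) 1 σ₁ := by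
      have := Exec.op (w := w') (D := D') .lt 51 50 (simReg i y) (σ.setReg 50 (len - s.reg x)) (by
        simpa [Op.eval, n1, hσ.reg] using hb)
      simpa [Op.eval, n1, hσ.reg] using this
    have e3 : Exec w' D' (.ite 51 (.op .or 52 50 50) (.op .or 52 (simReg i y) (simReg i y))) σ₁
        (1 + 1) σ₂ := by
      by_cases hc : len - s.reg x < s.reg y
      · refine .ite_true (by simp [σ₁, b, hc]) ?_
        have := Exec.op (w := w') (D := D') .or 52 50 50 σ₁ (by
          simp [Op.eval, σ₁]; omega)
        simpa [Op.eval, σ₁, σ₂, min_eq_right hc.le] using this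
      · refine .ite_false (by simp [σ₁, b, hc]) ?_
        have := Exec.op (w := w') (D := D') .or 52 (simReg i y) (simReg i y) σ₁ (by
          simp [Op.eval, σ₁, n1, n2, hσ.reg]; omega)
        simpa [Op.eval, σ₁, σ₂, n1, n2, hσ.reg, min_eq_left (not_lt.1 hc)] using this
    have e4 : Exec w' D' (.op .add 53 7 (simReg i x)) σ₂ 1 σ₃ := by
      have := Exec.op (w := w') (D := D') .add 53 7 (simReg i x) σ₂ (by
        simp [Op.eval, σ₁, σ₂, n1, n2, n3, hσ.reg, h7]; omega)
      simpa [Op.eval, σ₁, σ₂, σ₃, n1, n2, n3, hσ.reg, h7] using this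
    have e5 : Exec w' D' (.read (simReg i r) 53 52) σ₃ 1
        (σ₃.setReg (simReg i r) (readBits D (s.reg x) (s.reg y))) := by
      have := Exec.read (w := w') (D := D') (simReg i r) 53 52 σ₃ (by
        simp [σ₃, σ₂]; left; omega)
      have h53 : σ₃.reg 53 = base + s.reg x := by simp [σ₃]
      have h52 : σ₃.reg 52 = min (s.reg y) (len - s.reg x) := by simp [σ₃, σ₂]
      rw [h53, h52, hread _ _ hx h] at this
      exact this
    have hkeep : ∀ r, r < 50 ∨ 54 ≤ r → σ₃.reg r = σ.reg r := fun r hr => by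
      simp only [σ₃, σ₂, σ₁, State.setReg_reg]
      rw [if_neg (by omega), if_neg (by omega), if_neg (by omega), if_neg (by omega)]
    have hv := (readBits_lt D (s.reg x) (s.reg y)).trans_le
      ((Nat.pow_le_pow_right two_pos h).trans hV)
    refine ⟨_, by omega, _, .seq e1 (.seq e2 (.seq e3 (.seq e4 e5))),
      ⟨fun r' => ?_, hσ.mem, ?_, hσ.out⟩,
      ⟨fun r' h1 h2 => ?_, fun r' h1 h2 => ?_, fun r' => ?_, fun _ _ _ => rfl, rfl⟩,
      hs.setReg r hv⟩
    · rw [State.setReg_reg σ₃, State.setReg_reg s]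
      by_cases h : r' = r
      · simp [h]
      · rw [if_neg (by unfold simReg; omega), if_neg h, hkeep _ (by unfold simReg; omega), hσ.reg]
    · rw [State.setReg_reg, if_neg (by unfold simReg; omega), hkeep _ (by omega)]
      exact hσ.cnt
    · rw [State.setReg_reg, if_neg (by unfold simReg; omega), hkeep _ (by omega)]
    · rw [State.setReg_reg, if_neg (by unfold simReg; omega), hkeep _ (by omega)]
    · rw [State.setReg_reg, if_neg (by unfold simReg; omega), hkeep _ (by unfold simReg; omega)]
  | emit r s =>
    intro hs hout σ hσ _ _
    simp only [List.length_append, List.length_cons, List.length_nil] at hout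
    have n1 : simReg i r ≠ 50 := by unfold simReg; omega
    have n2 : simReg i r ≠ 51 := by unfold simReg; omega
    have m1 : 20 + i ≠ 50 := by omega
    have m2 : 20 + i ≠ 51 := by omega
    let l := s.out.length
    let σ₁ := ((σ.setReg 50 5).setReg 50 (5 * l)).setReg 51 (2 + i)
    let σ₂ := σ₁.setReg 50 (5 * l + (2 + i))
    let σ₃ := (σ₂.setMem (5 * l + (2 + i)) (s.reg r)).setReg 51 1
    have e1 : Exec w' D' (.const 50 5) σ 1 _ := .const 50 5 σ (by omega)
    have e2 : Exec w' D' (.op .mul 50 50 (20 + i)) (σ.setReg 50 5) 1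
        ((σ.setReg 50 5).setReg 50 (5 * l)) := by
      have := Exec.op (w := w') (D := D') .mul 50 50 (20 + i) (σ.setReg 50 5) (by
        simp only [Op.eval, State.setReg_reg, m1, hσ.cnt, if_true, if_false]; omega)
      simpa only [Op.eval, State.setReg_reg, m1, hσ.cnt, if_true, if_false] using this
    have e3 : Exec w' D' (.const 51 (2 + i)) ((σ.setReg 50 5).setReg 50 (5 * l)) 1 σ₁ :=
      .const 51 _ _ (by omega)
    have e4 : Exec w' D' (.op .add 50 50 51) σ₁ 1 σ₂ := by
      have := Exec.op (w := w') (D := D') .add 50 50 51 σ₁ (by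
        simp [Op.eval, σ₁, l]; omega)
      simpa [Op.eval, σ₁, σ₂] using this
    have e5 : Exec w' D' (.store 50 (simReg i r)) σ₂ 1
        (σ₂.setMem (5 * l + (2 + i)) (s.reg r)) := by
      have := Exec.store (w := w') (D := D') 50 (simReg i r) σ₂
      simpa [σ₁, σ₂, n1, n2, hσ.reg] using this
    have e6 : Exec w' D' (.const 51 1) (σ₂.setMem (5 * l + (2 + i)) (s.reg r)) 1 σ₃ :=
      .const 51 _ _ (by omega)
    have e7 : Exec w' D' (.op .add (20 + i) (20 + i) 51) σ₃ 1 (σ₃.setReg (20 + i) (l + 1)) := by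
      have hc : σ₃.reg (20 + i) = l := by simp [σ₃, σ₂, σ₁, m1, m2, hσ.cnt, l]
      have hc' : σ₃.reg 51 = 1 := by simp [σ₃]
      have := Exec.op (w := w') (D := D') .add (20 + i) (20 + i) 51 σ₃ (by
        simp only [Op.eval, hc, hc', l]; omega)
      simpa only [Op.eval, hc, hc'] using this
    have hkeep : ∀ r, r ≠ 50 → r ≠ 51 → σ₃.reg r = σ.reg r := fun r h1 h2 => by
      simp [σ₃, σ₂, σ₁, h1, h2]
    have hmem : ∀ a, σ₃.mem a = if a = 5 * l + (2 + i) then s.reg r else σ.mem a := fun a => by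
      simp [σ₃, σ₂, σ₁]
    refine ⟨_, by omega, _, .seq e1 (.seq e2 (.seq e3 (.seq e4 (.seq e5 (.seq e6 e7))))),
      ⟨fun r' => ?_, fun a => ?_, ?_, fun j h => ?_⟩,
      ⟨fun r' h1 h2 => ?_, fun r' h1 h2 => ?_, fun r' => ?_, fun a h1 h2 => ?_, rfl⟩, hs⟩
    · rw [State.setReg_reg, if_neg (by unfold simReg; omega), hkeep _ (by unfold simReg; omega)
        (by unfold simReg; omega)]
      exact hσ.reg r'
    · rw [State.setReg_mem, hmem, if_neg (by omega)]
      exact hσ.mem a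
    · simp [l]
    · rw [State.setReg_mem, hmem]
      by_cases hj : j = l
      · subst hj
        rw [if_pos (by ring)]
        simp [l]
      · have : j < s.out.length := by simp at h; omega
        rw [if_neg (by omega), hσ.out j this]
        simp [this]
    · rw [State.setReg_reg, if_neg h2, hkeep _ (by omega) (by omega)]
    · rw [State.setReg_reg, if_neg (by omega), hkeep _ (by omega) (by omega)]
    · rw [State.setReg_reg, if_neg (by unfold simReg; omega), hkeep _ (by unfold simReg; omega)
        (by unfold simReg; omega)]
    · rw [State.setReg_mem, hmem, if_neg (by omega)]
  | skip s =>
    intro hs _ σ hσ _ _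
    exact ⟨1, by omega, σ, .skip σ, hσ, .refl i σ, hs⟩
  | seq h h' ih ih' =>
    intro hs hout σ hσ h7 h8
    obtain ⟨n₁, hn₁, σ₁, e₁, s₁, f₁, b₁⟩ := ih hs (h'.out_length_le.trans_lt hout) σ hσ h7 h8
    obtain ⟨n₂, hn₂, σ₂, e₂, s₂, f₂, b₂⟩ := ih' b₁ hout σ₁ s₁
      ((f₁.low 7 (by omega) (by omega)).trans h7) ((f₁.low 8 (by omega) (by omega)).trans h8)
    exact ⟨_, by omega, σ₂, .seq e₁ e₂, s₂, f₁.trans f₂, b₂⟩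
  | ite_true hr h ih =>
    intro hs hout σ hσ h7 h8
    obtain ⟨n₁, hn₁, σ₁, e₁, s₁, f₁, b₁⟩ := ih hs hout σ hσ h7 h8
    exact ⟨_, by omega, σ₁, .ite_true (by rwa [hσ.reg]) e₁, s₁, f₁, b₁⟩
  | ite_false hr h ih =>
    intro hs hout σ hσ h7 h8
    obtain ⟨n₁, hn₁, σ₁, e₁, s₁, f₁, b₁⟩ := ih hs hout σ hσ h7 h8
    exact ⟨_, by omega, σ₁, .ite_false (by rwa [hσ.reg]) e₁, s₁, f₁, b₁⟩
  | loop_done hr =>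
    intro hs hout σ hσ h7 h8
    exact ⟨1, by omega, σ, .loop_done (by rwa [hσ.reg]), hσ, .refl i σ, hs⟩
  | loop_step hr h h' ih ih' =>
    intro hs hout σ hσ h7 h8
    obtain ⟨n₁, hn₁, σ₁, e₁, s₁, f₁, b₁⟩ := ih hs (h'.out_length_le.trans_lt hout) σ hσ h7 h8
    obtain ⟨n₂, hn₂, σ₂, e₂, s₂, f₂, b₂⟩ := ih' b₁ hout σ₁ s₁
      ((f₁.low 7 (by omega) (by omega)).trans h7) ((f₁.low 8 (by omega) (by omega)).trans h8)
    exact ⟨_, by omega, σ₂, .loop_step (by rwa [hσ.reg]) e₁ e₂, s₂, f₁.trans f₂, b₂⟩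

end Simulation

end WordRAM

namespace RangeTopK

/-! ### Comparing two elements by counting larger elements -/

section Count

variable {β : Type*} [LinearOrder β] (v : ℕ → β)

/-- The number of positions strictly between `z` and `t` with elements larger than that of `z`. -/
def larger (z t : ℕ) : ℕ := ((Finset.Ioo z t).filter fun u => v z < v u).card

/-- The number of positions before `y` with elements at least as large as that of `y`, such that
there are exactly `j` larger elements in between. -/
def levelCount (j y : ℕ) : ℕ :=
  ((Finset.range y).filter fun z => v y ≤ v z ∧ larger v z y = j).card

/-- The number of positions before `t` that are followed by at least `j` larger elements before
`t`. -/
def surpassed (j t : ℕ) : ℕ := ((Finset.range t).filter fun z => j ≤ larger v z t).card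

lemma larger_succ {z t : ℕ} (h : z < t) :
    larger v z (t + 1) = larger v z t + if v z < v t then 1 else 0 := by
  have : Finset.Ioo z (t + 1) = insert t (Finset.Ioo z t) := by
    ext u; simp; omega
  rw [larger, this, Finset.filter_insert]
  split_ifs with hv
  · rw [Finset.card_insert_of_notMem (by simp)]; rfl
  · rfl

lemma larger_mono (z : ℕ) : Monotone (larger v z) := fun _ _ h =>
  Finset.card_le_card (Finset.filter_subset_filter _ (Finset.Ioo_subset_Ioo_right h))

lemma surpassed_mono (j : ℕ) : Monotone (surpassed v j) := fun s t h => by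
  refine Finset.card_le_card fun z hz => ?_
  simp only [Finset.mem_filter, Finset.mem_range] at hz ⊢
  exact ⟨by omega, hz.2.trans (larger_mono v z h)⟩

lemma surpassed_le (j t : ℕ) : surpassed v j t ≤ t :=
  (Finset.card_filter_le _ _).trans_eq (Finset.card_range t)

/-- When the element at `y` arrives, a position with at least `j` larger followers has at least `j +
1` of them afterwards, unless it had exactly `j` and the new element is not larger. These exceptions
are what `levelCount v j y` counts, and `y` itself has no followers yet. Level counts thereby become
differences of monotone functions. -/
lemma surpassed_eq (j y : ℕ) :
    surpassed v j y = levelCount v j y + surpassed v (j + 1) (y + 1) := by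
  have h1 : surpassed v (j + 1) (y + 1) = ((Finset.range y).filter fun z =>
      j ≤ larger v z y ∧ ¬ (v y ≤ v z ∧ larger v z y = j)).card := by
    refine congrArg Finset.card ?_
    ext z
    simp only [Finset.mem_filter, Finset.mem_range]
    constructor
    · rintro ⟨hz, h⟩
      have hzy : z ≠ y := by
        rintro rfl
        have : larger v z (z + 1) = 0 := by
          rw [larger, Finset.card_eq_zero]
          ext u; simp
        omega
      rw [larger_succ v (by omega)] at h
      refine ⟨by omega, ?_⟩
      split_ifs at h with hv
      · exact ⟨by omega, fun h' => absurd h'.1 (not_le.2 hv)⟩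
      · exact ⟨by omega, fun h' => by omega⟩
    · rintro ⟨hz, h, h'⟩
      rw [larger_succ v hz]
      refine ⟨by omega, ?_⟩
      split_ifs with hv
      · omega
      · have : ¬ larger v z y = j := fun h => h' ⟨not_lt.1 hv, h⟩
        omega
  rw [h1, surpassed, levelCount, ← Finset.card_union_of_disjoint]
  · congr 1
    ext z
    simp only [Finset.mem_filter, Finset.mem_range, Finset.mem_union]
    constructor
    · rintro ⟨h, h'⟩
      by_cases hc : v y ≤ v z ∧ larger v z y = j
      · exact .inl ⟨h, hc⟩
      · exact .inr ⟨h, h', hc⟩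
    · rintro (⟨h, h1, h2⟩ | ⟨h, h1, h2⟩)
      · exact ⟨h, h2.ge⟩
      · exact ⟨h, h1⟩
  · rw [Finset.disjoint_left]
    intro z h h'
    simp only [Finset.mem_filter] at h h'
    exact h'.2.2 h.2

lemma levelCount_le (j y : ℕ) : levelCount v j y ≤ y :=
  (Finset.card_filter_le _ _).trans_eq (Finset.card_range y)

/-- The number of positions `z` before `x` with larger elements that have, among the positions
after `z` that are before `x` or in the list `l`, exactly as many larger elements as `l` is long. -/
def height (x : ℕ) (l : List ℕ) : ℕ :=
  ((Finset.range x).filter fun z => v x < v z ∧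
    larger v z x + l.countP (fun u => v z < v u) = l.length).card

/-- Between `x` and `e` only members of `l` can exceed `v z`, and `x` itself does not, by `hvx`. -/
lemma larger_split {x e z : ℕ} {l : List ℕ} (hzx : z < x) (hxe : x < e) (hl : l.Nodup)
    (hmem : ∀ u ∈ l, x < u ∧ u < e) (hvx : v x < v z)
    (hother : ∀ u, x < u → u < e → u ∉ l → v u < v z) :
    larger v z e = larger v z x + l.countP (fun u => v z < v u) := by
  have h1 : (Finset.Ioo z e).filter (fun u => v z < v u)
      = ((Finset.Ioo z x).filter fun u => v z < v u) ∪
        (l.filter fun u => v z < v u).toFinset := by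
    ext u
    simp only [Finset.mem_filter, Finset.mem_Ioo, Finset.mem_union, List.mem_toFinset,
      List.mem_filter, decide_eq_true_eq]
    constructor
    · rintro ⟨⟨h1, h2⟩, h3⟩
      rcases lt_trichotomy u x with h | h | h
      · exact .inl ⟨⟨h1, h⟩, h3⟩
      · subst h; exact absurd h3 hvx.not_gt
      · refine .inr ⟨?_, h3⟩
        by_contra hu
        exact absurd h3 (hother u h h2 hu).not_gt
    · rintro (⟨⟨h1, h2⟩, h3⟩ | ⟨h1, h2⟩)
      · exact ⟨⟨h1, by omega⟩, h3⟩
      · have := hmem u h1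
        exact ⟨⟨by omega, this.2⟩, h2⟩
  rw [larger, h1, Finset.card_union_of_disjoint, List.toFinset_card_of_nodup (hl.filter _),
    List.countP_eq_length_filter]
  · rfl
  · rw [Finset.disjoint_left]
    intro u h h'
    simp only [Finset.mem_filter, Finset.mem_Ioo, List.mem_toFinset, List.mem_filter] at h h'
    have := hmem u h'.1
    omega

/-- Elements after `z` that exceed `v z` belong to `l` without `z`. Hence members of `l` never reach
the level `l.length`. -/
lemma larger_lt_of_mem {x e z : ℕ} {l : List ℕ} (hxz : x ≤ z) (hz : z ∈ l)
    (hother : ∀ u, x < u → u < e → u ∉ l → v u ≤ v z) : larger v z e < l.length := by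
  have h1 : (Finset.Ioo z e).filter (fun u => v z < v u) ⊆ l.toFinset.erase z := by
    intro u
    simp only [Finset.mem_filter, Finset.mem_Ioo, Finset.mem_erase, List.mem_toFinset]
    rintro ⟨⟨h1, h2⟩, h3⟩
    refine ⟨by omega, ?_⟩
    by_contra hu
    exact absurd h3 (hother u (by omega) h2 hu).not_gt
  have h2 := Finset.card_le_card h1
  rw [Finset.card_erase_of_mem (by simpa using hz)] at h2
  have h3 := l.toFinset_card_le
  have h4 : 0 < l.toFinset.card := Finset.card_pos.2 ⟨z, by simpa using hz⟩
  unfold larger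
  omega

/-- No position from `x` on contributes: those outside `l` have elements smaller than `v e`, and
those in `l` have fewer than `l.length ≤ j` larger followers. For the remaining positions
`larger_split` applies. -/
lemma levelCount_eq {x e j : ℕ} {l : List ℕ} (hxe : x < e) (hl : l.Nodup)
    (hmem : ∀ u ∈ l, x < u ∧ u < e) (hx : v x < v e)
    (hother : ∀ u, x < u → u < e → u ∉ l → v u < v e) (hj : l.length ≤ j) :
    levelCount v j e = ((Finset.range x).filter fun z => v e ≤ v z ∧
      larger v z x + l.countP (fun u => v z < v u) = j).card := by
  unfold levelCount
  congr 1
  ext z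
  simp only [Finset.mem_filter, Finset.mem_range]
  constructor
  · rintro ⟨h1, h2, h3⟩
    have hzx : z < x := by
      by_contra hzx
      have hz : z ∈ l := by
        by_contra hz
        rcases eq_or_ne z x with rfl | hne
        · exact absurd h2 hx.not_ge
        · exact absurd h2 (hother z (by omega) h1 hz).not_ge
      have := larger_lt_of_mem v (not_lt.1 hzx) hz
        (fun u h4 h5 h6 => ((hother u h4 h5 h6).trans_le h2).le)
      omega
    refine ⟨hzx, h2, ?_⟩
    rw [← larger_split v hzx hxe hl hmem (hx.trans_le h2)
      (fun u h4 h5 h6 => (hother u h4 h5 h6).trans_le h2)]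
    exact h3
  · rintro ⟨h1, h2, h3⟩
    refine ⟨by omega, h2, ?_⟩
    rw [larger_split v h1 hxe hl hmem (hx.trans_le h2)
      (fun u h4 h5 h6 => (hother u h4 h5 h6).trans_le h2)]
    exact h3

/-- For `z` with `v z < v e`, appending `e` raises both the number of larger elements and the
required number by one, so nothing changes; these positions form `B` below. For `z` with `v e ≤ v z`
only the requirement rises, and the contributions before and after are the level counts of `e` at
`l.length` and `l.length + 1`. -/
lemma height_append {x e : ℕ} {l : List ℕ} (hxe : x < e) (hl : l.Nodup)
    (hmem : ∀ u ∈ l, x < u ∧ u < e) (hx : v x < v e)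
    (hother : ∀ u, x < u → u < e → u ∉ l → v u < v e) :
    height v x (l ++ [e]) + levelCount v l.length e
      = height v x l + levelCount v (l.length + 1) e := by
  rw [levelCount_eq v hxe hl hmem hx hother le_rfl,
    levelCount_eq v (j := l.length + 1) hxe hl hmem hx hother (by omega)]
  let R := Finset.range x
  let κ : ℕ → ℕ := fun z => larger v z x + l.countP (fun u => v z < v u)
  let B := R.filter fun z => (v x < v z ∧ v z < v e) ∧ κ z = l.length
  have h1 : height v x (l ++ [e])
      = (R.filter fun z => v e ≤ v z ∧ κ z = l.length + 1).card + B.card := by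
    rw [height, ← Finset.card_union_of_disjoint]
    · congr 1
      ext z
      simp only [Finset.mem_filter, Finset.mem_union, List.countP_append, List.countP_singleton,
        List.length_append, List.length_singleton, B, κ, decide_eq_true_eq, R]
      constructor
      · rintro ⟨hz, h1, h2⟩
        by_cases h : v z < v e
        · rw [if_pos h] at h2
          exact .inr ⟨hz, ⟨h1, h⟩, by omega⟩
        · rw [if_neg h] at h2
          exact .inl ⟨hz, not_lt.1 h, by omega⟩
      · rintro (⟨hz, h1, h2⟩ | ⟨hz, h1, h2⟩)
        · rw [if_neg h1.not_gt]
          exact ⟨hz, hx.trans_le h1, by omega⟩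
        · rw [if_pos h1.2]
          exact ⟨hz, h1.1, by omega⟩
    · rw [Finset.disjoint_left]
      intro z h h'
      simp only [Finset.mem_filter, B] at h h'
      exact absurd h'.2.1.2 h.2.1.not_gt
  have h2 : height v x l
      = (R.filter fun z => v e ≤ v z ∧ κ z = l.length).card + B.card := by
    rw [height, ← Finset.card_union_of_disjoint]
    · congr 1
      ext z
      simp only [Finset.mem_filter, Finset.mem_union, B, κ, R]
      constructor
      · rintro ⟨hz, h1, h2⟩
        by_cases h : v z < v e
        · exact .inr ⟨hz, ⟨h1, h⟩, h2⟩
        · exact .inl ⟨hz, not_lt.1 h, h2⟩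
      · rintro (⟨hz, h1, h2⟩ | ⟨hz, h1, h2⟩)
        · exact ⟨hz, hx.trans_le h1, h2⟩
        · exact ⟨hz, h1.1, h2⟩
    · rw [Finset.disjoint_left]
      intro z h h'
      simp only [Finset.mem_filter, B] at h h'
      exact absurd h'.2.1.2 h.2.1.not_gt
  rw [h1, h2]
  simp only [κ, R]
  omega

/-- `levelCount v i e₀ + levelCount v (i + 1) e₁ + …` -/
def levelSum : ℕ → List ℕ → ℕ
  | _, [] => 0
  | i, e :: l => levelCount v i e + levelSum (i + 1) l

lemma levelSum_append (i : ℕ) (l l' : List ℕ) :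
    levelSum v i (l ++ l') = levelSum v i l + levelSum v (i + l.length) l' := by
  induction l generalizing i with
  | nil => simp [levelSum]
  | cons e l ih =>
    simp only [List.cons_append, levelSum, ih, List.length_cons]
    rw [show i + 1 + l.length = i + (l.length + 1) by ring]
    ring

/-- Telescoping of `height_append` over the prefixes of `l`. The hypothesis `hne` reconciles the
strict inequality in `height v x []` with the weak one in `levelCount v 0 x`. -/
lemma height_levelSum {x y : ℕ} {l : List ℕ} (hl : l.Pairwise (· < ·))
    (hmem : ∀ u ∈ l, x < u ∧ u < y) (hx : ∀ u ∈ l, v x < v u) (hne : ∀ z < x, v x ≠ v z)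
    (hother : ∀ u, x < u → u < y → u ∉ l → ∀ e ∈ l, v u < v e) :
    height v x l + levelSum v 0 l = levelCount v 0 x + levelSum v 1 l := by
  suffices h : ∀ l' l'', l' ++ l'' = l →
      height v x l' + levelSum v 0 l' = height v x [] + levelSum v 1 l' by
    rw [h l [] (by simp)]
    congr 1
    unfold height levelCount
    congr 1
    ext z
    simp only [Finset.mem_filter, Finset.mem_range, List.countP_nil, List.length_nil, add_zero,
      and_congr_right_iff, and_congr_left_iff]
    exact fun hz _ => ⟨le_of_lt, fun h => lt_of_le_of_ne h (hne z hz)⟩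
  intro l'
  induction l' using List.reverseRecOn with
  | nil => intro l'' _; simp [levelSum]
  | append_singleton l' e ih =>
    intro l'' h
    have ih := ih (e :: l'') (by simpa using h)
    have he : e ∈ l := by rw [← h]; simp
    have hsub : ∀ u ∈ l', u ∈ l := fun u hu => by rw [← h]; simp [hu]
    have hp : (l' ++ [e]).Pairwise (· < ·) := (List.pairwise_append.1 (h ▸ hl)).1
    have hp' := List.pairwise_append.1 hp
    have hlt : ∀ u ∈ l', u < e := fun u hu => hp'.2.2 u hu e (by simp)
    -- Since `l` is increasing, its members before `e` all belong to the prefix `l'`.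
    have hnot : ∀ u, x < u → u < e → u ∉ l' → u ∉ l := by
      intro u h1 h2 h3 h4
      rw [← h] at h4
      simp only [List.append_assoc, List.mem_append, List.mem_singleton] at h4
      rcases h4 with h4 | h4 | h4
      · exact h3 h4
      · omega
      · have := (List.pairwise_append.1 (h ▸ hl)).2.2 e (by simp) u h4
        omega
    have := height_append v (hmem e he).1 (hp'.1.imp (fun h => h.ne))
      (fun u hu => ⟨(hmem u (hsub u hu)).1, hlt u hu⟩) (hx e he)
      (fun u h1 h2 h3 => hother u h1 (h2.trans (hmem e he).2) (hnot u h1 h2 h3) e he)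
    rw [levelSum_append, levelSum_append]
    simp only [levelSum]
    rw [show 0 + l'.length = l'.length by ring, show 1 + l'.length = l'.length + 1 by ring]
    omega

/-- The comparison on which everything rests: both sides are sums of at most `l.length + 2` terms
and can be computed without access to `v`. The subtractions in the formula for the height are moved
to the other side. -/
theorem lt_iff_levelSum {x y : ℕ} {l : List ℕ} (hxy : x < y) (hl : l.Pairwise (· < ·))
    (hmem : ∀ u ∈ l, x < u ∧ u < y) (hx : ∀ u ∈ l, v x < v u) (hy : ∀ u ∈ l, v y < v u)
    (hother : ∀ u, x < u → u < y → u ∉ l → v u < max (v x) (v y)) (hne : ∀ z < x, v x ≠ v z)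
    (hne' : v x ≠ v y) :
    v y < v x ↔
      1 + levelCount v 0 x + levelSum v 1 l ≤ levelCount v l.length y + levelSum v 0 l := by
  have key := height_levelSum v hl hmem hx hne
    (fun u h1 h2 h3 e he => (hother u h1 h2 h3).trans (max_lt (hx e he) (hy e he)))
  have hnd : l.Nodup := hl.imp (fun h => h.ne)
  -- By `key` the level sums may be replaced by the height.
  suffices h : v y < v x ↔ 1 + height v x l ≤ levelCount v l.length y by
    rw [h]; omega
  rcases lt_or_gt_of_ne hne' with h | h
  · refine ⟨fun h' => absurd h h'.not_gt, fun h' => ?_⟩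
    rw [max_eq_right h.le] at hother
    rw [levelCount_eq v hxy hnd hmem h hother le_rfl] at h'
    have : ((Finset.range x).filter fun z => v y ≤ v z ∧
        larger v z x + l.countP (fun u => v z < v u) = l.length).card ≤ height v x l := by
      refine Finset.card_le_card fun z hz => ?_
      simp only [Finset.mem_filter] at hz ⊢
      exact ⟨hz.1, h.trans_le hz.2.1, hz.2.2⟩
    omega
  · refine ⟨fun _ => ?_, fun _ => h⟩
    rw [max_eq_left h.le] at hother
    -- If `v x` is the larger one, exactly the members of `l` exceed it before `y`, so `x` is
    -- counted at `y`. As `height v x l` counts only positions before `x`, this provides the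
    -- additional `1`.
    have hx' : larger v x y = l.length := by
      have : (Finset.Ioo x y).filter (fun u => v x < v u) = l.toFinset := by
        ext u
        simp only [Finset.mem_filter, Finset.mem_Ioo, List.mem_toFinset]
        refine ⟨fun ⟨⟨h1, h2⟩, h3⟩ => ?_, fun hu => ⟨hmem u hu, hx u hu⟩⟩
        by_contra hu
        exact absurd h3 (hother u h1 h2 hu).not_gt
      rw [larger, this, List.toFinset_card_of_nodup hnd]
    have hins : height v x l + 1 = (insert x ((Finset.range x).filter fun z => v x < v z ∧
        larger v z x + l.countP (fun u => v z < v u) = l.length)).card := by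
      rw [Finset.card_insert_of_notMem (by simp)]; rfl
    rw [add_comm, hins]
    refine Finset.card_le_card fun z hz => ?_
    simp only [Finset.mem_filter, Finset.mem_insert, Finset.mem_range] at hz ⊢
    rcases hz with rfl | ⟨h1, h2, h3⟩
    · exact ⟨hxy, h.le, hx'⟩
    · refine ⟨by omega, (h.trans h2).le, ?_⟩
      rw [larger_split v h1 hxy hnd hmem h2 (fun u h4 h5 h6 => (hother u h4 h5 h6).trans h2), h3]

/-- The functions `surpassed v 0`, `surpassed v 1`, … on `0, …, P - 1`, as one monotone function. -/
def profile (P i : ℕ) : ℕ := i / P * P + surpassed v (i / P) (i % P)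

lemma profile_le (P i : ℕ) : profile v P i ≤ i := by
  have h1 := surpassed_le v (i / P) (i % P)
  have h2 := Nat.div_add_mod' i P
  unfold profile
  omega

/-- Inside a chunk of `P` arguments this is `surpassed_mono`. Across chunks it holds because the
values of chunk `j` lie between `j * P` and `(j + 1) * P`. -/
lemma profile_mono {P : ℕ} (hP : 0 < P) : Monotone (profile v P) := by
  intro i j hij
  rcases (Nat.div_le_div_right hij : i / P ≤ j / P).eq_or_lt with h | h
  · unfold profile
    rw [h]
    refine Nat.add_le_add_left (surpassed_mono v _ ?_) _
    have h1 := Nat.div_add_mod' i P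
    have h2 := Nat.div_add_mod' j P
    rw [h] at h1
    omega
  · calc profile v P i ≤ i := profile_le v P i
      _ ≤ (i / P + 1) * P := by
        have h1 := Nat.div_add_mod' i P
        have h2 := Nat.mod_lt i hP
        rw [add_mul]; omega
      _ ≤ j / P * P := Nat.mul_le_mul_right P h
      _ ≤ profile v P j := Nat.le_add_right _ _

lemma profile_mul_add {P t : ℕ} (j : ℕ) (ht : t < P) :
    profile v P (j * P + t) = j * P + surpassed v j t := by
  have h1 : (j * P + t) / P = j := by
    rw [Nat.mul_comm, Nat.mul_add_div (by omega), Nat.div_eq_of_lt ht, add_zero]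
  have h2 : (j * P + t) % P = t := by
    rw [Nat.mul_comm, Nat.mul_add_mod, Nat.mod_eq_of_lt ht]
  rw [profile, h1, h2]

/-- The summand `P` cancels the difference of the offsets `j * P` and `(j + 1) * P` of the two
chunks. It is added first, so that truncated subtraction does no harm. -/
lemma levelCount_eq_profile {P y : ℕ} (j : ℕ) (hy : y + 1 < P) :
    levelCount v j y = profile v P (j * P + y) + P - profile v P ((j + 1) * P + (y + 1)) := by
  rw [profile_mul_add v j (by omega), profile_mul_add v (j + 1) hy, surpassed_eq, add_mul]
  omega

end Count

end RangeTopK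

namespace WordRAM

/-! ### Bit strings composed of fields -/

/-- The `l` least significant binary digits of `v`. -/
def natBits (l v : ℕ) : List Bool := (List.range l).map v.testBit

@[simp] lemma natBits_length (l v : ℕ) : (natBits l v).length = l := by simp [natBits]

lemma readBits_eq_of_getD {A B : List Bool} {x y l : ℕ}
    (h : ∀ t < l, A.getD (x + t) false = B.getD (y + t) false) :
    readBits A x l = readBits B y l :=
  Finset.sum_congr rfl fun t ht => by rw [h t (Finset.mem_range.1 ht)]

lemma readBits_natBits {l v : ℕ} (h : v < 2 ^ l) : readBits (natBits l v) 0 l = v := by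
  have key : ∀ m ≤ l, readBits (natBits l v) 0 m = v % 2 ^ m := by
    intro m hm
    induction m with
    | zero => simp [readBits, Nat.mod_one]
    | succ m ih =>
      have h1 : readBits (natBits l v) 0 (m + 1)
          = readBits (natBits l v) 0 m + ((natBits l v).getD m false).toNat * 2 ^ m := by
        simp [readBits, Finset.sum_range_succ]
      have h2 : (natBits l v).getD m false = v.testBit m := by
        rw [List.getD_eq_getElem _ _ (by simpa using hm)]
        simp [natBits]
      rw [h1, ih (by omega), h2, Nat.toNat_testBit, Nat.mod_pow_succ]
      ring
  rw [key l le_rfl, Nat.mod_eq_of_lt h]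

/-- The string `A` occurs in `D` at position `p`. -/
def At (D : List Bool) (p : ℕ) (A : List Bool) : Prop :=
  ∃ pre post, D = pre ++ (A ++ post) ∧ pre.length = p

lemma At.left {D A B : List Bool} {p : ℕ} (h : At D p (A ++ B)) : At D p A := by
  obtain ⟨pre, post, rfl, rfl⟩ := h
  exact ⟨pre, B ++ post, by simp, rfl⟩

lemma At.right {D A B : List Bool} {p : ℕ} (h : At D p (A ++ B)) : At D (p + A.length) B := by
  obtain ⟨pre, post, rfl, rfl⟩ := h
  exact ⟨pre ++ A, post, by simp, by simp⟩

lemma At.readBits_eq {D A : List Bool} {p x l : ℕ} (h : At D p A) (hx : x + l ≤ A.length) :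
    readBits D (p + x) l = readBits A x l := by
  obtain ⟨pre, post, rfl, rfl⟩ := h
  refine readBits_eq_of_getD fun t ht => ?_
  rw [List.getD_append_right _ _ _ _ (by omega), List.getD_append _ _ _ _ (by omega)]
  congr 1
  omega

lemma At.read {D : List Bool} {p l v : ℕ} (h : At D p (natBits l v)) (hv : v < 2 ^ l) :
    readBits D p l = v := by
  have := h.readBits_eq (x := 0) (l := l) (by simp)
  rwa [add_zero, readBits_natBits hv] at this

/-- The concatenation of `F 0`, …, `F (m - 1)`. -/
def cat (m : ℕ) (F : ℕ → List Bool) : List Bool := (List.range m).flatMap F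

lemma cat_succ (m : ℕ) (F : ℕ → List Bool) : cat (m + 1) F = cat m F ++ F m := by
  simp [cat, List.range_succ]

lemma cat_length (m : ℕ) (F : ℕ → List Bool) :
    (cat m F).length = ∑ i ∈ Finset.range m, (F i).length := by
  induction m with
  | zero => rfl
  | succ m ih => rw [cat_succ, List.length_append, ih, Finset.sum_range_succ]

lemma cat_length_const {m c : ℕ} {F : ℕ → List Bool} (h : ∀ i < m, (F i).length = c) :
    (cat m F).length = m * c := by
  rw [cat_length, Finset.sum_congr rfl (fun i hi => h i (Finset.mem_range.1 hi))]
  simp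

lemma At.nth {D : List Bool} {p m i : ℕ} {F : ℕ → List Bool} (h : At D p (cat m F)) (hi : i < m) :
    At D (p + ∑ j ∈ Finset.range i, (F j).length) (F i) := by
  rw [← cat_length]
  induction m with
  | zero => omega
  | succ m ih =>
    rw [cat_succ] at h
    rcases Nat.lt_succ_iff_lt_or_eq.1 hi with h' | rfl
    · exact ih h.left h'
    · exact h.right

lemma At.nth_const {D : List Bool} {p m i c : ℕ} {F : ℕ → List Bool} (h : At D p (cat m F))
    (hi : i < m) (hc : ∀ i < m, (F i).length = c) : At D (p + i * c) (F i) := by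
  have := h.nth hi
  rwa [Finset.sum_congr rfl (fun j hj => hc j ((Finset.mem_range.1 hj).trans hi)),
    Finset.sum_const, Finset.card_range, smul_eq_mul] at this

/-! ### Codes for monotone functions -/

/-- The map `q ↦ q + h q` is strictly increasing, hence determined by its image, a subset of `{0, …,
s + J - 1}`. -/
lemma card_monotone_le_pow (s J : ℕ) :
    (Finset.univ.filter fun h : Fin s → Fin (J + 1) => Monotone h).card ≤ 2 ^ (s + J) := by
  have hst : ∀ h : Fin s → Fin (J + 1), Monotone h → StrictMono fun q : Fin s => (q : ℕ) + (h q : ℕ) :=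
    fun h hh a b hab => add_lt_add_of_lt_of_le hab (hh hab.le)
  calc _ ≤ (Finset.range (s + J)).powerset.card := by
        refine Finset.card_le_card_of_injOn (fun h => Finset.univ.image fun q : Fin s => (q : ℕ) + (h q : ℕ))
          ?_ ?_
        · intro h _
          simp only [Finset.coe_powerset, Set.mem_preimage, Set.mem_powerset_iff]
          intro x hx
          simp only [Finset.coe_image, Finset.coe_univ, Set.image_univ, Set.mem_range] at hx
          obtain ⟨q, rfl⟩ := hx
          have := (h q).2
          simp only [Finset.coe_range, Set.mem_Iio]
          omega
        · intro h hh h' hh' heq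
          simp only [Finset.coe_filter, Finset.mem_univ, true_and, Set.mem_ofPred_eq] at hh hh'
          have h1 : Set.range (fun q : Fin s => (q : ℕ) + (h q : ℕ))
              = Set.range fun q : Fin s => (q : ℕ) + (h' q : ℕ) := by
            have := congrArg (fun A : Finset ℕ => (A : Set ℕ)) heq
            simpa using this
          have h2 := (StrictMono.range_inj (hst h hh) (hst h' hh')).1 h1
          funext q
          have := congrFun h2 q
          exact Fin.ext (by simpa using this)
    _ = 2 ^ (s + J) := by rw [Finset.card_powerset, Finset.card_range]

/-- The code is the index in a list of all monotone functions. Length `s + J` is what the space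
bound needs; the cap `L`, available because there are at most `(J + 1) ^ s` functions, keeps a code
within one word and the decoding table small. -/
lemma exists_code {s J L : ℕ} (hL : (J + 1) ^ s ≤ 2 ^ L) :
    ∃ (code : (ℕ → ℕ) → ℕ) (decode : ℕ → ℕ → ℕ), (∀ a q, decode a q ≤ J) ∧
      ∀ h, Monotone h → (∀ q < s, h q ≤ J) →
        code h < 2 ^ min (s + J) L ∧ ∀ q < s, decode (code h) q = h q := by
  let A := Finset.univ.filter fun h : Fin s → Fin (J + 1) => Monotone h
  have hA : A.card ≤ 2 ^ min (s + J) L := by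
    rcases min_choice (s + J) L with h | h <;> rw [h]
    · exact card_monotone_le_pow s J
    · refine (Finset.card_filter_le _ _).trans ?_
      simpa using hL
  let E := A.equivFin
  refine ⟨fun h => if hh : (fun q : Fin s => Fin.ofNat (J + 1) (h q)) ∈ A then E ⟨_, hh⟩ else 0,
    fun a q => if ha : a < A.card then if hq : q < s then (E.symm ⟨a, ha⟩).1 ⟨q, hq⟩ else 0 else 0,
    fun a q => ?_, fun h hm hJ => ?_⟩
  · dsimp only
    split_ifs
    · exact Nat.lt_succ_iff.1 (Fin.is_lt _)
    all_goals exact Nat.zero_le _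
  · have hval : ∀ q : Fin s, (Fin.ofNat (J + 1) (h q) : ℕ) = h q := fun q => by
      rw [Fin.val_ofNat]
      exact Nat.mod_eq_of_lt (Nat.lt_succ_of_le (hJ q q.2))
    have hh : (fun q : Fin s => Fin.ofNat (J + 1) (h q)) ∈ A := by
      simp only [A, Finset.mem_filter, Finset.mem_univ, true_and]
      intro a b hab
      rw [Fin.le_def, hval, hval]
      exact hm hab
    simp only [dif_pos hh]
    refine ⟨(Fin.is_lt _).trans_le hA, fun q hq => ?_⟩
    rw [dif_pos (Fin.is_lt _), dif_pos hq]
    simpa using hJ q hq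

/-! ### Random access to a monotone function -/

/-- Only the growth inside the blocks is added up; the jumps from one block to the next are left
out. -/
lemma sum_increments_le {F : ℕ → ℕ} (hF : Monotone F) {s : ℕ} (hs : 0 < s) (m : ℕ) :
    ∑ j ∈ Finset.range m, (F (j * s + (s - 1)) - F (j * s)) ≤ F (m * s - 1) := by
  induction m with
  | zero => simp
  | succ m ih =>
    rw [Finset.sum_range_succ]
    have h1 : F (m * s - 1) ≤ F (m * s) := hF (by omega)
    have h2 : F (m * s) ≤ F (m * s + (s - 1)) := hF (by omega)
    have h3 : (m + 1) * s - 1 = m * s + (s - 1) := by rw [add_mul]; omega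
    rw [h3]
    omega

/-- The number of low bits that are stored separately, for `m` numbers of at most `I`. -/
def lowWidth (m I : ℕ) : ℕ := Nat.log 2 (I / m)

/-- After removal of the low bits the numbers are of the order of the superblock size, so they fit
into the short fields of the block records. -/
lemma div_lowWidth_lt {m I : ℕ} (hm : 0 < m) : I / 2 ^ lowWidth m I < 2 * m := by
  rw [Nat.div_lt_iff_lt_mul (by positivity)]
  have h := Nat.lt_pow_succ_log_self (b := 2) (by norm_num) (I / m)
  rw [Nat.div_lt_iff_lt_mul hm, pow_succ] at h
  unfold lowWidth
  calc I < _ := h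
    _ = _ := by ring

/-- The low bits of `m` numbers and the total growth of their high parts together cost at most `I`:
with `b = lowWidth m I` and `I / m` positive, `m ≤ I / 2 ^ b` and `b + 1 ≤ 2 ^ b`. If `I / m = 0`,
no low bits are stored. -/
lemma mul_lowWidth_add_le (m I : ℕ) : m * lowWidth m I + I / 2 ^ lowWidth m I ≤ I := by
  rcases Nat.eq_zero_or_pos (I / m) with h0 | h0
  · simp [lowWidth, h0]
  · set b := lowWidth m I
    have h1 : 2 ^ b ≤ I / m := Nat.pow_log_le_self 2 h0.ne'
    have hm : 0 < m := by
      rcases Nat.eq_zero_or_pos m with h | h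
      · simp [h] at h0
      · exact h
    have h2 : m ≤ I / 2 ^ b := by
      rw [Nat.le_div_iff_mul_le (by positivity), mul_comm]
      exact (Nat.le_div_iff_mul_le hm).1 h1
    have h3 : b + 1 ≤ 2 ^ b := b.lt_two_pow_self
    calc m * b + I / 2 ^ b ≤ (I / 2 ^ b) * b + I / 2 ^ b := by gcongr
      _ = (I / 2 ^ b) * (b + 1) := by ring
      _ ≤ (I / 2 ^ b) * 2 ^ b := by gcongr
      _ ≤ I := Nat.div_mul_le_self _ _

/-- In the data structure `D`, the values `f i`, for `i < M`, can be found as follows. The arguments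
are divided into blocks of `s` arguments and superblocks of `g` blocks. A table at `SB` has three
`W`-bit fields for every superblock, a table at `BB` has four `h`-bit fields for every block, and a
table at `TB` decodes the blocks. All addresses are at most `E`. -/
structure Layout (W : ℕ) (D : List Bool) (SB BB TB s g h E M : ℕ) (f : ℕ → ℕ) : Prop where
  super : ∀ i < M, SB + 3 * W * (i / (s * g)) + 3 * W ≤ E
  block : ∀ i < M, BB + 4 * h * (i / s) + 4 * h ≤ E
  table : ∀ J a q, J < 2 ^ h → a < 2 ^ (s * h) → q < s →
    TB + ((J * 2 ^ (s * h) + a) * s + q) * h + h ≤ E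
  access : ∀ i < M, ∃ base ptr b base1 rel J len a val low,
    readBits D (SB + 3 * W * (i / (s * g))) W = base ∧
    readBits D (SB + 3 * W * (i / (s * g)) + W) W = ptr ∧
    readBits D (SB + 3 * W * (i / (s * g)) + 2 * W) W = b ∧
    readBits D (BB + 4 * h * (i / s)) h = base1 ∧
    readBits D (BB + 4 * h * (i / s) + h) h = rel ∧
    readBits D (BB + 4 * h * (i / s) + 2 * h) h = J ∧
    readBits D (BB + 4 * h * (i / s) + 3 * h) h = len ∧
    readBits D (ptr + s * g * b + rel) len = a ∧
    readBits D (TB + ((J * 2 ^ (s * h) + a) * s + i % s) * h) h = val ∧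
    readBits D (ptr + i % (s * g) * b) b = low ∧
    f i = base + (base1 + val) * 2 ^ b + low ∧
    b < W ∧ len ≤ s * h ∧ J < 2 ^ h ∧ a < 2 ^ (s * h) ∧ ptr + s * g * b + rel ≤ E

/-- A superblock stores the low bits of its values explicitly and, block by block, codes of the high
parts. A block of `s` arguments whose high part grows by `J` costs at most `s + J` bits, so a
superblock costs at most its size plus the growth of `f` on it. Since `f i ≤ i`, the total is at
most twice the number of arguments; records and the decoding table come on top. -/
theorem exists_layout {f : ℕ → ℕ} (hf : Monotone f) (hfi : ∀ i, f i ≤ i) {W s g h U β : ℕ}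
    (hs : 0 < s) (hg : 0 < g) (hsg : 2 * (s * g) < 2 ^ h) (hgh : g * (s * h) < 2 ^ h)
    (hW : β + U * (3 * W) + U * g * (4 * h) + 2 ^ h * 2 ^ (s * h) * s * h + 2 * (U * (s * g))
      < 2 ^ W) :
    ∃ G : List Bool, G.length ≤ U * (3 * W) + U * g * (4 * h) + 2 ^ h * 2 ^ (s * h) * s * h
        + 2 * (U * (s * g)) ∧
      ∀ D, At D β G → Layout W D β (β + U * (3 * W)) (β + U * (3 * W) + U * g * (4 * h)) s g h
        (β + G.length) (U * (s * g)) f := by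
  have hS : 0 < s * g := Nat.mul_pos hs hg
  set S₀ := s * g with hS₀
  set L := s * h with hLdef
  have hJ : ∀ J < 2 ^ h, (J + 1) ^ s ≤ 2 ^ L := fun J hJ => by
    rw [hLdef, mul_comm, pow_mul]
    exact Nat.pow_le_pow_left hJ s
  choose! code decode hdec hcode using fun J (hJ' : J < 2 ^ h) => exists_code (hJ J hJ')
  -- For superblock `u`: its growth `I u`, the number `b u` of low bits, and at offset `r` the value
  -- `R u r` relative to the start with high part `H u r`.
  let I : ℕ → ℕ := fun u => f (u * S₀ + (S₀ - 1)) - f (u * S₀)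
  let b : ℕ → ℕ := fun u => lowWidth S₀ (I u)
  let R : ℕ → ℕ → ℕ := fun u r => f (u * S₀ + r) - f (u * S₀)
  let H : ℕ → ℕ → ℕ := fun u r => R u r / 2 ^ b u
  have hH : ∀ u, Monotone (H u) := fun u x y hxy =>
    Nat.div_le_div_right (Nat.sub_le_sub_right (hf (by omega)) _)
  have hH2 : ∀ u r, r < S₀ → H u r < 2 * S₀ := fun u r hr =>
    (Nat.div_le_div_right (Nat.sub_le_sub_right (hf (by omega)) _)).trans_lt
      (div_lowWidth_lt (I := I u) hS)
  -- blocks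
  let h1 : ℕ → ℕ → ℕ → ℕ := fun u j q => H u (j * s + q) - H u (j * s)
  let J : ℕ → ℕ → ℕ := fun u j => h1 u j (s - 1)
  have hblk : ∀ j < g, ∀ q < s, j * s + q < S₀ := fun j hj q hq => by
    calc j * s + q < j * s + s := by omega
      _ = s * (j + 1) := by ring
      _ ≤ S₀ := Nat.mul_le_mul_left s hj
  have hJlt : ∀ u, ∀ j < g, J u j < 2 ^ h := fun u j hj => by
    have := hH2 u (j * s + (s - 1)) (hblk j hj _ (by omega))
    simp only [J, h1]
    omega
  have hh1 : ∀ u j, Monotone (h1 u j) := fun u j x y hxy =>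
    Nat.sub_le_sub_right (hH u (by omega)) _
  have hc := fun u j (hj : j < g) => hcode (J u j) (hJlt u j hj) (h1 u j) (hh1 u j)
    (fun q hq => hh1 u j (by omega))
  let len : ℕ → ℕ → ℕ := fun u j => min (s + J u j) L
  let cd : ℕ → ℕ → ℕ := fun u j => code (J u j) (h1 u j)
  -- sections
  let lowF : ℕ → List Bool := fun u => cat S₀ fun r => natBits (b u) (R u r % 2 ^ b u)
  let idF : ℕ → List Bool := fun u => cat g fun j => natBits (len u j) (cd u j)
  let dataF : ℕ → List Bool := fun u => lowF u ++ idF u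
  let TB := β + U * (3 * W) + U * g * (4 * h)
  let TT := 2 ^ h * 2 ^ L * s
  let DB := TB + TT * h
  let ptr : ℕ → ℕ := fun u => DB + ∑ u' ∈ Finset.range u, (dataF u').length
  let rel : ℕ → ℕ → ℕ := fun u j => ∑ j' ∈ Finset.range j, len u j'
  let supF : ℕ → List Bool := fun u =>
    natBits W (f (u * S₀)) ++ (natBits W (ptr u) ++ natBits W (b u))
  let blkF : ℕ → List Bool := fun v =>
    natBits h (H (v / g) (v % g * s)) ++ (natBits h (rel (v / g) (v % g)) ++
      (natBits h (J (v / g) (v % g)) ++ natBits h (len (v / g) (v % g))))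
  let tabF : ℕ → List Bool := fun x => natBits h (decode (x / s / 2 ^ L) (x / s % 2 ^ L) (x % s))
  have lowL : ∀ u, (lowF u).length = S₀ * b u := fun u => cat_length_const (fun _ _ => by simp)
  have idL : ∀ u, (idF u).length = ∑ j ∈ Finset.range g, len u j := fun u => by
    simp [idF, cat_length]
  -- The codes take at most `g * s = S₀` bits plus the growth of the high parts; this growth and the
  -- `S₀ * b u` low bits are at most `I u` by `mul_lowWidth_add_le`.
  have dataL : ∀ u, (dataF u).length ≤ S₀ + I u := fun u => by
    have e1 : ∑ j ∈ Finset.range g, len u j ≤ g * s + ∑ j ∈ Finset.range g, J u j := by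
      rw [← smul_eq_mul, ← Finset.card_range g, ← Finset.sum_const, Finset.card_range,
        ← Finset.sum_add_distrib]
      exact Finset.sum_le_sum fun j _ => min_le_left _ _
    have e2 := sum_increments_le (hH u) hs g
    have e3 : H u (g * s - 1) = I u / 2 ^ b u := by simp only [H, R, I, hS₀, mul_comm]
    have e4 := mul_lowWidth_add_le S₀ (I u)
    rw [e3] at e2
    simp only [dataF, List.length_append, lowL, idL]
    have : g * s = S₀ := by rw [hS₀, mul_comm]
    simp only [J, h1, b] at *
    omega
  have sumL : ∑ u ∈ Finset.range U, (dataF u).length ≤ 2 * (U * S₀) := by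
    calc _ ≤ ∑ u ∈ Finset.range U, (S₀ + I u) := Finset.sum_le_sum fun u _ => dataL u
      _ = U * S₀ + ∑ u ∈ Finset.range U, I u := by rw [Finset.sum_add_distrib]; simp
      _ ≤ U * S₀ + f (U * S₀ - 1) := Nat.add_le_add_left (sum_increments_le hf hS U) _
      _ ≤ _ := by have := hfi (U * S₀ - 1); omega
  have supL : ∀ u < U, (supF u).length = 3 * W := fun u _ => by simp [supF]; ring
  have blkL : ∀ v < U * g, (blkF v).length = 4 * h := fun v _ => by simp [blkF]; ring
  have tabL : ∀ x < TT, (tabF x).length = h := fun x _ => by simp [tabF]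
  let G := cat U supF ++ (cat (U * g) blkF ++ (cat TT tabF ++ cat U dataF))
  have hGlen : G.length = U * (3 * W) + U * g * (4 * h) + TT * h
      + ∑ u ∈ Finset.range U, (dataF u).length := by
    simp only [G, List.length_append, cat_length_const supL, cat_length_const blkL,
      cat_length_const tabL, cat_length U dataF]
    ring
  have hTT : 2 ^ h * 2 ^ L * s = TT := rfl
  rw [hTT] at hW ⊢
  refine ⟨G, by rw [hGlen]; omega, fun D hD => ?_⟩
  have a1 := hD.left
  have a2 := hD.right.left
  have a3 := hD.right.right.left
  have a4 := hD.right.right.right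
  rw [cat_length_const supL] at a2 a3 a4
  rw [cat_length_const blkL] at a3 a4
  rw [cat_length_const tabL] at a4
  have hdivu : ∀ i < U * S₀, i / S₀ < U := fun i hi => (Nat.div_lt_iff_lt_mul hS).2 hi
  have hdivv : ∀ i < U * S₀, i / s < U * g := fun i hi =>
    (Nat.div_lt_iff_lt_mul hs).2 (by rw [mul_assoc, mul_comm g s]; exact hi)
  have htab : ∀ J a q, J < 2 ^ h → a < 2 ^ L → q < s → (J * 2 ^ L + a) * s + q < TT := by
    intro J a q hJ ha hq
    calc (J * 2 ^ L + a) * s + q < (J * 2 ^ L + a) * s + s := by omega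
      _ = (J * 2 ^ L + (a + 1)) * s := by ring
      _ ≤ (J * 2 ^ L + 2 ^ L) * s := by gcongr; omega
      _ = (J + 1) * 2 ^ L * s := by ring
      _ ≤ TT := by simp only [TT]; gcongr; omega
  have hm : ∀ {m x c : ℕ}, x < m → c * x + c ≤ m * c := fun {m x c} hx => by
    calc c * x + c = (x + 1) * c := by ring
      _ ≤ m * c := Nat.mul_le_mul_right c hx
  refine ⟨fun i hi => ?_, fun i hi => ?_, fun J a q hJ ha hq => ?_, fun i hi => ?_⟩
  · have := hm (c := 3 * W) (hdivu i hi)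
    change β + 3 * W * (i / S₀) + 3 * W ≤ _
    rw [hGlen]
    omega
  · have := hm (c := 4 * h) (hdivv i hi)
    rw [hGlen]
    omega
  · have := hm (c := h) (htab J a q hJ ha hq)
    rw [mul_comm h] at this
    change β + U * (3 * W) + U * g * (4 * h) + ((J * 2 ^ L + a) * s + q) * h + h ≤ _
    rw [hGlen]
    omega
  · set u := i / S₀ with hu
    set r := i % S₀ with hr
    set v := i / s with hv
    have hvu : v / g = u := by rw [hv, Nat.div_div_eq_div_mul]
    set j := v % g with hj
    set q := i % s with hq
    have hqs : q < s := Nat.mod_lt _ hs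
    have hjg : j < g := Nat.mod_lt _ hg
    have hrS : r < S₀ := Nat.mod_lt _ hS
    have huU : u < U := hdivu i hi
    have hvU : v < U * g := hdivv i hi
    have hi' : u * S₀ + r = i := Nat.div_add_mod' i S₀
    have hr' : r = j * s + q := by
      have e1 : v * s + q = i := Nat.div_add_mod' i s
      have e2 : u * g + j = v := by rw [← hvu]; exact Nat.div_add_mod' v g
      have e3 : u * S₀ + (j * s + q) = i := by
        rw [← e1, ← e2, hS₀]; ring
      omega
    have hfW : ∀ x ≤ i, f x < 2 ^ W := fun x hx => by
      have := hfi x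
      omega
    have hIW : I u < 2 ^ W := by
      have e1 : u * S₀ + (S₀ - 1) < U * S₀ := by
        have := hm (c := S₀) huU
        rw [mul_comm S₀] at this
        omega
      have e2 := hfi (u * S₀ + (S₀ - 1))
      simp only [I]
      omega
    have hWpos : 0 < W := by
      by_contra h0
      obtain rfl : W = 0 := by omega
      have : 0 < U * S₀ := Nat.mul_pos (by omega) hS
      simp only [pow_zero] at hW
      omega
    have hbW : b u < W := by
      simp only [b, lowWidth]
      exact Nat.log_lt_of_lt_pow' hWpos.ne' ((Nat.div_le_self _ _).trans_lt hIW)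
    have hb2 : b u < 2 ^ W := hbW.trans W.lt_two_pow_self
    -- superblock
    have s1 := a1.nth_const huU supL
    have s1a := s1.left
    have s1b := s1.right.left
    have s1c := s1.right.right
    simp only [natBits_length] at s1b s1c
    -- block
    have b1 := a2.nth_const hvU blkL
    simp only [blkF] at b1
    rw [hvu, ← hj] at b1
    have b1a := b1.left
    have b1b := b1.right.left
    have b1c := b1.right.right.left
    have b1d := b1.right.right.right
    simp only [natBits_length] at b1b b1c b1d
    -- data
    have d1 := a4.nth huU
    have d1a := (d1.left.nth_const hrS (c := b u) (fun _ _ => by simp))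
    have d1b := d1.right.nth hjg
    have hptr : β + U * (3 * W) + U * g * (4 * h) + TT * h
        + ∑ u' ∈ Finset.range u, (dataF u').length = ptr u := rfl
    rw [hptr] at d1a d1b
    simp only [natBits_length, lowL] at d1b
    have hrel : ∑ j' ∈ Finset.range j, len u j' = rel u j := rfl
    rw [hrel] at d1b
    -- bounds
    have hlen : len u j ≤ L := min_le_right _ _
    have hL' : L ≤ g * L := Nat.le_mul_of_pos_left L hg
    have hrelb : rel u j ≤ g * L := by
      calc rel u j ≤ ∑ j' ∈ Finset.range j, L := Finset.sum_le_sum fun _ _ => min_le_right _ _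
        _ = j * L := by simp
        _ ≤ g * L := Nat.mul_le_mul_right L hjg.le
    have hcd := (hc u j hjg).1
    have hcd' : cd u j < 2 ^ L := hcd.trans_le (Nat.pow_le_pow_right two_pos hlen)
    have hsumu : ∑ u' ∈ Finset.range u, (dataF u').length + (dataF u).length
        ≤ ∑ u' ∈ Finset.range U, (dataF u').length := by
      rw [← Finset.sum_range_succ]
      exact Finset.sum_le_sum_of_subset (Finset.range_mono (by omega))
    have hptrW : ptr u < 2 ^ W := by
      simp only [ptr, DB, TB]
      omega
    have hrel2 : rel u j ≤ ∑ j ∈ Finset.range g, len u j :=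
      Finset.sum_le_sum_of_subset (Finset.range_mono hjg.le)
    have hend : ptr u + S₀ * b u + rel u j ≤ β + G.length := by
      simp only [dataF, List.length_append, lowL, idL] at hsumu
      rw [hGlen]
      simp only [ptr, DB, TB]
      simp only [dataF, List.length_append, lowL, idL]
      omega
    -- the table
    have t1 := a3.nth_const (htab (J u j) (cd u j) q (hJlt u j hjg) hcd' hqs) tabL
    have hx1 : ((J u j * 2 ^ L + cd u j) * s + q) / s = J u j * 2 ^ L + cd u j := by
      rw [mul_comm _ s, Nat.mul_add_div hs, Nat.div_eq_of_lt hqs, add_zero]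
    have hx2 : ((J u j * 2 ^ L + cd u j) * s + q) % s = q := by
      rw [mul_comm _ s, Nat.mul_add_mod, Nat.mod_eq_of_lt hqs]
    have hx3 : (J u j * 2 ^ L + cd u j) / 2 ^ L = J u j := by
      rw [mul_comm _ (2 ^ L), Nat.mul_add_div (by positivity), Nat.div_eq_of_lt hcd', add_zero]
    have hx4 : (J u j * 2 ^ L + cd u j) % 2 ^ L = cd u j := by
      rw [mul_comm _ (2 ^ L), Nat.mul_add_mod, Nat.mod_eq_of_lt hcd']
    simp only [tabF] at t1
    rw [hx1, hx2, hx3, hx4, (hc u j hjg).2 q hqs] at t1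
    have hHr : H u r = H u (j * s) + h1 u j q := by
      simp only [h1]
      rw [hr']
      have := hH u (show j * s ≤ j * s + q by omega)
      omega
    refine ⟨f (u * S₀), ptr u, b u, H u (j * s), rel u j, J u j, len u j, cd u j, h1 u j q,
      R u r % 2 ^ b u, ?_, ?_, ?_, ?_, ?_, ?_, ?_, ?_, ?_, ?_, ?_, hbW, hlen, hJlt u j hjg, hcd', hend⟩
    · rw [mul_comm (3 * W)]
      exact s1a.read (hfW _ (by omega))
    · rw [mul_comm (3 * W)]
      exact s1b.read hptrW
    · rw [mul_comm (3 * W), two_mul, ← add_assoc]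
      exact s1c.read hb2
    · rw [mul_comm (4 * h)]
      exact b1a.read ((hH2 u _ (by have := hblk j hjg 0 hs; omega)).trans hsg)
    · rw [mul_comm (4 * h)]
      exact b1b.read (hrelb.trans_lt hgh)
    · rw [mul_comm (4 * h), two_mul, ← add_assoc]
      exact b1c.read (hJlt u j hjg)
    · rw [mul_comm (4 * h), show 3 * h = h + h + h by ring, ← add_assoc, ← add_assoc]
      exact b1d.read (by omega)
    · exact d1b.read hcd
    · refine t1.read (lt_of_le_of_lt ?_ (hJlt u j hjg))
      exact hh1 u j (by omega)
    · exact d1a.read (Nat.mod_lt _ (by positivity))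
    · rw [← hHr]
      have e1 : f (u * S₀) ≤ f i := hf (by omega)
      have e2 : R u r = f i - f (u * S₀) := by simp only [R]; rw [hi']
      have e3 : H u r * 2 ^ b u + R u r % 2 ^ b u = R u r := Nat.div_add_mod' _ _
      omega

/-! ### Evaluation of the stored functions -/

instance : Add Ex := ⟨.bin .add⟩
instance : Sub Ex := ⟨.bin .sub⟩
instance : Mul Ex := ⟨.bin .mul⟩
instance : Div Ex := ⟨.bin .div⟩

/-- `a` modulo `b` -/
def Ex.mod (a b : Ex) : Ex := a - a / b * b

section Ev

variable {w : ℕ} {D : List Bool} {s : State} {a b : Ex} {x y : ℕ}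

lemma Ev.reg {r v : ℕ} (h : s.reg r = v) (hr : r < 49) (hv : v < 2 ^ w) :
    Ev w D s (.var r) v := by
  subst h
  exact .var hr hv

lemma Ev.add (ha : Ev w D s a x) (hb : Ev w D s b y) (h : x + y < 2 ^ w) :
    Ev w D s (a + b) (x + y) := Ev.bin (o := .add) ha hb h

lemma Ev.sub (ha : Ev w D s a x) (hb : Ev w D s b y) : Ev w D s (a - b) (x - y) :=
  Ev.bin (o := .sub) ha hb ((Nat.sub_le _ _).trans_lt ha.lt)

lemma Ev.mul (ha : Ev w D s a x) (hb : Ev w D s b y) (h : x * y < 2 ^ w) :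
    Ev w D s (a * b) (x * y) := Ev.bin (o := .mul) ha hb h

lemma Ev.div (ha : Ev w D s a x) (hb : Ev w D s b y) : Ev w D s (a / b) (x / y) :=
  Ev.bin (o := .div) ha hb ((Nat.div_le_self _ _).trans_lt ha.lt)

lemma Ev.mod (ha : Ev w D s a x) (hb : Ev w D s b y) : Ev w D s (a.mod b) (x % y) := by
  have h := Nat.div_add_mod' x y
  have := ha.sub ((ha.div hb).mul hb ((Nat.div_mul_le_self x y).trans_lt ha.lt))
  rwa [show x - x / y * y = x % y by omega] at this

lemma Ev.lt' (ha : Ev w D s a x) (hb : Ev w D s b y) (hw : 0 < w) :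
    Ev w D s (.bin .lt a b) (if x < y then 1 else 0) :=
  Ev.bin (o := .lt) ha hb (by
    have : 1 < 2 ^ w := Nat.one_lt_two_pow hw.ne'
    simp only [Op.eval]; split_ifs <;> omega)

end Ev

/-- Field number `c` of the record of the superblock that contains the argument `i`. -/
def superEx (i : Ex) (c : ℕ) : Ex :=
  .rd (.var 9 + .lit 3 * .var 0 * (i / .var 13) + .lit c * .var 0) (.var 0)

/-- Field number `c` of the record of the block that contains the argument `i`. -/
def blockEx (i : Ex) (c : ℕ) : Ex :=
  .rd (.var 10 + .lit 4 * .var 14 * (i / .var 12) + .lit c * .var 14) (.var 14)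

/-- The code of the block that contains the argument `i`. -/
def codeEx (i : Ex) : Ex :=
  .rd (superEx i 1 + .var 13 * superEx i 2 + blockEx i 1) (blockEx i 3)

/-- The value that is decoded with the table. -/
def tableEx (i : Ex) : Ex :=
  .rd (.var 11 + ((blockEx i 2 * .var 15 + codeEx i) * .var 12 + i.mod (.var 12)) * .var 14)
    (.var 14)

/-- The low bits of the value for the argument `i`. -/
def lowEx (i : Ex) : Ex :=
  .rd (superEx i 1 + i.mod (.var 13) * superEx i 2) (superEx i 2)

/-- The value for the argument `i`. -/
def accessEx (i : Ex) : Ex :=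
  superEx i 0 + (blockEx i 0 + tableEx i) * .bin .shl (.lit 1) (superEx i 2) + lowEx i

/-- The registers contain the parameters of a layout. -/
structure LayoutRegs (s : State) (W SB BB TB sz g h : ℕ) : Prop where
  r0 : s.reg 0 = W
  r9 : s.reg 9 = SB
  r10 : s.reg 10 = BB
  r11 : s.reg 11 = TB
  r12 : s.reg 12 = sz
  r13 : s.reg 13 = sz * g
  r14 : s.reg 14 = h
  r15 : s.reg 15 = 2 ^ (sz * h)

/-- No overflow occurs: intermediate numbers in address computations are bounded by an address,
hence by `E`, and those in the final sum by `f i`. -/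
theorem Ev.access {W SB BB TB sz g h E M i : ℕ} {f : ℕ → ℕ} {D : List Bool} {s : State} {e : Ex}
    (hL : Layout W D SB BB TB sz g h E M f) (hR : LayoutRegs s W SB BB TB sz g h)
    (hE : E < 2 ^ W) (hsz : 0 < sz) (hg : 0 < g) (hh : 0 < h) (hsh : sz * h < W)
    (hsg : sz * g < 2 ^ W) (hiM : i < M) (hf : f i < 2 ^ W) (hi : Ev W D s e i) :
    Ev W D s (accessEx e) (f i) := by
  obtain ⟨base, ptr, b, base1, rel, J, len, a, val, low, h1, h2, h3, h4, h5, h6, h7, h8, h9, h10,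
    h11, hb, hlen, hJ, ha, hend⟩ := hL.access i hiM
  have hsup := hL.super i hiM
  have hblk := hL.block i hiM
  have htab := hL.table J a (i % sz) hJ ha (Nat.mod_lt _ hsz)
  have hhW : h ≤ sz * h := Nat.le_mul_of_pos_left h hsz
  have hszW : sz ≤ sz * h := Nat.le_mul_of_pos_right sz hh
  have hWW : W < 2 ^ W := W.lt_two_pow_self
  -- Word lengths `1` and `2` contradict `3 * W ≤ E < 2 ^ W`, so `2 ^ W` is at least `8`.
  have c0 : ∀ c < 5, Ev W D s (.lit c) c := fun c hc => by
    refine .lit ?_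
    have : 3 * W ≤ E := by omega
    rcases Nat.lt_or_ge W 2 with h' | h'
    · obtain rfl : W = 1 := by omega
      omega
    · have : 2 ^ 2 ≤ 2 ^ W := Nat.pow_le_pow_right two_pos h'
      rcases Nat.lt_or_ge W 3 with h'' | h''
      · obtain rfl : W = 2 := by omega
        omega
      · have : 2 ^ 3 ≤ 2 ^ W := Nat.pow_le_pow_right two_pos h''
        omega
  have r0 : Ev W D s (.var 0) W := .reg hR.r0 (by omega) hWW
  have r9 : Ev W D s (.var 9) SB := .reg hR.r9 (by omega) (by omega)
  have r10 : Ev W D s (.var 10) BB := .reg hR.r10 (by omega) (by omega)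
  have r11 : Ev W D s (.var 11) TB := .reg hR.r11 (by omega) (by omega)
  have r12 : Ev W D s (.var 12) sz := .reg hR.r12 (by omega) (by omega)
  have r13 : Ev W D s (.var 13) (sz * g) := .reg hR.r13 (by omega) (by omega)
  have r14 : Ev W D s (.var 14) h := .reg hR.r14 (by omega) (by omega)
  have r15 : Ev W D s (.var 15) (2 ^ (sz * h)) :=
    .reg hR.r15 (by omega) (Nat.pow_lt_pow_right (by norm_num) hsh)
  have hsuper : ∀ c < 3, Ev W D s (superEx e c)
      (readBits D (SB + 3 * W * (i / (sz * g)) + c * W) W) := fun c hc => by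
    have hcW : c * W ≤ 2 * W := Nat.mul_le_mul_right W (by omega)
    exact ((r9.add (((c0 3 (by omega)).mul r0 (by omega)).mul (hi.div r13) (by omega)) (by omega)).add
      ((c0 c (by omega)).mul r0 (by omega)) (by omega)).rd r0 le_rfl
  have hblock : ∀ c < 4, Ev W D s (blockEx e c)
      (readBits D (BB + 4 * h * (i / sz) + c * h) h) := fun c hc => by
    have hcW : c * h ≤ 3 * h := Nat.mul_le_mul_right h (by omega)
    exact ((r10.add (((c0 4 (by omega)).mul r14 (by omega)).mul (hi.div r12) (by omega)) (by omega)).add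
      ((c0 c (by omega)).mul r14 (by omega)) (by omega)).rd r14 (by omega)
  have s0 := hsuper 0 (by omega)
  have s1 := hsuper 1 (by omega)
  have s2 := hsuper 2 (by omega)
  have b0 := hblock 0 (by omega)
  have b1 := hblock 1 (by omega)
  have b2 := hblock 2 (by omega)
  have b3 := hblock 3 (by omega)
  rw [zero_mul, add_zero, h1] at s0
  rw [one_mul, h2] at s1
  rw [h3] at s2
  rw [zero_mul, add_zero, h4] at b0
  rw [one_mul, h5] at b1
  rw [h6] at b2
  rw [h7] at b3
  have hcode : Ev W D s (codeEx e) a := by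
    have := ((s1.add (r13.mul s2 (by omega)) (by omega)).add b1 (by omega)).rd b3 (by omega)
    rwa [h8] at this
  have t1 : (J * 2 ^ (sz * h) + a) * sz ≤ ((J * 2 ^ (sz * h) + a) * sz + i % sz) * h := by
    refine le_trans ?_ (Nat.le_mul_of_pos_right _ hh)
    omega
  have t2 : J * 2 ^ (sz * h) + a ≤ (J * 2 ^ (sz * h) + a) * sz := Nat.le_mul_of_pos_right _ hsz
  have t3 : (J * 2 ^ (sz * h) + a) * sz + i % sz ≤
      ((J * 2 ^ (sz * h) + a) * sz + i % sz) * h := Nat.le_mul_of_pos_right _ hh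
  have htable : Ev W D s (tableEx e) val := by
    have := (r11.add (((((b2.mul r15 (by omega)).add hcode (by omega)).mul r12 (by omega)).add
      (hi.mod r12) (by omega)).mul r14 (by omega)) (by omega)).rd r14 (by omega)
    rwa [h9] at this
  have l1 : i % (sz * g) * b ≤ sz * g * b :=
    Nat.mul_le_mul_right b (Nat.mod_lt _ (Nat.mul_pos hsz hg)).le
  have hlow : Ev W D s (lowEx e) low := by
    have := (s1.add ((hi.mod r13).mul s2 (by omega)) (by omega)).rd s2 hb.le
    rwa [h10] at this
  have hshl : Ev W D s (.bin .shl (.lit 1) (superEx e 2)) (2 ^ b) := by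
    have := Ev.bin (o := .shl) (c0 1 (by omega)) s2 (by
      rw [Op.eval, Nat.one_shiftLeft]
      exact Nat.pow_lt_pow_right (by norm_num) hb)
    rwa [Op.eval, Nat.one_shiftLeft] at this
  have f1 : base1 + val ≤ (base1 + val) * 2 ^ b := Nat.le_mul_of_pos_right _ (by positivity)
  rw [h11] at hf ⊢
  exact (s0.add ((b0.add htable (by omega)).mul hshl (by omega)) (by omega)).add hlow (by omega)

/-- The number of elements at least as large as that at position `y`, with `j` larger elements in
between. -/
def levelEx (j y : Ex) : Ex :=
  accessEx (j * .var 16 + y) + .var 16 - accessEx ((j + .lit 1) * .var 16 + (y + .lit 1))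

open RangeTopK in
-- The hypothesis `hj` guarantees that both chunks involved, `j` and `j + 1`, belong to the stored
-- part of the profile.
theorem Ev.level {β : Type*} [LinearOrder β] {v : ℕ → β}
    {W SB BB TB sz g h E M P j y : ℕ} {D : List Bool} {s : State} {ej ey : Ex}
    (hL : Layout W D SB BB TB sz g h E M (profile v P)) (hR : LayoutRegs s W SB BB TB sz g h)
    (hE : E < 2 ^ W) (hsz : 0 < sz) (hg : 0 < g) (hh : 0 < h) (hsh : sz * h < W)
    (hsg : sz * g < 2 ^ W) (hP : s.reg 16 = P) (hM : 2 * M < 2 ^ W) (hy : y + 1 < P)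
    (hj : (j + 2) * P ≤ M) (hej : Ev W D s ej j) (hey : Ev W D s ey y) :
    Ev W D s (levelEx ej ey) (levelCount v j y) := by
  have e1 : (j + 2) * P = j * P + 2 * P := by ring
  have e2 : (j + 1) * P = j * P + P := by ring
  have e3 : j + 1 ≤ (j + 1) * P := Nat.le_mul_of_pos_right _ (by omega)
  have hacc : ∀ {e i}, Ev W D s e i → i < M → Ev W D s (accessEx e) (profile v P i) :=
    fun he hi => Ev.access hL hR hE hsz hg hh hsh hsg hi
      ((profile_le v P _).trans_lt (by omega)) he
  have rP : Ev W D s (.var 16) P := .reg hP (by omega) (by omega)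
  have l1 : Ev W D s (.lit 1) 1 := .lit (by omega)
  rw [levelCount_eq_profile v j hy]
  have h1 := profile_le v P (j * P + y)
  exact ((hacc ((hej.mul rP (by omega)).add hey (by omega)) (by omega)).add rP (by omega)).sub
    (hacc (((hej.add l1 (by omega)).mul rP (by omega)).add (hey.add l1 (by omega)) (by omega))
      (by omega))

end WordRAM

namespace RangeTopK

/-! ### Merging two sorted lists -/

/-- Insertion into a sorted list. -/
def bubble : ℕ → List ℕ → List ℕ
  | x, [] => [x]
  | x, e :: l => if x < e then x :: bubble e l else e :: bubble x l

lemma bubble_perm (x : ℕ) (l : List ℕ) : (bubble x l).Perm (x :: l) := by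
  induction l generalizing x with
  | nil => exact .refl _
  | cons e l ih =>
    rw [bubble]
    split_ifs
    · exact (ih e).cons x
    · exact ((ih x).cons e).trans (.swap x e l)

lemma bubble_sorted {x : ℕ} {l : List ℕ} (hl : l.Pairwise (· < ·)) (hx : x ∉ l) :
    (bubble x l).Pairwise (· < ·) := by
  induction l generalizing x with
  | nil => simp [bubble]
  | cons e l ih =>
    rw [List.pairwise_cons] at hl
    rw [List.mem_cons, not_or] at hx
    have he : e ∉ l := fun h => lt_irrefl _ (hl.1 e h)
    rw [bubble]
    split_ifs with h
    · refine List.pairwise_cons.2 ⟨fun y hy => ?_, ih hl.2 he⟩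
      rcases List.mem_cons.1 ((bubble_perm e l).mem_iff.1 hy) with rfl | hy
      · exact h
      · exact h.trans (hl.1 y hy)
    · refine List.pairwise_cons.2 ⟨fun y hy => ?_, ih hl.2 hx.2⟩
      rcases List.mem_cons.1 ((bubble_perm x l).mem_iff.1 hy) with rfl | hy
      · exact lt_of_le_of_ne (not_lt.1 h) (Ne.symm hx.1)
      · exact hl.1 y hy

section Merge

variable {β : Type*} [LinearOrder β] (v : ℕ → β)

/-- Merge two lists of positions that are sorted by decreasing elements. -/
def mergeDesc (A B : List ℕ) : List ℕ := List.merge A B fun p q => decide (v q ≤ v p)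

lemma mergeDesc_perm (A B : List ℕ) : (mergeDesc v A B).Perm (A ++ B) :=
  List.merge_perm_append _

lemma mergeDesc_sorted {A B : List ℕ} (hA : A.Pairwise fun p q => v q < v p)
    (hB : B.Pairwise fun p q => v q < v p) (hAB : ∀ p ∈ A, ∀ q ∈ B, v p ≠ v q) :
    (mergeDesc v A B).Pairwise fun p q => v q < v p := by
  have h1 : (mergeDesc v A B).Pairwise fun p q => decide (v q ≤ v p) = true := by
    refine List.pairwise_merge ?_ ?_ A B ?_ ?_
    · intro a b c hab hbc
      simp only [decide_eq_true_eq] at *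
      exact hbc.trans hab
    · intro a b
      simp only [Bool.or_eq_true, decide_eq_true_eq]
      exact le_total _ _
    · exact hA.imp fun h => by simpa using h.le
    · exact hB.imp fun h => by simpa using h.le
  have h2 : (mergeDesc v A B).Pairwise fun p q => v p ≠ v q := by
    refine ((mergeDesc_perm v A B).pairwise_iff (fun h => Ne.symm h)).2 ?_
    rw [List.pairwise_append]
    exact ⟨hA.imp fun h => h.ne', hB.imp fun h => h.ne', hAB⟩
  exact (h1.and h2).imp fun h => lt_of_le_of_ne (by simpa using h.1) (Ne.symm h.2)

lemma mergeDesc_nil_left (B : List ℕ) : mergeDesc v [] B = B := by simp [mergeDesc]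

lemma mergeDesc_nil_right (A : List ℕ) : mergeDesc v A [] = A := by simp [mergeDesc]

lemma mergeDesc_cons_left {x y : ℕ} {A B : List ℕ} (h : v y < v x) :
    mergeDesc v (x :: A) (y :: B) = x :: mergeDesc v A (y :: B) := by
  simp [mergeDesc, h.le]

lemma mergeDesc_cons_right {x y : ℕ} {A B : List ℕ} (h : v x < v y) :
    mergeDesc v (x :: A) (y :: B) = y :: mergeDesc v (x :: A) B := by
  simp [mergeDesc, h]

/-- The state of the merging after `i₀` elements of `A` and `i₁` elements of `B`: these elements
are, in decreasing order, the list `E`, and in the order of their positions the list `arr`. -/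
structure Merging (A B : List ℕ) (i₀ i₁ : ℕ) (E arr : List ℕ) : Prop where
  le₀ : i₀ ≤ A.length
  le₁ : i₁ ≤ B.length
  eq : mergeDesc v A B = E ++ mergeDesc v (A.drop i₀) (B.drop i₁)
  perm : E.Perm (A.take i₀ ++ B.take i₁)
  arr_perm : arr.Perm E
  arr_sorted : arr.Pairwise (· < ·)

lemma Merging.zero (A B : List ℕ) : Merging v A B 0 0 [] [] :=
  ⟨Nat.zero_le _, Nat.zero_le _, by simp, by simp, .refl _, .nil⟩

variable {v} {A B E arr : List ℕ} {i₀ i₁ : ℕ}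

lemma Merging.length (h : Merging v A B i₀ i₁ E arr) : E.length = i₀ + i₁ := by
  rw [h.perm.length_eq, List.length_append, List.length_take, List.length_take,
    min_eq_left h.le₀, min_eq_left h.le₁]

lemma Merging.arr_length (h : Merging v A B i₀ i₁ E arr) : arr.length = i₀ + i₁ := by
  rw [h.arr_perm.length_eq, h.length]

lemma Merging.arr_mem (h : Merging v A B i₀ i₁ E arr) (u : ℕ) :
    u ∈ arr ↔ u ∈ A.take i₀ ∨ u ∈ B.take i₁ := by
  rw [h.arr_perm.mem_iff, h.perm.mem_iff, List.mem_append]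

lemma notMem_take {l : List ℕ} (hl : l.Nodup) {i : ℕ} (hi : i < l.length) : l[i] ∉ l.take i := by
  intro h
  obtain ⟨j, hj, he⟩ := List.mem_iff_getElem.1 h
  rw [List.getElem_take] at he
  have := (hl.getElem_inj_iff).1 he
  simp at hj
  omega

lemma Merging.step₀ (h : Merging v A B i₀ i₁ E arr) (hi : i₀ < A.length) (hA : A.Nodup)
    (hAB : ∀ p ∈ A, p ∉ B) (hB : ∀ hi₁ : i₁ < B.length, v B[i₁] < v A[i₀]) :
    Merging v A B (i₀ + 1) i₁ (E ++ [A[i₀]]) (bubble A[i₀] arr) := by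
  refine ⟨hi, h.le₁, ?_, ?_, ?_, ?_⟩
  · rw [h.eq, List.append_assoc, List.drop_eq_getElem_cons hi]
    congr 1
    rcases h.le₁.lt_or_eq with h1 | h1
    · rw [List.drop_eq_getElem_cons h1, mergeDesc_cons_left v (hB h1)]; rfl
    · rw [h1, List.drop_length, mergeDesc_nil_right, mergeDesc_nil_right]; rfl
  · rw [List.take_succ_eq_append_getElem hi]
    refine (h.perm.append_right _).trans ?_
    simp only [List.append_assoc]
    exact List.perm_append_comm.append_left _
  · refine (bubble_perm _ _).trans ((h.arr_perm.cons _).trans ?_)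
    exact (List.perm_append_singleton _ _).symm
  · refine bubble_sorted h.arr_sorted fun hm => ?_
    rcases (h.arr_mem _).1 hm with h1 | h1
    · exact notMem_take hA hi h1
    · exact hAB _ (List.getElem_mem _) (List.mem_of_mem_take h1)

lemma Merging.step₁ (h : Merging v A B i₀ i₁ E arr) (hi : i₁ < B.length) (hB : B.Nodup)
    (hAB : ∀ p ∈ A, p ∉ B) (hA : ∀ hi₀ : i₀ < A.length, v A[i₀] < v B[i₁]) :
    Merging v A B i₀ (i₁ + 1) (E ++ [B[i₁]]) (bubble B[i₁] arr) := by
  refine ⟨h.le₀, hi, ?_, ?_, ?_, ?_⟩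
  · rw [h.eq, List.append_assoc, List.drop_eq_getElem_cons hi]
    congr 1
    rcases h.le₀.lt_or_eq with h1 | h1
    · rw [List.drop_eq_getElem_cons h1, mergeDesc_cons_right v (hA h1)]; rfl
    · rw [h1, List.drop_length, mergeDesc_nil_left, mergeDesc_nil_left]; rfl
  · rw [List.take_succ_eq_append_getElem hi]
    refine (h.perm.append_right _).trans ?_
    simp only [List.append_assoc]
    exact .refl _
  · refine (bubble_perm _ _).trans ((h.arr_perm.cons _).trans ?_)
    exact (List.perm_append_singleton _ _).symm
  · refine bubble_sorted h.arr_sorted fun hm => ?_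
    rcases (h.arr_mem _).1 hm with h1 | h1
    · exact hAB _ (List.mem_of_mem_take h1) (List.getElem_mem _)
    · exact notMem_take hB hi h1

/-- `A` and `B` contain positions in `lo, …, hi`, in decreasing order of their elements; `A`
consists of largest even positions of this range, and `B` of largest odd positions. -/
structure Candidates (v : ℕ → β) (lo hi : ℕ) (A B : List ℕ) : Prop where
  even : ∀ p ∈ A, p % 2 = 0
  odd : ∀ p ∈ B, p % 2 = 1
  mem₀ : ∀ p ∈ A, lo ≤ p ∧ p ≤ hi
  mem₁ : ∀ p ∈ B, lo ≤ p ∧ p ≤ hi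
  sorted₀ : A.Pairwise fun p q => v q < v p
  sorted₁ : B.Pairwise fun p q => v q < v p
  max₀ : ∀ p, lo ≤ p → p ≤ hi → p % 2 = 0 → p ∉ A → ∀ q ∈ A, v p < v q
  max₁ : ∀ p, lo ≤ p → p ≤ hi → p % 2 = 1 → p ∉ B → ∀ q ∈ B, v p < v q
  inj : ∀ p ≤ hi, ∀ q ≤ hi, v p = v q → p = q

lemma Candidates.disjoint {lo hi : ℕ} (h : Candidates v lo hi A B) : ∀ p ∈ A, p ∉ B :=
  fun p hp hq => by
    have := h.even p hp
    have := h.odd p hq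
    omega

lemma Candidates.nodup₀ {lo hi : ℕ} (h : Candidates v lo hi A B) : A.Nodup :=
  h.sorted₀.imp fun h => by rintro rfl; exact lt_irrefl _ h

lemma Candidates.nodup₁ {lo hi : ℕ} (h : Candidates v lo hi A B) : B.Nodup :=
  h.sorted₁.imp fun h => by rintro rfl; exact lt_irrefl _ h

lemma Candidates.ne {lo hi : ℕ} (h : Candidates v lo hi A B) : ∀ p ∈ A, ∀ q ∈ B, v p ≠ v q :=
  fun p hp q hq he => by
    have := h.inj p (h.mem₀ p hp).2 q (h.mem₁ q hq).2 he
    exact h.disjoint p hp (this ▸ hq)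

lemma lt_of_not_mem_take {l : List ℕ} (hs : l.Pairwise fun p q => v q < v p) {i u : ℕ}
    (hi : i < l.length) (hu : u ∈ l → u ∉ l.take i) (hne : u ≠ l[i])
    (hmax : u ∉ l → v u < v l[i]) : v u < v l[i] := by
  by_cases hm : u ∈ l
  · obtain ⟨j, hj, rfl⟩ := List.mem_iff_getElem.1 hm
    have hji : ¬ j < i := fun hlt => hu hm (by
      rw [List.mem_iff_getElem]
      exact ⟨j, by simp; omega, by simp⟩)
    have : j ≠ i := by rintro rfl; exact hne rfl
    exact List.pairwise_iff_getElem.1 hs i j hi hj (by omega)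
  · exact hmax hm

/-- The known positions strictly between `x` and `y`. -/
def between (x y : ℕ) (arr : List ℕ) : List ℕ := arr.filter fun e => x < e ∧ e < y

/-- Supplies the hypotheses of `lt_iff_levelSum`. Known positions precede both heads in the sorted
merge, so their elements are larger. An unknown position between the heads lies in the query range,
and its element is smaller than the head of its own row, whether it comes later in that row's list
or is missing from it. -/
lemma Merging.lt_iff {lo hi x y : ℕ} (hc : Candidates v lo hi A B) (h : Merging v A B i₀ i₁ E arr)
    (h₀ : i₀ < A.length) (h₁ : i₁ < B.length)
    (hxy : x = A[i₀] ∧ y = B[i₁] ∨ x = B[i₁] ∧ y = A[i₀]) (hlt : x < y) :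
    v y < v x ↔ 1 + levelCount v 0 x + levelSum v 1 (between x y arr)
      ≤ levelCount v (between x y arr).length y + levelSum v 0 (between x y arr) := by
  have hA : A[i₀] ∈ A := List.getElem_mem _
  have hB : B[i₁] ∈ B := List.getElem_mem _
  have hfull := mergeDesc_sorted v hc.sorted₀ hc.sorted₁ hc.ne
  rw [h.eq, List.drop_eq_getElem_cons h₀, List.drop_eq_getElem_cons h₁] at hfull
  have hbig : ∀ u ∈ arr, v A[i₀] < v u ∧ v B[i₁] < v u := by
    intro u hu
    have huE := h.arr_perm.mem_iff.1 hu
    have := (List.pairwise_append.1 hfull).2.2 u huE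
    constructor
    · exact this _ ((mergeDesc_perm v _ _).mem_iff.2
        (List.mem_append_left _ List.mem_cons_self))
    · exact this _ ((mergeDesc_perm v _ _).mem_iff.2
        (List.mem_append_right _ List.mem_cons_self))
  have hother : ∀ u, x < u → u < y → u ∉ arr → v u < max (v A[i₀]) (v B[i₁]) := by
    intro u h1 h2 h3
    have hlo : lo ≤ u ∧ u ≤ hi ∧ u ≠ A[i₀] ∧ u ≠ B[i₁] := by
      have := hc.mem₀ _ hA
      have := hc.mem₁ _ hB
      rcases hxy with ⟨rfl, rfl⟩ | ⟨rfl, rfl⟩ <;> omega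
    rw [h.arr_mem, not_or] at h3
    -- The parity of a position is its row.
    rcases Nat.mod_two_eq_zero_or_one u with h4 | h4
    · exact (lt_of_not_mem_take hc.sorted₀ h₀ (fun _ => h3.1) hlo.2.2.1
        (fun hm => hc.max₀ u hlo.1 hlo.2.1 h4 hm _ hA)).trans_le (le_max_left _ _)
    · exact (lt_of_not_mem_take hc.sorted₁ h₁ (fun _ => h3.2) hlo.2.2.2
        (fun hm => hc.max₁ u hlo.1 hlo.2.1 h4 hm _ hB)).trans_le (le_max_right _ _)
  have hhi : x ≤ hi ∧ y ≤ hi := by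
    have := hc.mem₀ _ hA
    have := hc.mem₁ _ hB
    rcases hxy with ⟨rfl, rfl⟩ | ⟨rfl, rfl⟩ <;> omega
  refine lt_iff_levelSum v hlt (h.arr_sorted.filter _) (fun u hu => ?_) (fun u hu => ?_)
    (fun u hu => ?_) (fun u h1 h2 h3 => ?_) (fun z hz he => ?_) (fun he => ?_)
  · simpa using (List.mem_filter.1 hu).2
  · have := hbig u (List.mem_filter.1 hu).1
    rcases hxy with ⟨rfl, rfl⟩ | ⟨rfl, rfl⟩
    exacts [this.1, this.2]
  · have := hbig u (List.mem_filter.1 hu).1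
    rcases hxy with ⟨rfl, rfl⟩ | ⟨rfl, rfl⟩
    exacts [this.2, this.1]
  · have := hother u h1 h2 (fun hu => h3 (List.mem_filter.2 ⟨hu, by simp [h1, h2]⟩))
    rcases hxy with ⟨rfl, rfl⟩ | ⟨rfl, rfl⟩
    exacts [this, by rwa [max_comm]]
  · have := hc.inj x hhi.1 z (by omega) he
    omega
  · have := hc.inj x hhi.1 y hhi.2 he
    omega

end Merge

end RangeTopK

namespace WordRAM

open RangeTopK

/-! ### The merging program -/

/-- The data structure and its parameters. -/
structure Par where
  (W SB BB TB sz g h E M P k : ℕ)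
  D : List Bool

/-- The data structure contains the profile of `v`, and the words are long enough. -/
structure Par.Good {β : Type*} [LinearOrder β] (π : Par) (v : ℕ → β) : Prop where
  layout : Layout π.W π.D π.SB π.BB π.TB π.sz π.g π.h π.E π.M (profile v π.P)
  E_lt : π.E < 2 ^ π.W
  sz_pos : 0 < π.sz
  g_pos : 0 < π.g
  h_pos : 0 < π.h
  sh_lt : π.sz * π.h < π.W
  sg_lt : π.sz * π.g < 2 ^ π.W
  M_lt : 2 * π.M < 2 ^ π.W
  le_M : (π.k + 1) * π.P ≤ π.M
  big : 10 * ((π.k + 3) * π.P) < 2 ^ π.W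
  P_pos : 2 ≤ π.P
  W_pos : 4 ≤ π.W

/-- The registers contain the parameters, and the memory the lists `A` and `B`. -/
structure Ready (π : Par) (A B : List ℕ) (s : State) : Prop where
  clean : Clean s
  regs : LayoutRegs s π.W π.SB π.BB π.TB π.sz π.g π.h
  r2 : s.reg 2 = π.k
  r16 : s.reg 16 = π.P
  r20 : s.reg 20 = A.length
  r21 : s.reg 21 = B.length
  mem₀ : ∀ j (h : j < A.length), s.mem (5 * j + 2) = A[j] / 2
  mem₁ : ∀ j (h : j < B.length), s.mem (5 * j + 3) = B[j] / 2

/-- Only the registers `25, …, 48` differ. -/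
structure Keep (s s' : State) : Prop where
  clean : Clean s'
  mem : s'.mem = s.mem
  out : s'.out = s.out
  reg : ∀ r < 25, s'.reg r = s.reg r

lemma Keep.refl {s : State} (h : Clean s) : Keep s s := ⟨h, rfl, rfl, fun _ _ => rfl⟩

lemma Keep.setReg {s s' : State} (h : Keep s s') {r : ℕ} (hr : 25 ≤ r) (hr' : r < 49) (v : ℕ) :
    Keep s (s'.setReg r v) :=
  ⟨h.clean.setReg hr' v, h.mem, h.out, fun r' h' => by
    rw [State.setReg_reg, if_neg (by omega), h.reg r' h']⟩

lemma LayoutRegs.congr {s s' : State} {W SB BB TB sz g h : ℕ}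
    (hs : LayoutRegs s W SB BB TB sz g h) (h' : ∀ r < 22, s'.reg r = s.reg r) :
    LayoutRegs s' W SB BB TB sz g h :=
  ⟨(h' 0 (by omega)).trans hs.r0, (h' 9 (by omega)).trans hs.r9, (h' 10 (by omega)).trans hs.r10,
    (h' 11 (by omega)).trans hs.r11, (h' 12 (by omega)).trans hs.r12,
    (h' 13 (by omega)).trans hs.r13, (h' 14 (by omega)).trans hs.r14,
    (h' 15 (by omega)).trans hs.r15⟩

lemma Ready.congr {π : Par} {A B : List ℕ} {s s' : State} (h : Ready π A B s) (hc : Clean s')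
    (hr : ∀ r < 22, s'.reg r = s.reg r) (hm : ∀ a, a % 5 ≠ 4 → s'.mem a = s.mem a) :
    Ready π A B s' :=
  ⟨hc, h.regs.congr hr, (hr 2 (by omega)).trans h.r2, (hr 16 (by omega)).trans h.r16,
    (hr 20 (by omega)).trans h.r20, (hr 21 (by omega)).trans h.r21,
    fun j hj => (hm _ (by omega)).trans (h.mem₀ j hj),
    fun j hj => (hm _ (by omega)).trans (h.mem₁ j hj)⟩

lemma Ready.keep {π : Par} {A B : List ℕ} {s s' : State} (h : Ready π A B s) (hk : Keep s s') :
    Ready π A B s' :=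
  h.congr hk.clean (fun r hr => hk.reg r (by omega)) (fun a _ => by rw [hk.mem])

/-- The list `l` is stored in the memory cells `4, 9, 14, …`. -/
def Stored (s : State) (l : List ℕ) : Prop := ∀ j (h : j < l.length), s.mem (5 * j + 4) = l[j]

/-- The cell number `4` of group `a`. -/
def cellEx (a : Ex) (c : ℕ) : Ex := .lit 5 * a + .lit c

/-- Account for the known position with index `30`, if it is between the positions `25` and
`26`. -/
def scanBody : Prog :=
  set 35 (.ld (cellEx (.var 30) 4)) ;;
  cond (.bin .lt (.var 25) (.var 35))
    (cond (.bin .lt (.var 35) (.var 26))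
      (set 28 (.var 28 + levelEx (.var 27) (.var 35)) ;;
        set 27 (.var 27 + .lit 1) ;;
        set 29 (.var 29 + levelEx (.var 27) (.var 35)))
      .skip)
    .skip ;;
  set 30 (.var 30 + .lit 1)

section

variable {β : Type*} [LinearOrder β] {v : ℕ → β} {π : Par} {A B : List ℕ} {s : State} {N : ℕ}

lemma Par.Good.lit (hπ : π.Good v) {c : ℕ} (hc : c < 16) : Ev π.W π.D s (.lit c) c :=
  .lit (hc.trans_le (Nat.pow_le_pow_right two_pos hπ.W_pos : 2 ^ 4 ≤ 2 ^ π.W))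

lemma Par.Good.level (hπ : π.Good v) (hs : Ready π A B s) {ej ey : Ex} {j y : ℕ}
    (hj : j + 1 ≤ π.k) (hy : y + 1 < π.P) (hej : Ev π.W π.D s ej j) (hey : Ev π.W π.D s ey y) :
    Ev π.W π.D s (levelEx ej ey) (levelCount v j y) :=
  .level hπ.layout hs.regs hπ.E_lt hπ.sz_pos hπ.g_pos hπ.h_pos hπ.sh_lt hπ.sg_lt hs.r16 hπ.M_lt hy
    ((Nat.mul_le_mul_right _ (by omega)).trans hπ.le_M) hej hey

lemma Ev.cell (hπ : π.Good v) {a : Ex} {x c : ℕ} (ha : Ev π.W π.D s a x) (hc : c < 5)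
    (hx : x ≤ π.k) : Ev π.W π.D s (cellEx a c) (5 * x + c) := by
  have h1 := hπ.big
  have h2 : π.k + 3 ≤ (π.k + 3) * π.P := Nat.le_mul_of_pos_right _ (by have := hπ.P_pos; omega)
  exact ((hπ.lit (by omega)).mul ha (by omega)).add (hπ.lit (by omega)) (by omega)

lemma levelSum_le (i : ℕ) {l : List ℕ} {b : ℕ} (h : ∀ e ∈ l, e ≤ b) :
    levelSum v i l ≤ l.length * b := by
  induction l generalizing i with
  | nil => simp [levelSum]
  | cons e l ih =>
    have h1 := ih (i + 1) (fun e he => h e (List.mem_cons_of_mem _ he))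
    have h2 := (levelCount_le v i e).trans (h e List.mem_cons_self)
    simp only [levelSum, List.length_cons, add_mul, one_mul]
    omega

/-- The registers after the positions in `l` have been scanned. -/
structure Scan (v : ℕ → β) (s : State) (x y t : ℕ) (l : List ℕ) (s' : State) : Prop where
  keep : Keep s s'
  r25 : s'.reg 25 = x
  r26 : s'.reg 26 = y
  r27 : s'.reg 27 = (between x y l).length
  r28 : s'.reg 28 = levelSum v 0 (between x y l)
  r29 : s'.reg 29 = 1 + levelCount v 0 x + levelSum v 1 (between x y l)
  r30 : s'.reg 30 = t
  r33 : s'.reg 33 = s.reg 33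
  r34 : s'.reg 34 = s.reg 34

/-- Both level sums are extended in the same pass. Since `arr` is sorted by position, register `27`
holds the index of the scanned element among those between `x` and `y`. -/
lemma scanBody_runs (hπ : π.Good v) (hs : Ready π A B s) {x y t : ℕ} {arr : List ℕ}
    (harr : Stored s arr) (hlen : arr.length < π.k) (hP : ∀ u ∈ arr, u + 1 < π.P)
    (hx : x + 1 < π.P) (hy : y + 1 < π.P) (ht : t < arr.length) {s' : State}
    (h : Scan v s x y t (arr.take t) s') :
    Runs π.W π.D scanBody s' (scanBody.time N) (Scan v s x y (t + 1) (arr.take (t + 1))) := by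
  have hbig := hπ.big
  have hk3 : (π.k + 3) * π.P = π.k * π.P + 3 * π.P := by ring
  have hkP : π.k ≤ π.k * π.P := Nat.le_mul_of_pos_right _ (by have := hπ.P_pos; omega)
  have hs' := hs.keep h.keep
  have he : arr[t] + 1 < π.P := hP _ (List.getElem_mem ht)
  set e := arr[t] with he_def
  set l := between x y (arr.take t) with hl
  have htk : arr.take (t + 1) = arr.take t ++ [e] := List.take_succ_eq_append_getElem ht
  have hlt : l.length ≤ t := (List.length_filter_le _ _).trans (by simp)
  have hmem : ∀ u ∈ l, u ≤ π.P := fun u hu => by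
    have := hP u (List.mem_of_mem_take (List.mem_filter.1 hu).1)
    omega
  have hsum : ∀ i, levelSum v i l ≤ π.k * π.P := fun i =>
    (levelSum_le i hmem).trans (Nat.mul_le_mul_right _ (by omega))
  have hs0 := hsum 0
  have hs1 := hsum 1
  have hc0 := levelCount_le v 0 x
  have hce : ∀ j, levelCount v j e ≤ e := fun j => levelCount_le v j e
  have h1 : Ev π.W π.D s' (.ld (cellEx (.var 30) 4)) e := by
    have h2 : s'.mem (5 * t + 4) = e := by rw [h.keep.mem]; exact harr t ht
    have := Ev.ld (D := π.D) (s := s') (Ev.cell hπ (.reg h.r30 (by norm_num) (by omega)) (by norm_num : 4 < 5)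
      (by omega)) (by rw [h2]; omega)
    rwa [h2] at this
  refine Runs.seq' (.set h.keep.clean h1 (by decide) (by norm_num) ?_)
  set s₁ := s'.setReg 35 e with hs₁
  have k1 : Keep s s₁ := h.keep.setReg (by norm_num) (by norm_num) e
  have v25 : Ev π.W π.D s₁ (.var 25) x := .reg (by simp [s₁, h.r25]) (by norm_num) (by omega)
  have v26 : Ev π.W π.D s₁ (.var 26) y := .reg (by simp [s₁, h.r26]) (by norm_num) (by omega)
  have v27 : Ev π.W π.D s₁ (.var 27) l.length := .reg (by simp [s₁, h.r27, hl]) (by norm_num) (by omega)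
  have v28 : Ev π.W π.D s₁ (.var 28) (levelSum v 0 l) := .reg (by simp [s₁, h.r28, hl]) (by norm_num) (by omega)
  have v35 : Ev π.W π.D s₁ (.var 35) e := .reg (by simp [s₁]) (by norm_num) (by omega)
  have hW : 0 < π.W := by have := hπ.W_pos; omega
  refine Runs.bind' (P' := Scan v s x y t (arr.take (t + 1))) ?_ ?_
  · have hskip : ¬ (x < e ∧ e < y) → Scan v s x y t (arr.take (t + 1)) s₁ := fun hn => by
      have hb : between x y (arr.take (t + 1)) = l := by
        rw [htk, between, List.filter_append]
        simp [hn, hl, between]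
      exact ⟨k1, by simp [s₁, h.r25], by simp [s₁, h.r26], by simp [s₁, hb, h.r27, hl],
        by simp [s₁, hb, h.r28, hl], by simp [s₁, hb, h.r29, hl], by simp [s₁, h.r30],
        by simp [s₁, h.r33], by simp [s₁, h.r34]⟩
    refine Runs.cond' k1.clean (v25.lt' v35 hW) (by decide) (fun hc => ?_) (fun hc => ?_)
    · have hxe : x < e := by by_contra hn; simp [hn] at hc
      refine Runs.cond' k1.clean (v35.lt' v26 hW) (by decide) (fun hc' => ?_) (fun hc' => ?_)
      · have hey : e < y := by by_contra hn; simp [hn] at hc'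
        have hb : between x y (arr.take (t + 1)) = l ++ [e] := by
          rw [htk, between, List.filter_append]
          simp [hxe, hey, hl, between]
        have c1 := hce l.length
        have c2 := hce (l.length + 1)
        -- The sum in register `28` takes level `l.length`. The one in register `29` is updated only
        -- after register `27` has been incremented, and so takes level `l.length + 1`.
        refine Runs.seq' (.set k1.clean (v28.add (hπ.level (hs.keep k1) (by omega) he v27 v35)
          (by omega)) (by decide) (by norm_num) ?_)
        set s₂ := s₁.setReg 28 (levelSum v 0 l + levelCount v l.length e) with hs₂
        have k2 : Keep s s₂ := k1.setReg (by norm_num) (by norm_num) _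
        have w27 : Ev π.W π.D s₂ (.var 27) l.length :=
          .reg (by simp [s₁, s₂, h.r27, hl]) (by norm_num) (by omega)
        refine Runs.seq' (.set k2.clean (w27.add (hπ.lit (by norm_num)) (by omega)) (by decide)
          (by norm_num) ?_)
        set s₃ := s₂.setReg 27 (l.length + 1) with hs₃
        have k3 : Keep s s₃ := k2.setReg (by norm_num) (by norm_num) _
        have x27 : Ev π.W π.D s₃ (.var 27) (l.length + 1) :=
          .reg (by simp [s₃]) (by norm_num) (by omega)
        have x29 : Ev π.W π.D s₃ (.var 29) (1 + levelCount v 0 x + levelSum v 1 l) :=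
          .reg (by simp [s₃, s₂, s₁, h.r29, hl]) (by norm_num) (by omega)
        have x35 : Ev π.W π.D s₃ (.var 35) e :=
          .reg (by simp [s₁, s₂, s₃]) (by norm_num) (by omega)
        refine .set k3.clean (x29.add (hπ.level (hs.keep k3) (by omega) he x27 x35)
          (by omega)) (by decide) (by norm_num) ?_
        refine ⟨k3.setReg (by norm_num) (by norm_num) _, by simp [s₁, s₂, s₃, h.r25],
          by simp [s₁, s₂, s₃, h.r26], ?_, ?_, ?_, by simp [s₁, s₂, s₃, h.r30],
          by simp [s₁, s₂, s₃, h.r33], by simp [s₁, s₂, s₃, h.r34]⟩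
        · rw [hb]; simp [s₃]
        · rw [hb, levelSum_append]; simp [s₃, s₂, levelSum]
        · rw [hb, levelSum_append]
          simp only [State.setReg_reg, if_true, levelSum]
          rw [add_comm 1 l.length]
          ring
      · refine .skip' (hskip fun hn => ?_)
        simp [hn.2] at hc'
    · refine .skip' (hskip fun hn => ?_)
      simp [hn.1] at hc
  · intro s₂ h2
    refine .set h2.keep.clean ((Ev.reg h2.r30 (by norm_num) (by omega)).add
      (hπ.lit (by norm_num)) (by omega)) (by decide) (by norm_num) ?_
    exact ⟨h2.keep.setReg (by norm_num) (by norm_num) _, by simp [h2.r25], by simp [h2.r26],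
      by simp [h2.r27], by simp [h2.r28], by simp [h2.r29], by simp, by simp [h2.r33],
      by simp [h2.r34]⟩

end

/-- Scan the known positions. -/
def scan : Prog :=
  set 27 (.lit 0) ;; set 28 (.lit 0) ;; set 29 (.lit 1 + levelEx (.lit 0) (.var 25)) ;;
  set 30 (.lit 0) ;; whl (.bin .lt (.var 30) (.var 24)) scanBody

/-- Register `31` becomes `0` if the current element of the first list is larger than that of the
second, and `1` otherwise. -/
def compare : Prog :=
  set 33 (.lit 2 * .ld (cellEx (.var 22) 2)) ;;
  set 34 (.lit 2 * .ld (cellEx (.var 23) 3) + .lit 1) ;;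
  cond (.bin .lt (.var 33) (.var 34)) (set 25 (.var 33) ;; set 26 (.var 34))
    (set 25 (.var 34) ;; set 26 (.var 33)) ;;
  scan ;;
  set 28 (.var 28 + levelEx (.var 27) (.var 26)) ;;
  set 31 (.bin .xor (.bin .lt (.var 28) (.var 29)) (.bin .lt (.var 34) (.var 33)))

/-- Register `31` becomes the row of the next element of the output. -/
def choose : Prog :=
  cond (.bin .lt (.var 23) (.var 21))
    (cond (.bin .lt (.var 22) (.var 20)) compare (set 31 (.lit 1)))
    (set 31 (.lit 0))

section

variable {β : Type*} [LinearOrder β] {v : ℕ → β} {π : Par} {A B : List ℕ} {s : State} {N : ℕ}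

lemma scan_runs (hπ : π.Good v) (hs : Ready π A B s) {x y : ℕ} {arr : List ℕ}
    (harr : Stored s arr) (hlen : arr.length < π.k) (hN : π.k ≤ N) (hP : ∀ u ∈ arr, u + 1 < π.P)
    (hx : x + 1 < π.P) (hy : y + 1 < π.P) (h24 : s.reg 24 = arr.length) (h25 : s.reg 25 = x)
    (h26 : s.reg 26 = y) :
    Runs π.W π.D scan s (scan.time N) (Scan v s x y arr.length arr) := by
  have hbig := hπ.big
  have hk3 : (π.k + 3) * π.P = π.k * π.P + 3 * π.P := by ring
  have hkP : π.k ≤ π.k * π.P := Nat.le_mul_of_pos_right _ (by have := hπ.P_pos; omega)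
  have hW : 0 < π.W := by have := hπ.W_pos; omega
  have hc0 := levelCount_le v 0 x
  have k0 := Keep.refl hs.clean
  refine Runs.seq' (.set hs.clean (hπ.lit (by norm_num)) (by decide) (by norm_num) ?_)
  have k1 := k0.setReg (r := 27) (by norm_num) (by norm_num) 0
  refine Runs.seq' (.set k1.clean (hπ.lit (by norm_num)) (by decide) (by norm_num) ?_)
  have k2 := k1.setReg (r := 28) (by norm_num) (by norm_num) 0
  refine Runs.seq' (.set k2.clean ((hπ.lit (by norm_num)).add
    (hπ.level (hs.keep k2) (by omega) hx (hπ.lit (by norm_num))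
      (.reg (v := x) (by simp [h25]) (by norm_num) (by omega))) (by omega))
    (by decide) (by norm_num) ?_)
  have k3 := k2.setReg (r := 29) (by norm_num) (by norm_num) (1 + levelCount v 0 x)
  refine Runs.seq' (.set k3.clean (hπ.lit (by norm_num)) (by decide) (by norm_num) ?_)
  have k4 := k3.setReg (r := 30) (by norm_num) (by norm_num) 0
  refine (Runs.whl' (n := arr.length) (I := fun t s' => Scan v s x y t (arr.take t) s')
    (by omega) (by decide) ?_ ?_ ?_).mono le_rfl (fun s' h => by simpa using h)
  · exact ⟨k4, by simp [h25], by simp [h26], by simp [between], by simp [between, levelSum],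
      by simp [between, levelSum], by simp, by simp, by simp⟩
  · intro t ht s' h
    refine ⟨h.keep.clean, _, ?_, (Ev.reg h.r30 (by norm_num) (by omega)).lt'
      (.reg ((h.keep.reg 24 (by norm_num)).trans h24) (by norm_num) (by omega)) hW,
      scanBody_runs hπ hs harr hlen hP hx hy ht h⟩
    simp [ht]
  · intro s' h
    have := (Ev.reg (w := π.W) (D := π.D) h.r30 (by norm_num) (by omega)).lt'
      (.reg ((h.keep.reg 24 (by norm_num)).trans h24) (by norm_num) (by omega)) hW
    rw [if_neg (lt_irrefl _)] at this
    exact ⟨h.keep.clean, this⟩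

/-- A state of the merging program: `i₀` elements of the first list and `i₁` elements of the second
have been put out. -/
structure Mid (π : Par) (v : ℕ → β) (A B : List ℕ) (i₀ i₁ : ℕ) (E arr : List ℕ) (s : State) :
    Prop where
  ready : Ready π A B s
  merging : Merging v A B i₀ i₁ E arr
  stored : Stored s arr
  r22 : s.reg 22 = i₀
  r23 : s.reg 23 = i₁
  r24 : s.reg 24 = i₀ + i₁

lemma Mid.keep {i₀ i₁ : ℕ} {E arr : List ℕ} {s' : State} (h : Mid π v A B i₀ i₁ E arr s)
    (hk : Keep s s') : Mid π v A B i₀ i₁ E arr s' :=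
  ⟨h.ready.keep hk, h.merging, fun j hj => by rw [hk.mem]; exact h.stored j hj,
    (hk.reg 22 (by norm_num)).trans h.r22, (hk.reg 23 (by norm_num)).trans h.r23,
    (hk.reg 24 (by norm_num)).trans h.r24⟩

lemma compare_runs (hπ : π.Good v) {i₀ i₁ lo hi : ℕ} {E arr : List ℕ}
    (h : Mid π v A B i₀ i₁ E arr s) (hc : Candidates v lo hi A B) (hhi : hi + 1 < π.P)
    (h₀ : i₀ < A.length) (h₁ : i₁ < B.length) (hlen : i₀ + i₁ < π.k) (hN : π.k ≤ N) :
    Runs π.W π.D compare s (compare.time N) fun s' =>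
      Keep s s' ∧ s'.reg 31 = if v B[i₁] < v A[i₀] then 0 else 1 := by
  have hbig := hπ.big
  have hk3 : (π.k + 3) * π.P = π.k * π.P + 3 * π.P := by ring
  have hkP : π.k ≤ π.k * π.P := Nat.le_mul_of_pos_right _ (by have := hπ.P_pos; omega)
  have hW : 0 < π.W := by have := hπ.W_pos; omega
  have mA : A[i₀] ∈ A := List.getElem_mem _
  have mB : B[i₁] ∈ B := List.getElem_mem _
  have hX := hc.mem₀ _ mA
  have hY := hc.mem₁ _ mB
  have eX := hc.even _ mA
  have eY := hc.odd _ mB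
  set X := A[i₀] with hXd
  set Y := B[i₁] with hYd
  have harrP : ∀ u ∈ arr, u + 1 < π.P := fun u hu => by
    rcases (h.merging.arr_mem u).1 hu with hu | hu
    · have := hc.mem₀ u (List.mem_of_mem_take hu); omega
    · have := hc.mem₁ u (List.mem_of_mem_take hu); omega
  have hal := h.merging.arr_length
  have k0 := Keep.refl h.ready.clean
  have l0 : Ev π.W π.D s (.ld (cellEx (.var 22) 2)) (X / 2) := by
    have h2 := h.ready.mem₀ i₀ h₀
    have := Ev.ld (D := π.D) (s := s) (Ev.cell hπ (.reg h.r22 (by norm_num) (by omega))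
      (by norm_num : 2 < 5) (by omega)) (by rw [h2]; omega)
    rwa [h2] at this
  refine Runs.seq' (.set h.ready.clean ((hπ.lit (by norm_num)).mul l0 (by omega)) (by decide)
    (by norm_num) ?_)
  -- The memory holds columns; for row `0` the number of the position is twice the column.
  rw [show 2 * (X / 2) = X by omega]
  set s₁ := s.setReg 33 X with hs₁
  have k1 : Keep s s₁ := k0.setReg (by norm_num) (by norm_num) X
  have l1 : Ev π.W π.D s₁ (.ld (cellEx (.var 23) 3)) (Y / 2) := by
    have h2 : s₁.mem (5 * i₁ + 3) = Y / 2 := h.ready.mem₁ i₁ h₁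
    have := Ev.ld (D := π.D) (s := s₁) (Ev.cell hπ
      (Ev.reg (r := 23) (v := i₁) (by simp [s₁, h.r23]) (by norm_num) (by omega))
      (by norm_num : 3 < 5) (by omega)) (by rw [h2]; omega)
    rwa [h2] at this
  refine Runs.seq' (.set k1.clean (((hπ.lit (by norm_num)).mul l1 (by omega)).add
    (hπ.lit (by norm_num)) (by omega)) (by decide) (by norm_num) ?_)
  rw [show 2 * (Y / 2) + 1 = Y by omega]
  set s₂ := s₁.setReg 34 Y with hs₂
  have k2 : Keep s s₂ := k1.setReg (by norm_num) (by norm_num) Y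
  have v33 : Ev π.W π.D s₂ (.var 33) X := .reg (by simp [s₂, s₁]) (by norm_num) (by omega)
  have v34 : Ev π.W π.D s₂ (.var 34) Y := .reg (by simp [s₂]) (by norm_num) (by omega)
  refine Runs.bind' (P' := fun s' => Keep s s' ∧ s'.reg 25 = min X Y ∧ s'.reg 26 = max X Y ∧
    s'.reg 33 = X ∧ s'.reg 34 = Y) ?_ ?_
  · refine Runs.cond' k2.clean (v33.lt' v34 hW) (by decide) (fun hlt => ?_) (fun hlt => ?_)
    · have hlt' : X < Y := by by_contra hn; simp [hn] at hlt
      refine Runs.seq' (.set k2.clean v33 (by decide) (by norm_num) ?_)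
      have k3 := k2.setReg (r := 25) (by norm_num) (by norm_num) X
      refine .set k3.clean (.reg (v := Y) (by simp [s₂]) (by norm_num) (by omega)) (by decide)
        (by norm_num) ⟨k3.setReg (by norm_num) (by norm_num) _, ?_, ?_, ?_, ?_⟩
      · simp [hlt'.le]
      · simp [hlt'.le]
      · simp [s₂, s₁]
      · simp [s₂]
    · have hlt' : Y ≤ X := by by_contra hn; simp [not_le.1 hn] at hlt
      refine Runs.seq' (.set k2.clean v34 (by decide) (by norm_num) ?_)
      have k3 := k2.setReg (r := 25) (by norm_num) (by norm_num) Y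
      refine .set k3.clean (.reg (v := X) (by simp [s₂, s₁]) (by norm_num) (by omega)) (by decide)
        (by norm_num) ⟨k3.setReg (by norm_num) (by norm_num) _, ?_, ?_, ?_, ?_⟩
      · simp [hlt']
      · simp [hlt']
      · simp [s₂, s₁]
      · simp [s₂]
  · rintro s₃ ⟨k3, h25, h26, h33, h34⟩
    have m3 := h.keep k3
    refine Runs.bind' (scan_runs hπ m3.ready m3.stored (by omega) hN harrP (by omega) (by omega)
      (by rw [m3.r24, hal]) h25 h26) ?_
    intro s₄ h4
    have k4 : Keep s s₄ := ⟨h4.keep.clean, h4.keep.mem.trans k3.mem, h4.keep.out.trans k3.out,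
      fun r hr => (h4.keep.reg r hr).trans (k3.reg r hr)⟩
    set l := between (min X Y) (max X Y) arr with hl
    have q27 : s₄.reg 27 = l.length := h4.r27
    have q28 : s₄.reg 28 = levelSum v 0 l := h4.r28
    have q26 : s₄.reg 26 = max X Y := h4.r26
    have hll : l.length ≤ arr.length := List.length_filter_le _ _
    have hsum : ∀ i, levelSum v i l ≤ π.k * π.P := fun i =>
      (levelSum_le i (fun u hu => by
        have := harrP u (List.mem_filter.1 hu).1; omega)).trans
        (Nat.mul_le_mul_right _ (by omega))
    have hs0 := hsum 0
    have hs1 := hsum 1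
    have hc0 := levelCount_le v 0 (min X Y)
    have hc1 := levelCount_le v l.length (max X Y)
    refine Runs.seq' (.set k4.clean ((Ev.reg q28 (by norm_num) (by omega)).add
      (hπ.level (h.ready.keep k4) (by omega) (by omega) (Ev.reg q27 (by norm_num) (by omega))
        (Ev.reg q26 (by norm_num) (by omega))) (by omega)) (by decide) (by norm_num) ?_)
    set lhs := levelSum v 0 l + levelCount v l.length (max X Y) with hlhs
    set rhs := 1 + levelCount v 0 (min X Y) + levelSum v 1 l with hrhs
    have k5 := k4.setReg (r := 28) (by norm_num) (by norm_num) lhs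
    have e1 : Ev π.W π.D (s₄.setReg 28 lhs) (.bin .lt (.var 28) (.var 29))
        (if lhs < rhs then 1 else 0) :=
      (Ev.reg (by simp) (by norm_num) (by omega)).lt'
        (.reg (by simp [h4.r29, ← hl, hrhs]) (by norm_num) (by omega)) hW
    have e2 : Ev π.W π.D (s₄.setReg 28 lhs) (.bin .lt (.var 34) (.var 33))
        (if Y < X then 1 else 0) :=
      (Ev.reg (by simp [h4.r34, h34]) (by norm_num) (by omega)).lt'
        (.reg (by simp [h4.r33, h33]) (by norm_num) (by omega)) hW
    have hv : v X ≠ v Y := hc.ne X mA Y mB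
    have hXY : X ≠ Y := fun he => hv (by rw [he])
    -- The first bit says that the right one of the two positions has the larger element. This is
    -- the head of `B` if `X < Y` and the head of `A` otherwise; the second bit corrects for that.
    have hval : (if lhs < rhs then 1 else 0) ^^^ (if Y < X then 1 else 0)
        = if v Y < v X then 0 else 1 := by
      rcases lt_or_gt_of_ne hXY with hlt | hlt
      · have := h.merging.lt_iff hc h₀ h₁ (x := X) (y := Y) (.inl ⟨rfl, rfl⟩) hlt
        rw [min_eq_left hlt.le, max_eq_right hlt.le] at hl
        rw [min_eq_left hlt.le] at hrhs
        rw [max_eq_right hlt.le] at hlhs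
        rw [← hl] at this
        rw [if_neg hlt.not_gt]
        by_cases hlr : lhs < rhs
        · rw [if_pos hlr, if_neg (by rw [this]; omega)]; rfl
        · rw [if_neg hlr, if_pos (by rw [this]; omega)]; rfl
      · have := h.merging.lt_iff hc h₀ h₁ (x := Y) (y := X) (.inr ⟨rfl, rfl⟩) hlt
        rw [min_eq_right hlt.le, max_eq_left hlt.le] at hl
        rw [min_eq_right hlt.le] at hrhs
        rw [max_eq_left hlt.le] at hlhs
        rw [← hl] at this
        rw [if_pos hlt]
        by_cases hlr : lhs < rhs
        · have h5 : ¬ v X < v Y := by rw [this]; omega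
          rw [if_pos hlr, if_pos (lt_of_le_of_ne (not_lt.1 h5) hv.symm)]; rfl
        · have h5 : v X < v Y := by rw [this]; omega
          rw [if_neg hlr, if_neg h5.not_gt]; rfl
    have e3 : Ev π.W π.D (s₄.setReg 28 lhs)
        (.bin .xor (.bin .lt (.var 28) (.var 29)) (.bin .lt (.var 34) (.var 33)))
        (if v Y < v X then 0 else 1) := by
      have := Ev.bin (o := .xor) e1 e2 (by
        simp only [Op.eval]
        rw [hval]
        split_ifs <;> omega)
      simp only [Op.eval] at this
      rwa [hval] at this
    exact .set k5.clean e3 (by decide) (by norm_num)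
      ⟨k5.setReg (by norm_num) (by norm_num) _, by simp⟩

lemma choose_runs (hπ : π.Good v) {i₀ i₁ lo hi : ℕ} {E arr : List ℕ}
    (h : Mid π v A B i₀ i₁ E arr s) (hc : Candidates v lo hi A B) (hhi : hi + 1 < π.P)
    (hA : A.length ≤ π.k) (hB : B.length ≤ π.k)
    (hAB : i₀ + i₁ < A.length + B.length) (hlen : i₀ + i₁ < π.k) (hN : π.k ≤ N) :
    Runs π.W π.D choose s (choose.time N) fun s' => Keep s s' ∧
      ((s'.reg 31 = 0 ∧ ∃ h₀ : i₀ < A.length, ∀ h₁ : i₁ < B.length, v B[i₁] < v A[i₀]) ∨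
       (s'.reg 31 = 1 ∧ ∃ h₁ : i₁ < B.length, ∀ h₀ : i₀ < A.length, v A[i₀] < v B[i₁])) := by
  have hbig := hπ.big
  have hk3 : (π.k + 3) * π.P = π.k * π.P + 3 * π.P := by ring
  have hkP : π.k ≤ π.k * π.P := Nat.le_mul_of_pos_right _ (by have := hπ.P_pos; omega)
  have hW : 0 < π.W := by have := hπ.W_pos; omega
  have k0 := Keep.refl h.ready.clean
  have l0 := h.merging.le₀
  have l1 := h.merging.le₁
  have v23 : Ev π.W π.D s (.var 23) i₁ := .reg h.r23 (by norm_num) (by omega)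
  have v21 : Ev π.W π.D s (.var 21) B.length := .reg h.ready.r21 (by norm_num) (by omega)
  have v22 : Ev π.W π.D s (.var 22) i₀ := .reg h.r22 (by norm_num) (by omega)
  have v20 : Ev π.W π.D s (.var 20) A.length := .reg h.ready.r20 (by norm_num) (by omega)
  refine Runs.cond' h.ready.clean (v23.lt' v21 hW) (by decide) (fun hc₁ => ?_) (fun hc₁ => ?_)
  · have h₁ : i₁ < B.length := by by_contra hn; simp [hn] at hc₁
    refine Runs.cond' h.ready.clean (v22.lt' v20 hW) (by decide) (fun hc₀ => ?_) (fun hc₀ => ?_)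
    · have h₀ : i₀ < A.length := by by_contra hn; simp [hn] at hc₀
      refine (compare_runs hπ h hc hhi h₀ h₁ hlen hN).mono le_rfl ?_
      rintro s' ⟨hk, hr⟩
      refine ⟨hk, ?_⟩
      split_ifs at hr with hv
      · exact .inl ⟨hr, h₀, fun _ => hv⟩
      · exact .inr ⟨hr, h₁, fun _ => lt_of_le_of_ne (not_lt.1 hv)
          (hc.ne _ (List.getElem_mem _) _ (List.getElem_mem _))⟩
    · have h₀ : ¬ i₀ < A.length := fun hn => by simp [hn] at hc₀
      exact .set h.ready.clean (hπ.lit (by norm_num)) (by decide) (by norm_num)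
        ⟨k0.setReg (by norm_num) (by norm_num) _, .inr ⟨by simp, h₁, fun hn => absurd hn h₀⟩⟩
  · have h₁ : ¬ i₁ < B.length := fun hn => by simp [hn] at hc₁
    exact .set h.ready.clean (hπ.lit (by norm_num)) (by decide) (by norm_num)
      ⟨k0.setReg (by norm_num) (by norm_num) _, .inl ⟨by simp, by omega, fun hn => absurd hn h₁⟩⟩

end

/-- One step of the insertion of register `36` into the sorted list of the known positions. -/
def insertBody : Prog :=
  set 35 (.ld (cellEx (.var 30) 4)) ;;
  cond (.bin .lt (.var 36) (.var 35))
    (put (cellEx (.var 30) 4) (.var 36) ;; set 36 (.var 35))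
    .skip ;;
  set 30 (.var 30 + .lit 1)

/-- Insert register `36` into the sorted list of the known positions. -/
def insert : Prog :=
  set 30 (.lit 0) ;;
  whl (.bin .lt (.var 30) (.var 24)) insertBody ;;
  put (cellEx (.var 24) 4) (.var 36) ;;
  set 24 (.var 24 + .lit 1)

/-- Put out the next element of the list which register `31` indicates. -/
def advance : Prog :=
  cond (.var 31)
    (set 32 (.ld (cellEx (.var 23) 3)) ;; set 23 (.var 23 + .lit 1))
    (set 32 (.ld (cellEx (.var 22) 2)) ;; set 22 (.var 22 + .lit 1)) ;;
  outp (.var 31) ;; outp (.var 32) ;;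
  set 36 (.lit 2 * .var 32 + .var 31) ;;
  insert

/-- Put out the `k` largest elements of both lists. -/
def mergeProg : Prog :=
  whl (.bin .and (.bin .lt (.var 24) (.var 2)) (.bin .lt (.var 24) (.var 20 + .var 21)))
    (choose ;; advance)

section

variable {β : Type*} [LinearOrder β] {v : ℕ → β} {π : Par} {A B : List ℕ} {s : State} {N : ℕ}

/-- The state after `t` steps of the insertion of `x` into the list `arr`. -/
structure Inserting (s : State) (x : ℕ) (arr : List ℕ) (b t : ℕ) (s' : State) : Prop where
  clean : Clean s'
  out : s'.out = s.out
  reg : ∀ r < 25, s'.reg r = s.reg r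
  mem : ∀ a, a % 5 ≠ 4 → s'.mem a = s.mem a
  r30 : s'.reg 30 = t
  carry : s'.reg 36 < b
  rest : ∀ j (h : j < arr.length), t ≤ j → s'.mem (5 * j + 4) = arr[j]
  done : ∃ pre : List ℕ, pre.length = t ∧ Stored s' pre ∧
    bubble x arr = pre ++ bubble (s'.reg 36) (arr.drop t)

/-- One left-to-right pass with a carried element: a cell holding a larger number exchanges it with
the carry, so later entries move up without a separate shift. -/
lemma insertBody_runs (hπ : π.Good v) {x b t : ℕ} {arr : List ℕ} (hb : b ≤ π.P)
    (harr : ∀ u ∈ arr, u < b) (hlen : arr.length < π.k) (ht : t < arr.length) {s' : State}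
    (h : Inserting s x arr b t s') :
    Runs π.W π.D insertBody s' (insertBody.time N) (Inserting s x arr b (t + 1)) := by
  have hbig := hπ.big
  have hk3 : (π.k + 3) * π.P = π.k * π.P + 3 * π.P := by ring
  have hkP : π.k ≤ π.k * π.P := Nat.le_mul_of_pos_right _ (by have := hπ.P_pos; omega)
  have hW : 0 < π.W := by have := hπ.W_pos; omega
  have he := harr _ (List.getElem_mem ht)
  set e := arr[t] with he_def
  have hdrop : arr.drop t = e :: arr.drop (t + 1) := List.drop_eq_getElem_cons ht
  obtain ⟨pre, hpre, hst, hbub⟩ := h.done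
  have hcar := h.carry
  set y := s'.reg 36 with hy
  have h1 : Ev π.W π.D s' (.ld (cellEx (.var 30) 4)) e := by
    have h2 : s'.mem (5 * t + 4) = e := h.rest t ht le_rfl
    have := Ev.ld (D := π.D) (s := s') (Ev.cell hπ (.reg h.r30 (by norm_num) (by omega))
      (by norm_num : 4 < 5) (by omega)) (by rw [h2]; omega)
    rwa [h2] at this
  refine Runs.seq' (.set h.clean h1 (by decide) (by norm_num) ?_)
  set s₁ := s'.setReg 35 e with hs₁
  have c₁ : Clean s₁ := h.clean.setReg (by norm_num) e
  have v36 : Ev π.W π.D s₁ (.var 36) y := .reg (by simp [s₁, hy]) (by norm_num) (by omega)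
  have v35 : Ev π.W π.D s₁ (.var 35) e := .reg (by simp [s₁]) (by norm_num) (by omega)
  have v30 : Ev π.W π.D s₁ (.var 30) t := .reg (by simp [s₁, h.r30]) (by norm_num) (by omega)
  -- The invariant is claimed for the state after the pending increment of the index.
  refine Runs.bind' (P' := fun s' => Inserting s x arr b (t + 1) (s'.setReg 30 (t + 1)) ∧
    s'.reg 30 = t ∧ Clean s') ?_ ?_
  · refine Runs.cond' c₁ (v36.lt' v35 hW) (by decide) (fun hc => ?_) (fun hc => ?_)
    · have hlt : y < e := by by_contra hn; simp [hn] at hc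
      refine Runs.seq' (.put c₁ (Ev.cell hπ v30 (by norm_num) (by omega)) v36 (by decide)
        (by decide) ?_)
      set s₂ := s₁.setMem (5 * t + 4) y with hs₂
      have c₂ : Clean s₂ := c₁.setMem _ _
      refine .set c₂ (.reg (v := e) (by simp [s₂, s₁]) (by norm_num) (by omega)) (by decide)
        (by norm_num) ⟨⟨(c₂.setReg (by norm_num) _).setReg (by norm_num) _, h.out, ?_, ?_,
          by simp, by simpa using he, ?_, pre ++ [y], by simp [hpre], ?_, ?_⟩,
          by simp [s₂, s₁, h.r30], c₂.setReg (by norm_num) _⟩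
      · intro r hr
        have := h.reg r hr
        simp only [State.setReg_reg, s₂, s₁, State.setMem_reg]
        rw [if_neg (by omega), if_neg (by omega), if_neg (by omega), this]
      · intro a ha
        have := h.mem a ha
        simp only [State.setReg_mem, s₂, s₁, State.setMem_mem]
        rw [if_neg (by omega), this]
      · intro j hj hjt
        have := h.rest j hj (by omega)
        simp only [State.setReg_mem, s₂, s₁, State.setMem_mem]
        rw [if_neg (by omega), this]
      · intro j hj
        simp only [State.setReg_mem, s₂, s₁, State.setMem_mem]
        rcases lt_or_ge j t with hjt | hjt
        · have := hst j (by omega)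
          rw [if_neg (by omega), this, List.getElem_append_left (by omega)]
        · have hjt' : j = t := by simp at hj; omega
          subst hjt'
          rw [if_pos rfl, List.getElem_append_right (by omega)]
          simp
      · rw [hbub, hdrop, bubble, if_pos hlt]
        simp
    · have hlt : ¬ y < e := fun hn => by simp [hn] at hc
      refine .skip' ⟨⟨c₁.setReg (by norm_num) _, h.out, ?_, h.mem, by simp, by simpa [s₁] using hcar,
        fun j hj hjt => h.rest j hj (by omega), pre ++ [e], by simp [hpre], ?_, ?_⟩,
        by simp [s₁, h.r30], c₁⟩
      · intro r hr
        have := h.reg r hr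
        simp only [State.setReg_reg, s₁]
        rw [if_neg (by omega), if_neg (by omega), this]
      · intro j hj
        change s'.mem _ = _
        rcases lt_or_ge j t with hjt | hjt
        · rw [hst j (by omega), List.getElem_append_left (by omega)]
        · have hjt' : j = t := by simp at hj; omega
          subst hjt'
          rw [List.getElem_append_right (by omega), h.rest j ht le_rfl]
          simp [he_def]
      · rw [hbub, hdrop, bubble, if_neg hlt]
        simp [s₁, ← hy]
  · rintro s₂ ⟨h2, h30, hc2⟩
    exact .set hc2 ((Ev.reg h30 (by norm_num) (by omega)).add (hπ.lit (by norm_num)) (by omega))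
      (by decide) (by norm_num) h2

lemma insert_runs (hπ : π.Good v) {x b : ℕ} {arr : List ℕ} (hb : b ≤ π.P)
    (harr : ∀ u ∈ arr, u < b) (hlen : arr.length < π.k) (hN : π.k ≤ N) (hc : Clean s)
    (hst : Stored s arr) (h24 : s.reg 24 = arr.length) (h36 : s.reg 36 = x) (hx : x < b) :
    Runs π.W π.D insert s (insert.time N) fun s' => Clean s' ∧ s'.out = s.out ∧
      (∀ r < 24, s'.reg r = s.reg r) ∧ (∀ a, a % 5 ≠ 4 → s'.mem a = s.mem a) ∧
      s'.reg 24 = arr.length + 1 ∧ Stored s' (bubble x arr) := by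
  have hbig := hπ.big
  have hk3 : (π.k + 3) * π.P = π.k * π.P + 3 * π.P := by ring
  have hkP : π.k ≤ π.k * π.P := Nat.le_mul_of_pos_right _ (by have := hπ.P_pos; omega)
  have hW : 0 < π.W := by have := hπ.W_pos; omega
  refine Runs.seq' (.set hc (hπ.lit (by norm_num)) (by decide) (by norm_num) ?_)
  refine Runs.bind' (Runs.whl' (n := arr.length) (I := fun t s' => Inserting s x arr b t s')
    (by omega) (by decide) ?_ ?_ ?_) ?_
  · exact ⟨hc.setReg (by norm_num) _, rfl, fun r hr => by simp; omega, fun _ _ => rfl, by simp,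
      by simpa [h36] using hx, fun j hj _ => hst j hj, [], rfl, fun j hj => by simp at hj,
      by simp [h36]⟩
  · intro t ht s' h
    refine ⟨h.clean, _, ?_, (Ev.reg h.r30 (by norm_num) (by omega)).lt'
      (.reg ((h.reg 24 (by norm_num)).trans h24) (by norm_num) (by omega)) hW,
      insertBody_runs hπ hb harr hlen ht h⟩
    simp [ht]
  · intro s' h
    have := (Ev.reg (w := π.W) (D := π.D) h.r30 (by norm_num) (by omega)).lt'
      (.reg ((h.reg 24 (by norm_num)).trans h24) (by norm_num) (by omega)) hW
    rw [if_neg (lt_irrefl _)] at this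
    exact ⟨h.clean, this⟩
  · intro s₁ h
    obtain ⟨pre, hpre, hst', hbub⟩ := h.done
    have hcar := h.carry
    have h24' : s₁.reg 24 = arr.length := (h.reg 24 (by norm_num)).trans h24
    set y := s₁.reg 36 with hy
    rw [List.drop_length, bubble] at hbub
    have v24 : Ev π.W π.D s₁ (.var 24) arr.length := .reg h24' (by norm_num) (by omega)
    refine Runs.seq' (.put h.clean (Ev.cell hπ v24 (by norm_num) (by omega))
      (.reg (v := y) hy.symm (by norm_num) (by omega)) (by decide) (by decide) ?_)
    set s₂ := s₁.setMem (5 * arr.length + 4) y with hs₂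
    have c₂ : Clean s₂ := h.clean.setMem _ _
    refine .set c₂ ((Ev.reg (v := arr.length) (by simp [s₂, h24']) (by norm_num) (by omega)).add
      (hπ.lit (by norm_num)) (by omega)) (by decide) (by norm_num)
      ⟨c₂.setReg (by norm_num) _, h.out, ?_, ?_, by simp, ?_⟩
    · intro r hr
      have := h.reg r (by omega)
      simp only [State.setReg_reg, s₂, State.setMem_reg]
      rw [if_neg (by omega), this]
    · intro a ha
      have := h.mem a ha
      simp only [State.setReg_mem, s₂, State.setMem_mem]
      rw [if_neg (by omega), this]
    · rw [hbub]
      intro j hj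
      simp only [State.setReg_mem, s₂, State.setMem_mem]
      rcases lt_or_ge j arr.length with hjt | hjt
      · rw [if_neg (by omega), hst' j (by omega), List.getElem_append_left (by omega)]
      · have hjt' : j = arr.length := by simp at hj; omega
        subst hjt'
        rw [if_pos rfl, List.getElem_append_right (by omega)]
        simp

end

section

variable {β : Type*} [LinearOrder β] {v : ℕ → β} {π : Par} {A B : List ℕ} {s : State} {N : ℕ}

/-- The row and the column of a position. -/
def cellOf (p : ℕ) : List ℕ := [p % 2, p / 2]

lemma advance_runs (hπ : π.Good v) {i₀ i₁ lo hi : ℕ} {E arr : List ℕ}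
    (h : Mid π v A B i₀ i₁ E arr s) (hc : Candidates v lo hi A B) (hhi : hi + 1 < π.P)
    (hlen : i₀ + i₁ < π.k) (hN : π.k ≤ N)
    (hch : (s.reg 31 = 0 ∧ ∃ h₀ : i₀ < A.length, ∀ h₁ : i₁ < B.length, v B[i₁] < v A[i₀]) ∨
       (s.reg 31 = 1 ∧ ∃ h₁ : i₁ < B.length, ∀ h₀ : i₀ < A.length, v A[i₀] < v B[i₁])) :
    Runs π.W π.D advance s (advance.time N) fun s' => ∃ j₀ j₁ arr' p, j₀ + j₁ = i₀ + i₁ + 1 ∧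
      Mid π v A B j₀ j₁ (E ++ [p]) arr' s' ∧ s'.out = s.out ++ cellOf p := by
  have hbig := hπ.big
  have hk3 : (π.k + 3) * π.P = π.k * π.P + 3 * π.P := by ring
  have hkP : π.k ≤ π.k * π.P := Nat.le_mul_of_pos_right _ (by have := hπ.P_pos; omega)
  have hal := h.merging.arr_length
  have harrP : ∀ u ∈ arr, u < π.P := fun u hu => by
    rcases (h.merging.arr_mem u).1 hu with hu | hu
    · have := hc.mem₀ u (List.mem_of_mem_take hu); omega
    · have := hc.mem₁ u (List.mem_of_mem_take hu); omega
  have hcl := h.ready.clean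
  have h31 : s.reg 31 ≤ 1 := by rcases hch with hch | hch <;> omega
  have v31 : Ev π.W π.D s (.var 31) (s.reg 31) := .reg rfl (by norm_num) (by omega)
  refine Runs.bind' (P' := fun s' => Clean s' ∧ s'.mem = s.mem ∧ s'.out = s.out ∧
    (∀ r < 22, s'.reg r = s.reg r) ∧ s'.reg 24 = i₀ + i₁ ∧ ∃ j₀ j₁ p, j₀ + j₁ = i₀ + i₁ + 1 ∧
      Merging v A B j₀ j₁ (E ++ [p]) (bubble p arr) ∧ s'.reg 22 = j₀ ∧ s'.reg 23 = j₁ ∧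
      s'.reg 31 = p % 2 ∧ s'.reg 32 = p / 2 ∧ p < π.P) ?_ ?_
  · refine Runs.cond' hcl v31 (by decide) (fun hv => ?_) (fun hv => ?_)
    · obtain ⟨h31', h₁, hlt⟩ := hch.resolve_left (fun hn => hv hn.1)
      have mB := List.getElem_mem h₁
      have eB := hc.odd _ mB
      have bB := hc.mem₁ _ mB
      have hM := h.merging.step₁ h₁ hc.nodup₁ hc.disjoint hlt
      have hst := h.ready.mem₁ i₁ h₁
      set p := B[i₁]
      have l1 : Ev π.W π.D s (.ld (cellEx (.var 23) 3)) (p / 2) := by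
        have := Ev.ld (D := π.D) (s := s) (Ev.cell hπ (.reg h.r23 (by norm_num) (by omega))
          (by norm_num : 3 < 5) (by omega)) (by rw [hst]; omega)
        rwa [hst] at this
      refine Runs.seq' (.set hcl l1 (by decide) (by norm_num) ?_)
      have c1 := hcl.setReg (r := 32) (by norm_num) (p / 2)
      refine .set c1 ((Ev.reg (v := i₁) (by simp [h.r23]) (by norm_num) (by omega)).add
        (hπ.lit (by norm_num)) (by omega)) (by decide) (by norm_num)
        ⟨c1.setReg (by norm_num) _, rfl, rfl, fun r hr => ?_, by simp [h.r24], i₀, i₁ + 1, p,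
          by omega, hM, by simp [h.r22], by simp, by simp [h31', eB], by simp, by omega⟩
      rw [State.setReg_reg, if_neg (by omega), State.setReg_reg, if_neg (by omega)]
    · obtain ⟨h31', h₀, hlt⟩ := hch.resolve_right (fun hn => by omega)
      have mA := List.getElem_mem h₀
      have eA := hc.even _ mA
      have bA := hc.mem₀ _ mA
      have hM := h.merging.step₀ h₀ hc.nodup₀ hc.disjoint hlt
      have hst := h.ready.mem₀ i₀ h₀
      set p := A[i₀]
      have l1 : Ev π.W π.D s (.ld (cellEx (.var 22) 2)) (p / 2) := by
        have := Ev.ld (D := π.D) (s := s) (Ev.cell hπ (.reg h.r22 (by norm_num) (by omega))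
          (by norm_num : 2 < 5) (by omega)) (by rw [hst]; omega)
        rwa [hst] at this
      refine Runs.seq' (.set hcl l1 (by decide) (by norm_num) ?_)
      have c1 := hcl.setReg (r := 32) (by norm_num) (p / 2)
      refine .set c1 ((Ev.reg (v := i₀) (by simp [h.r22]) (by norm_num) (by omega)).add
        (hπ.lit (by norm_num)) (by omega)) (by decide) (by norm_num)
        ⟨c1.setReg (by norm_num) _, rfl, rfl, fun r hr => ?_, by simp [h.r24], i₀ + 1, i₁, p,
          by omega, hM, by simp, by simp [h.r23], by simp [h31', eA], by simp, by omega⟩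
      rw [State.setReg_reg, if_neg (by omega), State.setReg_reg, if_neg (by omega)]
  · rintro s₁ ⟨c1, m1, o1, r1, h24, j₀, j₁, p, hj, hM, h22, h23, h31, h32, hp⟩
    refine Runs.seq' (.outp c1 (.reg (v := p % 2) h31 (by norm_num) (by omega)) (by decide) ?_)
    refine Runs.seq' (.outp (c1.emit _) (.reg (v := p / 2) h32 (by norm_num) (by omega))
      (by decide) ?_)
    have c2 := (c1.emit (p % 2)).emit (p / 2)
    refine Runs.seq' (.set c2 (((hπ.lit (c := 2) (by norm_num)).mul
      (Ev.reg (r := 32) (v := p / 2) (by simp [h32]) (by norm_num) (by omega)) (by omega)).add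
      (Ev.reg (r := 31) (v := p % 2) (by simp [h31]) (by norm_num) (by omega)) (by omega)) (by decide) (by norm_num) ?_)
    rw [show 2 * (p / 2) + p % 2 = p by omega]
    refine (insert_runs hπ le_rfl harrP (by omega) hN (c2.setReg (by norm_num) _)
      (fun j hj => ?_) ?_ (x := p) (by simp) hp).mono le_rfl ?_
    · simp only [State.setReg_mem, State.emit_mem, m1]
      exact h.stored j hj
    · simp [h24, hal]
    · rintro s₂ ⟨c3, o3, r3, m3, h24', hst⟩
      have r3' : ∀ r < 24, s₂.reg r = s₁.reg r := fun r hr => by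
        rw [r3 r hr, State.setReg_reg, if_neg (by omega)]; rfl
      refine ⟨j₀, j₁, _, p, hj, ⟨?_, hM, hst, ?_, ?_, ?_⟩, ?_⟩
      · refine h.ready.congr c3 (fun r hr => (r3' r (by omega)).trans (r1 r hr)) fun a ha => ?_
        rw [m3 a ha]
        simp [m1]
      · rw [r3' 22 (by norm_num), h22]
      · rw [r3' 23 (by norm_num), h23]
      · rw [h24', hal, hj]
      · rw [o3]
        simp [o1, cellOf]

/-- The loop makes `min π.k (A.length + B.length)` iterations, each putting out the next element of
the merge. Its output is therefore a prefix of `mergeDesc v A B` of this length. -/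
lemma mergeProg_runs (hπ : π.Good v) {lo hi : ℕ} (hs : Ready π A B s) (h22 : s.reg 22 = 0)
    (h23 : s.reg 23 = 0) (h24 : s.reg 24 = 0)
    (hc : Candidates v lo hi A B) (hhi : hi + 1 < π.P) (hA : A.length ≤ π.k)
    (hB : B.length ≤ π.k) (hN : π.k ≤ N) :
    Runs π.W π.D mergeProg s (mergeProg.time N) fun s' =>
      s'.out = s.out ++ ((mergeDesc v A B).take π.k).flatMap cellOf := by
  have hbig := hπ.big
  have hk3 : (π.k + 3) * π.P = π.k * π.P + 3 * π.P := by ring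
  have hkP : π.k ≤ π.k * π.P := Nat.le_mul_of_pos_right _ (by have := hπ.P_pos; omega)
  have hW : 0 < π.W := by have := hπ.W_pos; omega
  have guard : ∀ {s' : State} {i₀ i₁ : ℕ} {E arr : List ℕ}, Mid π v A B i₀ i₁ E arr s' →
      Ev π.W π.D s' (.bin .and (.bin .lt (.var 24) (.var 2))
        (.bin .lt (.var 24) (.var 20 + .var 21)))
        (if i₀ + i₁ < min π.k (A.length + B.length) then 1 else 0) := by
    intro s' i₀ i₁ E arr h
    have l0 := h.merging.le₀
    have l1 := h.merging.le₁
    have e1 : Ev π.W π.D s' (.bin .lt (.var 24) (.var 2)) (if i₀ + i₁ < π.k then 1 else 0) :=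
      (Ev.reg h.r24 (by norm_num) (by omega)).lt' (.reg h.ready.r2 (by norm_num) (by omega)) hW
    have e2 : Ev π.W π.D s' (.bin .lt (.var 24) (.var 20 + .var 21))
        (if i₀ + i₁ < A.length + B.length then 1 else 0) :=
      (Ev.reg h.r24 (by norm_num) (by omega)).lt'
        ((Ev.reg h.ready.r20 (by norm_num) (by omega)).add
          (.reg h.ready.r21 (by norm_num) (by omega)) (by omega)) hW
    have hval : (if i₀ + i₁ < π.k then 1 else 0) &&& (if i₀ + i₁ < A.length + B.length then 1 else 0)
        = if i₀ + i₁ < min π.k (A.length + B.length) then 1 else 0 := by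
      split_ifs <;> first | rfl | (exfalso; omega)
    have := Ev.bin (o := .and) e1 e2 (by
      simp only [Op.eval]
      rw [hval]
      split_ifs <;> omega)
    simp only [Op.eval] at this
    rwa [hval] at this
  refine (Runs.whl' (n := min π.k (A.length + B.length)) (I := fun t s' => ∃ i₀ i₁ E arr,
    i₀ + i₁ = t ∧ Mid π v A B i₀ i₁ E arr s' ∧ s'.out = s.out ++ E.flatMap cellOf)
    (by omega) (by decide) ?_ ?_ ?_).mono le_rfl ?_
  · exact ⟨0, 0, [], [], rfl, ⟨hs, .zero v A B, fun j hj => by simp at hj, h22, h23, h24⟩, by simp⟩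
  · rintro t ht s' ⟨i₀, i₁, E, arr, rfl, h, ho⟩
    refine ⟨h.ready.clean, _, ?_, guard h, ?_⟩
    · simp [ht]
    refine Runs.bind' (choose_runs hπ h hc hhi hA hB (by omega) (by omega) hN) ?_
    rintro s₁ ⟨hk, hch⟩
    refine (advance_runs hπ (h.keep hk) hc hhi (by omega) hN hch).mono le_rfl ?_
    rintro s₂ ⟨j₀, j₁, arr', p, hj, hm, ho'⟩
    exact ⟨j₀, j₁, _, arr', hj, hm, by rw [ho', hk.out, ho]; simp⟩
  · rintro s' ⟨i₀, i₁, E, arr, hi, h, ho⟩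
    have := guard h
    rw [hi, if_neg (lt_irrefl _)] at this
    exact ⟨h.ready.clean, this⟩
  · rintro s' ⟨i₀, i₁, E, arr, hi, h, ho⟩
    rw [ho]
    have hE := h.merging.length
    have hfull := (mergeDesc_perm v A B).length_eq
    rw [List.length_append] at hfull
    have : (mergeDesc v A B).take π.k = E := by
      rw [List.take_eq_take_min, hfull, ← hi, ← hE, h.merging.eq, List.take_left]
    rw [this]

end

/-! ### The query program -/

/-- Field number `c` of the header of the data structure. -/
def headerEx (c : ℕ) : Ex := .rd (.lit c * .var 0) (.var 0)

/-- `r := x` -/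
def copy (r x : ℕ) : Prog := .op .or r x x

/-- Read the parameters. -/
def setup : Prog :=
  set 9 (headerEx 5) ;; set 10 (headerEx 6) ;; set 11 (headerEx 7) ;; set 12 (headerEx 8) ;;
  set 13 (headerEx 9) ;; set 14 (headerEx 10) ;; set 15 (headerEx 11) ;;
  set 16 (.lit 2 * .var 1 + .lit 1) ;; set 17 (headerEx 0)

/-- Run the program `Q` for the row `t`. -/
def rowProg (t : ℕ) (Q : Prog) : Prog :=
  set 7 (headerEx (1 + 2 * t)) ;; set 8 (headerEx (2 + 2 * t)) ;;
  copy (simReg t 0) 17 ;; copy (simReg t 1) 1 ;; copy (simReg t 2) 2 ;; copy (simReg t 3) 5 ;;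
  copy (simReg t 4) 6 ;; sim t Q ;; clear 4

/-- Run the program `Q` for both rows and merge the results. -/
def queryProg (Q : Prog) : Prog :=
  setup ;; cond (.var 3) .skip (rowProg 0 Q) ;; cond (.var 4) (rowProg 1 Q) .skip ;; mergeProg

/-- The registers and the memory of the `t`-th simulated program are empty. -/
structure Fresh (t : ℕ) (s : State) : Prop where
  reg : ∀ r, s.reg (simReg t r) = 0
  mem : ∀ a, s.mem (5 * a + t) = 0
  cnt : s.reg (20 + t) = 0

/-- The state `s'` contains the results `L` for the row `t`. -/
structure RowDone (t : ℕ) (L : List ℕ) (s s' : State) : Prop where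
  clean : Clean s'
  reg : ∀ r < 49, r ≠ 7 → r ≠ 8 → r ≠ 20 + t → s'.reg r = s.reg r
  cnt : s'.reg (20 + t) = L.length
  res : ∀ j (h : j < L.length), s'.mem (5 * j + 2 + t) = L[j]
  frame_reg : ∀ r, s'.reg (simReg (1 - t) r) = s.reg (simReg (1 - t) r)
  frame_mem : ∀ a, a % 5 ≠ t → a % 5 ≠ 2 + t → s'.mem a = s.mem a
  out : s'.out = s.out

lemma copy_runs {w : ℕ} {D : List Bool} {s : State} {r x v : ℕ} {P : State → Prop}
    (hx : s.reg x = v) (hv : v < 2 ^ w) (hP : P (s.setReg r v)) : Runs w D (copy r x) s 1 P := by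
  subst hx
  have := Exec.op (w := w) (D := D) .or r x x s (by simpa [Op.eval] using hv)
  simp only [Op.eval, Nat.or_self] at this
  exact this.runs hP

section

variable {W : ℕ} {D : List Bool} {s : State}

lemma Ev.header {c F : ℕ} (h0 : s.reg 0 = W) (hc : c * W < 2 ^ W) (hW : c < 2 ^ W)
    (hF : readBits D (c * W) W = F) : Ev W D s (headerEx c) F := by
  have h : Ev W D s (.var 0) W := .reg h0 (by norm_num) W.lt_two_pow_self
  have := Ev.rd ((Ev.lit hW).mul h hc) h le_rfl
  rwa [hF] at this

lemma set_header_runs {c F r : ℕ} {P : State → Prop} (hs : Clean s) (h0 : s.reg 0 = W)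
    (hc : c * W < 2 ^ W) (hW : c < 2 ^ W) (hF : readBits D (c * W) W = F) (hr : r < 49)
    (hP : P (s.setReg r F)) : Runs W D (set r (headerEx c)) s 9 P := by
  have hd : (headerEx c).depth = 2 := rfl
  have ht : (headerEx c).setTime = 9 := rfl
  exact (Runs.set (N := 0) hs (.header h0 hc hW hF) (by omega) hr hP).le
    (by rw [set_time, ht])

lemma rowProg_runs {t wQ n k a b base len V T : ℕ} {Q : Prog} {Dt : List Bool} {L : List ℕ}
    (ht : t ≤ 1) (hc : Clean s) (hf : Fresh t s) (h0 : s.reg 0 = W) (h17 : s.reg 17 = wQ)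
    (h1 : s.reg 1 = n) (h2 : s.reg 2 = k) (h5 : s.reg 5 = a) (h6 : s.reg 6 = b)
    (hwV : wQ < V) (hnV : n < V) (hkV : k < V) (haV : a < V) (hbV : b < V)
    (hW : 4 * W < 2 ^ W) (hW4 : 4 ≤ W)
    (hF1 : readBits D ((1 + 2 * t) * W) W = base) (hF2 : readBits D ((2 + 2 * t) * W) W = len)
    (hV : 2 ^ wQ ≤ V) (hV' : 5 * V + 5 < 2 ^ W) (hw : wQ ≤ W) (hlen : len < 2 ^ W)
    (hbase : base + V < 2 ^ W)
    (hread : ∀ x y, x < V → y ≤ wQ →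
      readBits D (base + x) (min y (len - x)) = readBits Dt x y)
    (hQ : Computes Q wQ Dt [n, k, a, b] T L) (hL : L.length < V) :
    Runs W D (rowProg t Q) s (7 * T + 28) (RowDone t L s) := by
  obtain ⟨T', hT', s', hex, rfl⟩ := hQ
  have hhdr : ∀ c ≤ 4, c * W < 2 ^ W ∧ c < 2 ^ W := fun c hc =>
    ⟨(Nat.mul_le_mul_right W hc).trans_lt hW, by omega⟩
  refine Runs.le (n := 9 + (9 + (1 + (1 + (1 + (1 + (1 + (7 * T + 5)))))))) ?_ (by omega)
  refine Runs.seq (set_header_runs hc h0 (hhdr _ (by omega)).1 (hhdr _ (by omega)).2 hF1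
    (by norm_num) ?_)
  have c1 := hc.setReg (r := 7) (by norm_num) base
  refine Runs.seq (set_header_runs c1 (by simp [h0]) (hhdr _ (by omega)).1 (hhdr _ (by omega)).2 hF2
    (by norm_num) ?_)
  have c2 := c1.setReg (r := 8) (by norm_num) len
  set s₂ := (s.setReg 7 base).setReg 8 len with hs₂
  have hne : ∀ r ≤ 17, ∀ q, r ≠ simReg t q := fun r hr q => by unfold simReg; omega
  refine Runs.seq (copy_runs (v := wQ) (by simp [s₂, h17]) (by omega) ?_)
  refine Runs.seq (copy_runs (v := n) (by simp [s₂, h1, hne]) (by omega) ?_)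
  refine Runs.seq (copy_runs (v := k) (by simp [s₂, h2, hne]) (by omega) ?_)
  refine Runs.seq (copy_runs (v := a) (by simp [s₂, h5, hne]) (by omega) ?_)
  refine Runs.seq (copy_runs (v := b) (by simp [s₂, h6, hne]) (by omega) ?_)
  set σ := ((((s₂.setReg (simReg t 0) wQ).setReg (simReg t 1) n).setReg (simReg t 2) k).setReg
    (simReg t 3) a).setReg (simReg t 4) b with hσ
  have hlow : ∀ r < 100, σ.reg r = s₂.reg r := fun r hr => by
    have : ∀ q, r ≠ simReg t q := fun q => by unfold simReg; omega
    simp [σ, this]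
  have hinj : ∀ q q', simReg t q = simReg t q' ↔ q = q' := fun q q' => by unfold simReg; omega
  have hS : Sim t (initState (wQ :: [n, k, a, b])) σ := by
    refine ⟨fun r => ?_, fun x => ?_, ?_, fun j hj => ?_⟩
    · simp only [σ, State.setReg_reg, hinj]
      rcases Nat.lt_or_ge r 5 with hr | hr
      · interval_cases r <;> simp [initState]
      · rw [if_neg (by omega), if_neg (by omega), if_neg (by omega), if_neg (by omega),
          if_neg (by omega)]
        have h7 : simReg t r ≠ 7 := (hne 7 (by norm_num) r).symm
        have h8 : simReg t r ≠ 8 := (hne 8 (by norm_num) r).symm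
        simp only [s₂, State.setReg_reg, h7, h8, if_false, hf.reg]
        simp [initState, hr]
    · simpa [σ, s₂, initState] using hf.mem x
    · rw [hlow _ (by omega)]
      simp only [s₂, State.setReg_reg]
      rw [if_neg (by omega), if_neg (by omega), hf.cnt]
      rfl
    · simp [initState] at hj
  have hB : (initState (wQ :: [n, k, a, b])).Below V := by
    refine ⟨fun r => ?_, fun x => by simp [initState]; omega⟩
    rcases Nat.lt_or_ge r 5 with hr | hr
    · interval_cases r <;> simpa [initState]
    · simp [initState, hr]; omega
  obtain ⟨m, hm, σ', hx, hS', hfr, -⟩ := Exec.sim hex ht hV hV' hw hlen hbase hread hB hL σ hS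
    (by rw [hlow _ (by norm_num)]; simp [s₂]) (by rw [hlow _ (by norm_num)]; simp [s₂])
  refine Runs.seq ((hx.runs ?_).le (hm.trans (Nat.mul_le_mul_left 7 hT')))
  -- The simulation uses the scratch registers `50, …, 53`; clearing these four makes the state
  -- clean again.
  refine (exec_clear W D σ' 4).runs ⟨fun r hr hr' => ?_, fun r hr h7 h8 h20 => ?_, ?_, hS'.out,
    fun r => ?_, fun x hx1 hx2 => ?_, ?_⟩
  · dsimp only
    split_ifs with h
    · rfl
    · rcases Nat.lt_or_ge r 50 with h' | h'
      · rw [hfr.low r h' (by omega), hlow _ hr']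
        exact c2 r hr hr'
      · rw [hfr.mid r (by omega) hr', hlow _ hr']
        exact c2 r hr hr'
  · dsimp only
    rw [if_neg (by omega), hfr.low r (by omega) h20, hlow _ (by omega)]
    simp [s₂, h7, h8]
  · dsimp only
    rw [if_neg (by omega), hS'.cnt]
  · dsimp only
    rw [if_neg (by unfold simReg; omega), hfr.reg]
    have h3 : ∀ q, simReg (1 - t) r ≠ simReg t q := fun q => by unfold simReg; omega
    have h7 : simReg (1 - t) r ≠ 7 := by unfold simReg; omega
    have h8 : simReg (1 - t) r ≠ 8 := by unfold simReg; omega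
    simp [σ, s₂, h3, h7, h8]
  · dsimp only
    rw [hfr.mem x hx1 hx2]
    rfl
  · exact hfr.out

end

section

variable {β : Type*} [LinearOrder β] {v : ℕ → β} {π : Par} {s : State}

/-- A part of the data structure answers the query `(a, b)` on one row. -/
structure RowCode (π : Par) (Q : Prog) (wQ n a b base len V T : ℕ) (Dt : List Bool)
    (L : List ℕ) : Prop where
  len_lt : len < 2 ^ π.W
  base_lt : base + V < 2 ^ π.W
  read : ∀ x y, x < V → y ≤ wQ → readBits π.D (base + x) (min y (len - x)) = readBits Dt x y
  computes : Computes Q wQ Dt [n, π.k, a, b] T L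
  length_lt : L.length < V

/-- The header of the data structure. -/
structure Header (π : Par) (wQ base₀ len₀ base₁ len₁ : ℕ) : Prop where
  f0 : readBits π.D (0 * π.W) π.W = wQ
  f1 : readBits π.D (1 * π.W) π.W = base₀
  f2 : readBits π.D (2 * π.W) π.W = len₀
  f3 : readBits π.D (3 * π.W) π.W = base₁
  f4 : readBits π.D (4 * π.W) π.W = len₁
  f5 : readBits π.D (5 * π.W) π.W = π.SB
  f6 : readBits π.D (6 * π.W) π.W = π.BB
  f7 : readBits π.D (7 * π.W) π.W = π.TB
  f8 : readBits π.D (8 * π.W) π.W = π.sz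
  f9 : readBits π.D (9 * π.W) π.W = π.sz * π.g
  f10 : readBits π.D (10 * π.W) π.W = π.h
  f11 : readBits π.D (11 * π.W) π.W = 2 ^ (π.sz * π.h)

lemma setup_runs {wQ base₀ len₀ base₁ len₁ : ℕ} (hH : Header π wQ base₀ len₀ base₁ len₁)
    (hW : 11 * π.W < 2 ^ π.W) (hW1 : 1 ≤ π.W) (hs : Clean s) (h0 : s.reg 0 = π.W)
    (h1 : 2 * s.reg 1 + 1 < 2 ^ π.W) (h1' : 2 * s.reg 1 + 1 = π.P) :
    Runs π.W π.D setup s 84 fun s' => Clean s' ∧ s'.mem = s.mem ∧ s'.out = s.out ∧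
      (∀ r, r < 9 ∨ 18 ≤ r → s'.reg r = s.reg r) ∧
      LayoutRegs s' π.W π.SB π.BB π.TB π.sz π.g π.h ∧ s'.reg 16 = π.P ∧ s'.reg 17 = wQ := by
  have hhdr : ∀ c ≤ 11, c * π.W < 2 ^ π.W := fun c hc => (Nat.mul_le_mul_right π.W hc).trans_lt hW
  have hlit : ∀ c ≤ 11, c < 2 ^ π.W := fun c hc =>
    (hc.trans (Nat.le_mul_of_pos_right 11 hW1)).trans_lt hW
  refine Runs.le (n := 9 + (9 + (9 + (9 + (9 + (9 + (9 + (9 + 9)))))))) ?_ (by omega)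
  refine Runs.seq (set_header_runs hs h0 (hhdr _ (by norm_num)) (hlit _ (by norm_num)) hH.f5
    (by norm_num) ?_)
  have c1 := hs.setReg (r := 9) (by norm_num) π.SB
  refine Runs.seq (set_header_runs c1 (by simp [h0]) (hhdr _ (by norm_num)) (hlit _ (by norm_num))
    hH.f6 (by norm_num) ?_)
  have c2 := c1.setReg (r := 10) (by norm_num) π.BB
  refine Runs.seq (set_header_runs c2 (by simp [h0]) (hhdr _ (by norm_num)) (hlit _ (by norm_num))
    hH.f7 (by norm_num) ?_)
  have c3 := c2.setReg (r := 11) (by norm_num) π.TB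
  refine Runs.seq (set_header_runs c3 (by simp [h0]) (hhdr _ (by norm_num)) (hlit _ (by norm_num))
    hH.f8 (by norm_num) ?_)
  have c4 := c3.setReg (r := 12) (by norm_num) π.sz
  refine Runs.seq (set_header_runs c4 (by simp [h0]) (hhdr _ (by norm_num)) (hlit _ (by norm_num))
    hH.f9 (by norm_num) ?_)
  have c5 := c4.setReg (r := 13) (by norm_num) (π.sz * π.g)
  refine Runs.seq (set_header_runs c5 (by simp [h0]) (hhdr _ (by norm_num)) (hlit _ (by norm_num))
    hH.f10 (by norm_num) ?_)
  have c6 := c5.setReg (r := 14) (by norm_num) π.h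
  refine Runs.seq (set_header_runs c6 (by simp [h0]) (hhdr _ (by norm_num)) (hlit _ (by norm_num))
    hH.f11 (by norm_num) ?_)
  have c7 := c6.setReg (r := 15) (by norm_num) (2 ^ (π.sz * π.h))
  have ht : (Ex.lit 2 * .var 1 + .lit 1).setTime = 9 := rfl
  refine Runs.seq ((Runs.set (N := 0) c7 (((Ev.lit (hlit 2 (by norm_num))).mul
    (Ev.reg (r := 1) (v := s.reg 1) (by simp) (by norm_num) (by omega)) (by omega)).add
    (Ev.lit (hlit 1 (by norm_num))) h1) (by decide) (by norm_num) ?_).le (by rw [set_time, ht]))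
  have c8 := c7.setReg (r := 16) (by norm_num) (2 * s.reg 1 + 1)
  refine set_header_runs c8 (by simp [h0]) (hhdr _ (by norm_num)) (hlit _ (by norm_num)) hH.f0
    (by norm_num) ?_
  have c9 := c8.setReg (r := 17) (by norm_num) wQ
  refine ⟨c9, rfl, rfl, fun r hr => ?_, ⟨by simp [h0], by simp, by simp, by simp, by simp,
    by simp, by simp, by simp⟩, by simp [h1'], by simp⟩
  simp only [State.setReg_reg]
  repeat rw [if_neg (by omega)]

/-- Row `0` belongs to the query exactly if `i = 0`, and row `1` exactly if `j ≠ 0`. A row outside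
the query is skipped, which leaves its list empty, and merging with an empty list needs no
comparisons. -/
lemma queryProg_runs (hπ : π.Good v) {n i j a b lo hi : ℕ} (hP : π.P = 2 * n + 1)
    {wQ base₀ len₀ base₁ len₁ V T : ℕ} {Q : Prog} {D₀ D₁ : List Bool} {L₀ L₁ : List ℕ}
    (hH : Header π wQ base₀ len₀ base₁ len₁) (hW : 11 * π.W < 2 ^ π.W)
    (hwV : wQ < V) (hnV : n < V) (hkV : π.k < V) (haV : a < V) (hbV : b < V)
    (hV : 2 ^ wQ ≤ V) (hV' : 5 * V + 5 < 2 ^ π.W) (hw : wQ ≤ π.W) (hi1 : i ≤ 1) (hj1 : j ≤ 1)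
    (h₀ : i = 0 → RowCode π Q wQ n a b base₀ len₀ V T D₀ L₀) (h₀' : i ≠ 0 → L₀ = [])
    (h₁ : j ≠ 0 → RowCode π Q wQ n a b base₁ len₁ V T D₁ L₁) (h₁' : j = 0 → L₁ = [])
    (hc : Candidates v lo hi (L₀.map (2 * ·)) (L₁.map (2 * · + 1))) (hhi : hi + 1 < π.P)
    (hL₀ : L₀.length ≤ π.k) (hL₁ : L₁.length ≤ π.k) :
    Computes (queryProg Q) π.W π.D [n, π.k, i, j, a, b] (mergeProg.time π.k + 14 * T + 200)
      (((mergeDesc v (L₀.map (2 * ·)) (L₁.map (2 * · + 1))).take π.k).flatMap cellOf) := by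
  have hbig := hπ.big
  have hk3 : (π.k + 3) * π.P = π.k * π.P + 3 * π.P := by ring
  have hW4 := hπ.W_pos
  change Runs π.W π.D (queryProg Q) _ _ _
  set s := initState (π.W :: [n, π.k, i, j, a, b]) with hs
  have hsr : ∀ r, 7 ≤ r → s.reg r = 0 := fun r hr => by simp [s, initState, hr]
  have s0 : s.reg 0 = π.W := rfl
  have s1 : s.reg 1 = n := rfl
  have s2 : s.reg 2 = π.k := rfl
  have s3 : s.reg 3 = i := rfl
  have s4 : s.reg 4 = j := rfl
  have s5 : s.reg 5 = a := rfl
  have s6 : s.reg 6 = b := rfl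
  have hcl : Clean s := fun r hr _ => hsr r (by omega)
  have ht : ∀ r, (Ex.var r).setTime = 4 := fun r => rfl
  -- The setup takes `84` steps; each row costs its simulation plus the conditional around it. The
  -- sum is rounded up to `200` in the statement.
  refine Runs.le (n := 84 + ((4 + (7 * T + 28 + 2)) + ((4 + (7 * T + 28 + 2)) + mergeProg.time π.k)))
    ?_ (by omega)
  refine Runs.bind (setup_runs hH hW (by omega) hcl s0 (by omega) (by omega)) ?_
  rintro s₁ ⟨c1, m1, o1, r1, l1, h16, h17⟩
  refine Runs.bind (P' := RowDone 0 (L₀) s₁) ?_ ?_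
  · refine (Runs.cond (n := 7 * T + 28) c1 (Ev.reg (v := i) (by rw [r1 3 (by norm_num), s3])
      (by norm_num) (by omega)) (by decide) (fun hi0 => ?_) (fun hi0 => ?_)).le (by rw [ht])
    · obtain rfl := h₀' hi0
      refine (Runs.skip ?_).le (by omega)
      exact ⟨c1, fun _ _ _ _ _ => rfl, by rw [r1 _ (by norm_num), hsr _ (by norm_num)]; rfl,
        fun j hj => by simp at hj, fun _ => rfl, fun _ _ _ => rfl, rfl⟩
    · have h := h₀ hi0
      refine rowProg_runs (t := 0) (by norm_num) c1 ⟨fun r => ?_, fun a => ?_, ?_⟩ l1.r0 h17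
        (by rw [r1 1 (by norm_num), s1]) (by rw [r1 2 (by norm_num), s2])
        (by rw [r1 5 (by norm_num), s5]) (by rw [r1 6 (by norm_num), s6]) hwV hnV hkV haV hbV
        (by omega) hW4 hH.f1 hH.f2 hV hV' hw h.len_lt h.base_lt h.read h.computes h.length_lt
      · rw [r1 _ (by unfold simReg; omega), hsr _ (by unfold simReg; omega)]
      · rw [m1]; rfl
      · rw [r1 _ (by norm_num), hsr _ (by norm_num)]
  intro s₂ d0
  have r2 : ∀ r < 49, r ≠ 7 → r ≠ 8 → r ≠ 20 → s₂.reg r = s₁.reg r := d0.reg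
  refine Runs.bind (P' := RowDone 1 (L₁) s₂) ?_ ?_
  · refine (Runs.cond (n := 7 * T + 28) d0.clean (Ev.reg (v := j)
      (by rw [r2 4 (by norm_num) (by norm_num) (by norm_num) (by norm_num), r1 4 (by norm_num), s4])
      (by norm_num) (by omega)) (by decide) (fun hi0 => ?_) (fun hi0 => ?_)).le (by rw [ht])
    · have h := h₁ hi0
      have e : ∀ r < 9, r ≠ 7 → r ≠ 8 → s₂.reg r = s.reg r := fun r hr h7 h8 => by
        rw [r2 r (by omega) h7 h8 (by omega), r1 r (by omega)]
      refine rowProg_runs (t := 1) (by norm_num) d0.clean ⟨fun r => ?_, fun a => ?_, ?_⟩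
        (e 0 (by norm_num) (by norm_num) (by norm_num))
        ((r2 17 (by norm_num) (by norm_num) (by norm_num) (by norm_num)).trans h17)
        (e 1 (by norm_num) (by norm_num) (by norm_num))
        (e 2 (by norm_num) (by norm_num) (by norm_num))
        (e 5 (by norm_num) (by norm_num) (by norm_num))
        (e 6 (by norm_num) (by norm_num) (by norm_num)) hwV hnV hkV haV hbV
        (by omega) hW4 hH.f3 hH.f4 hV hV' hw h.len_lt h.base_lt h.read h.computes h.length_lt
      · rw [d0.frame_reg r, r1 _ (by unfold simReg; omega), hsr _ (by unfold simReg; omega)]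
      · rw [d0.frame_mem _ (by omega) (by omega), m1]; rfl
      · rw [r2 _ (by norm_num) (by norm_num) (by norm_num) (by norm_num), r1 _ (by norm_num),
          hsr _ (by norm_num)]
    · obtain rfl := h₁' hi0
      refine (Runs.skip ?_).le (by omega)
      refine ⟨d0.clean, fun _ _ _ _ _ => rfl, ?_,
        fun j hj => by simp at hj, fun _ => rfl, fun _ _ _ => rfl, rfl⟩
      rw [r2 _ (by norm_num) (by norm_num) (by norm_num) (by norm_num), r1 _ (by norm_num),
          hsr _ (by norm_num)]
      rfl
  intro s₃ d1
  have r3 : ∀ r < 49, r ≠ 7 → r ≠ 8 → r ≠ 20 → r ≠ 21 → s₃.reg r = s₁.reg r :=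
    fun r h h7 h8 h20 h21 => (d1.reg r h h7 h8 h21).trans (r2 r h h7 h8 h20)
  have z : ∀ r, 22 ≤ r → r < 25 → s₃.reg r = 0 := fun r h h' => by
    rw [r3 r (by omega) (by omega) (by omega) (by omega) (by omega), r1 r (by omega),
      hsr r (by omega)]
  have hR : Ready π (L₀.map (2 * ·)) (L₁.map (2 * · + 1)) s₃ := by
    refine ⟨d1.clean, ⟨?_, ?_, ?_, ?_, ?_, ?_, ?_, ?_⟩, ?_, ?_, ?_, ?_, fun j hj => ?_,
      fun j hj => ?_⟩
    · exact (r3 0 (by norm_num) (by norm_num) (by norm_num) (by norm_num) (by norm_num)).trans l1.r0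
    · exact (r3 9 (by norm_num) (by norm_num) (by norm_num) (by norm_num) (by norm_num)).trans l1.r9
    · exact (r3 10 (by norm_num) (by norm_num) (by norm_num) (by norm_num) (by norm_num)).trans l1.r10
    · exact (r3 11 (by norm_num) (by norm_num) (by norm_num) (by norm_num) (by norm_num)).trans l1.r11
    · exact (r3 12 (by norm_num) (by norm_num) (by norm_num) (by norm_num) (by norm_num)).trans l1.r12
    · exact (r3 13 (by norm_num) (by norm_num) (by norm_num) (by norm_num) (by norm_num)).trans l1.r13
    · exact (r3 14 (by norm_num) (by norm_num) (by norm_num) (by norm_num) (by norm_num)).trans l1.r14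
    · exact (r3 15 (by norm_num) (by norm_num) (by norm_num) (by norm_num) (by norm_num)).trans l1.r15
    · rw [r3 2 (by norm_num) (by norm_num) (by norm_num) (by norm_num) (by norm_num),
        r1 2 (by norm_num), s2]
    · rw [r3 16 (by norm_num) (by norm_num) (by norm_num) (by norm_num) (by norm_num), h16]
    · rw [d1.reg 20 (by norm_num) (by norm_num) (by norm_num) (by norm_num), List.length_map]
      exact d0.cnt
    · rw [List.length_map]
      exact d1.cnt
    · rw [List.length_map] at hj
      rw [d1.frame_mem _ (by omega) (by omega), List.getElem_map]
      have := d0.res j hj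
      simp only [add_zero] at this
      rw [this]
      omega
    · rw [List.length_map] at hj
      rw [List.getElem_map]
      have := d1.res j hj
      rw [show 5 * j + 3 = 5 * j + 2 + 1 by ring, this]
      omega
  refine (mergeProg_runs hπ hR (z 22 (by norm_num) (by norm_num)) (z 23 (by norm_num) (by norm_num))
    (z 24 (by norm_num) (by norm_num)) hc hhi (by simpa) (by simpa) le_rfl).mono le_rfl ?_
  intro s' h
  rw [h, d1.out, d0.out, o1]
  rfl

end

end WordRAM

/-! ### Numbering of the cells, and correctness of the merged answer. -/

namespace RangeTopK

open WordRAM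

section

variable {α : Type*} [LinearOrder α] {n k : ℕ}

/-- The position with a given number; the positions are numbered column by column. -/
def posOf (hn : 0 < n) (p : ℕ) : Fin 2 × Fin n :=
  (⟨p % 2, Nat.mod_lt _ two_pos⟩, ⟨p / 2 % n, Nat.mod_lt _ hn⟩)

/-- The number of a position. -/
def numOf (p : Fin 2 × Fin n) : ℕ := 2 * (p.2 : ℕ) + p.1

lemma posOf_numOf (hn : 0 < n) (p : Fin 2 × Fin n) : posOf hn (numOf p) = p := by
  obtain ⟨r, c⟩ := p
  have hr := r.isLt
  have hc := c.isLt
  refine Prod.ext (Fin.ext ?_) (Fin.ext ?_)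
  · simp only [posOf, numOf]; omega
  · simp only [posOf, numOf]
    rw [show (2 * (c : ℕ) + r) / 2 = c by omega, Nat.mod_eq_of_lt hc]

lemma numOf_posOf (hn : 0 < n) {p : ℕ} (hp : p < 2 * n) : numOf (posOf hn p) = p := by
  simp only [posOf, numOf]
  rw [Nat.mod_eq_of_lt (by omega : p / 2 < n)]
  omega

/-- The key of the position with a given number. -/
def numKey (A : Fin 2 → Fin n → α) (hn : 0 < n) (p : ℕ) : α ×ₗ (Fin 2 ×ₗ Fin n) :=
  key2 A (posOf hn p)

/-- Within a row, ties are broken as in the 1D array, so the 1D answers are sorted for the 2D order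
too. -/
lemma key2_lt_iff (A : Fin 2 → Fin n → α) (r : Fin 2) (p q : Fin n) :
    key2 A (r, p) < key2 A (r, q) ↔ key1 (A r) p < key1 (A r) q := by
  simp [key1, key2, Prod.Lex.toLex_lt_toLex]

lemma key2_injective {γ : Type*} (A : Fin 2 → Fin n → γ) : Function.Injective (key2 A) := fun p q h => by
  have := congrArg (fun x => (ofLex (ofLex x).2)) h
  simpa [key2] using this

/-- Otherwise `v q ≤ v p`, so `q` is not in `C` and every element of `C` precedes `q` in `M`. Then
`q` and the at least `k` elements of `C` would all be among the first `k` elements of `M`. This is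
how a row's own list excludes all other cells of that row. -/
lemma lt_of_mem_take {β : Type*} [LinearOrder β] {v : ℕ → β} {M C : List ℕ} {p q k : ℕ}
    (hM : M.Pairwise fun x y => v y < v x) (hC : C.Nodup) (hk : k ≤ C.length) (hCM : C ⊆ M)
    (hp : ∀ x ∈ C, v p < v x) (hq : q ∈ M.take k) : v p < v q := by
  by_contra hn
  have hqC : q ∉ C := fun h => hn (hp q h)
  rw [← List.take_append_drop k M, List.pairwise_append] at hM
  have hsub : q :: C ⊆ M.take k := by
    intro x hx
    rcases List.mem_cons.1 hx with rfl | hx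
    · exact hq
    · have h1 := hCM hx
      rw [← List.take_append_drop k M, List.mem_append] at h1
      rcases h1 with h1 | h1
      · exact h1
      · exact absurd ((hp x hx).trans (hM.2.2 q hq x h1)) hn
  have := ((List.nodup_cons.2 ⟨hqC, hC⟩).subperm hsub).length_le
  rw [List.length_cons, List.length_take] at this
  omega

lemma IsSortedTopK.nodup {P β : Type*} [LinearOrder β] {key : P → β} {R : Finset P} {L : List P}
    (h : IsSortedTopK key R k L) : L.Nodup :=
  List.Pairwise.imp (fun {x y} hlt => fun he : x = y => lt_irrefl (key x) (he ▸ hlt)) h.1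

/-- A list that misses some position of the range is not exhaustive, so the minimum in its length is
`k`. -/
lemma IsSortedTopK.length_eq_of_not_mem {P β : Type*} [LinearOrder β] {key : P → β}
    {R : Finset P} {L : List P} (h : IsSortedTopK key R k L) {p : P} (hp : p ∈ R) (hL : p ∉ L) :
    L.length = k := by
  classical
  have h1 : L.toFinset.card < R.card := Finset.card_lt_card <| by
    refine ⟨fun x hx => h.2.1 x (List.mem_toFinset.1 hx), fun hs => hL ?_⟩
    exact List.mem_toFinset.1 (hs hp)
  rw [List.toFinset_card_of_nodup h.nodup] at h1
  have := h.2.2.1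
  omega

/-- The answer to a query on the rows `i, …, j`, given the answers for the single rows. -/
structure RowAnswers (A : Fin 2 → Fin n → α) (k : ℕ) (i j : Fin 2) (a b : Fin n)
    (L₀ L₁ : List (Fin n)) : Prop where
  zero : i = 0 → IsSortedTopK (key1 (A 0)) (Finset.Icc a b) k L₀
  zero' : i ≠ 0 → L₀ = []
  one : j ≠ 0 → IsSortedTopK (key1 (A 1)) (Finset.Icc a b) k L₁
  one' : j = 0 → L₁ = []

/-- The numbers of the positions in the row `r` and the columns `L`. -/
def rowNums (r : Fin 2) (L : List (Fin n)) : List ℕ := L.map fun c => numOf (r, c)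

lemma mem_rowNums {r : Fin 2} {L : List (Fin n)} {p : Fin 2 × Fin n} :
    numOf p ∈ rowNums r L ↔ p.1 = r ∧ p.2 ∈ L := by
  obtain ⟨r', c'⟩ := p
  simp only [rowNums, List.mem_map, numOf]
  constructor
  · rintro ⟨c, hc, he⟩
    have := r.isLt
    have := r'.isLt
    have h1 : c = c' := Fin.ext (by omega)
    subst h1
    exact ⟨Fin.ext (by omega), hc⟩
  · rintro ⟨rfl, hc⟩
    exact ⟨c', hc, rfl⟩

variable {A : Fin 2 → Fin n → α} {i j : Fin 2} {a b : Fin n} {L₀ L₁ : List (Fin n)}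

lemma sorted_rowNums (hn : 0 < n) {r : Fin 2} {L : List (Fin n)} {R : Finset (Fin n)}
    (h : IsSortedTopK (key1 (A r)) R k L) :
    (rowNums r L).Pairwise fun p q => numKey A hn q < numKey A hn p := by
  rw [rowNums, List.pairwise_map]
  refine h.1.imp fun hlt => ?_
  rw [numKey, numKey, posOf_numOf, posOf_numOf, key2_lt_iff]
  exact hlt

lemma bounds_rowNums {r : Fin 2} {L : List (Fin n)}
    (h : IsSortedTopK (key1 (A r)) (Finset.Icc a b) k L) :
    ∀ p ∈ rowNums r L, 2 * (a : ℕ) ≤ p ∧ p ≤ 2 * b + 1 := by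
  intro p hp
  obtain ⟨c, hc, rfl⟩ := List.mem_map.1 hp
  have h1 := Finset.mem_Icc.1 (h.2.1 c hc)
  have h2 : (a : ℕ) ≤ c := h1.1
  have h3 : (c : ℕ) ≤ b := h1.2
  have h4 := r.isLt
  simp only [numOf]
  omega

lemma max_rowNums (hn : 0 < n) {r : Fin 2} {L : List (Fin n)}
    (h : IsSortedTopK (key1 (A r)) (Finset.Icc a b) k L) {p : ℕ} (h1 : 2 * (a : ℕ) ≤ p)
    (h2 : p ≤ 2 * b + 1) (h3 : p % 2 = r) (h4 : p ∉ rowNums r L) :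
    ∀ q ∈ rowNums r L, numKey A hn p < numKey A hn q := by
  intro q hq
  obtain ⟨c, hc, rfl⟩ := List.mem_map.1 hq
  have hb := b.isLt
  have hp : numOf (posOf hn p) = p := numOf_posOf hn (by omega)
  rw [← hp] at h4 ⊢
  have hr : (posOf hn p).1 = r := Fin.ext h3
  have hv : ((posOf hn p).2 : ℕ) = p / 2 := Nat.mod_eq_of_lt (by omega)
  have hm : (posOf hn p).2 ∉ L := fun hm => h4 (mem_rowNums.2 ⟨hr, hm⟩)
  rw [numKey, numKey, posOf_numOf, posOf_numOf, ← Prod.mk.eta (p := posOf hn p), hr, key2_lt_iff]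
  refine h.2.2.2 _ (Finset.mem_Icc.2 ⟨?_, ?_⟩) hm _ hc
  · change (a : ℕ) ≤ _
    omega
  · change _ ≤ (b : ℕ)
    omega

lemma RowAnswers.candidates (hn : 0 < n) (h : RowAnswers A k i j a b L₀ L₁) :
    Candidates (numKey A hn) (2 * a) (2 * b + 1) (rowNums 0 L₀) (rowNums 1 L₁) := by
  have hb := b.isLt
  have n0 : i ≠ 0 → ∀ p, p ∉ rowNums (0 : Fin 2) L₀ := fun hi p => by simp [h.zero' hi, rowNums]
  have n1 : j = 0 → ∀ p, p ∉ rowNums (1 : Fin 2) L₁ := fun hi p => by simp [h.one' hi, rowNums]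
  refine ⟨?_, ?_, ?_, ?_, ?_, ?_, ?_, ?_, ?_⟩
  · intro p hp
    obtain ⟨c, hc, rfl⟩ := List.mem_map.1 hp
    simp [numOf]
  · intro p hp
    obtain ⟨c, hc, rfl⟩ := List.mem_map.1 hp
    simp [numOf]
  · intro p hp
    by_cases hi : i = 0
    · exact bounds_rowNums (h.zero hi) p hp
    · exact absurd hp (n0 hi p)
  · intro p hp
    by_cases hj : j = 0
    · exact absurd hp (n1 hj p)
    · exact bounds_rowNums (h.one hj) p hp
  · by_cases hi : i = 0
    · exact sorted_rowNums hn (h.zero hi)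
    · simp [h.zero' hi, rowNums]
  · by_cases hj : j = 0
    · simp [h.one' hj, rowNums]
    · exact sorted_rowNums hn (h.one hj)
  · intro p h1 h2 h3 h4 q hq
    by_cases hi : i = 0
    · exact max_rowNums hn (h.zero hi) h1 h2 h3 h4 q hq
    · exact absurd hq (n0 hi q)
  · intro p h1 h2 h3 h4 q hq
    by_cases hj : j = 0
    · exact absurd hq (n1 hj q)
    · exact max_rowNums hn (h.one hj) h1 h2 h3 h4 q hq
  -- `posOf` reduces columns modulo `n`, so the keys are distinct only on numbers below `2 * n`.
  · intro p hp q hq he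
    have := congrArg numOf (key2_injective A he)
    rwa [numOf_posOf hn (by omega), numOf_posOf hn (by omega)] at this

/-- The answer that the merging program computes. -/
def mergedAnswer (A : Fin 2 → Fin n → α) (hn : 0 < n) (k : ℕ) (L₀ L₁ : List (Fin n)) :
    List (Fin 2 × Fin n) :=
  ((mergeDesc (numKey A hn) (rowNums 0 L₀) (rowNums 1 L₁)).take k).map (posOf hn)

lemma RowAnswers.isSortedTopK (hn : 0 < n) (hij : i ≤ j) (h : RowAnswers A k i j a b L₀ L₁) :
    IsSortedTopK (key2 A) (Finset.Icc i j ×ˢ Finset.Icc a b) k (mergedAnswer A hn k L₀ L₁) := by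
  have hc := h.candidates hn
  have hsort := mergeDesc_sorted (numKey A hn) hc.sorted₀ hc.sorted₁ hc.ne
  have hperm := mergeDesc_perm (numKey A hn) (rowNums 0 L₀) (rowNums 1 L₁)
  have hmem : ∀ p, p ∈ mergeDesc (numKey A hn) (rowNums 0 L₀) (rowNums 1 L₁) ↔
      p ∈ rowNums 0 L₀ ∨ p ∈ rowNums 1 L₁ := fun p => by rw [hperm.mem_iff, List.mem_append]
  have hlen := hperm.length_eq
  set M := mergeDesc (numKey A hn) (rowNums 0 L₀) (rowNums 1 L₁) with hM
  have hl₀ : (rowNums 0 L₀).length = L₀.length := List.length_map _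
  have hl₁ : (rowNums 1 L₁).length = L₁.length := List.length_map _
  have hi01 : i = 0 ∨ i = 1 := by omega
  have hj01 : j = 0 ∨ j = 1 := by omega
  refine ⟨?_, ?_, ?_, ?_⟩
  · rw [mergedAnswer, List.pairwise_map]
    exact hsort.sublist (List.take_sublist _ _)
  · intro p hp
    obtain ⟨q, hq, rfl⟩ := List.mem_map.1 hp
    rw [Finset.mem_product]
    rcases (hmem q).1 (List.mem_of_mem_take hq) with hq | hq
    · have hi : i = 0 := by
        by_contra hi
        simp [h.zero' hi, rowNums] at hq
      obtain ⟨c, hc', rfl⟩ := List.mem_map.1 hq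
      rw [posOf_numOf]
      refine ⟨?_, (h.zero hi).2.1 c hc'⟩
      rw [hi]
      simp
    · have hj : j ≠ 0 := by
        intro hj
        simp [h.one' hj, rowNums] at hq
      obtain ⟨c, hc', rfl⟩ := List.mem_map.1 hq
      rw [posOf_numOf]
      refine ⟨?_, (h.one hj).2.1 c hc'⟩
      rw [hj01.resolve_left hj]
      rw [Finset.mem_Icc]
      exact ⟨Fin.le_last i, le_rfl⟩
  · rw [mergedAnswer, List.length_map, List.length_take, hlen, List.length_append, hl₀, hl₁,
      Finset.card_product]
    set m := (Finset.Icc a b).card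
    have e0 : i = 0 → L₀.length = min k m := fun hi => (h.zero hi).2.2.1
    have e0' : i = 1 → L₀.length = 0 := fun hi => by rw [h.zero' (by omega)]; rfl
    have e1 : j = 1 → L₁.length = min k m := fun hj => (h.one (by omega)).2.2.1
    have e1' : j = 0 → L₁.length = 0 := fun hj => by rw [h.one' hj]; rfl
    rcases hi01 with rfl | rfl <;> rcases hj01 with rfl | rfl
    · rw [e0 rfl, e1' rfl]; simp
    · rw [e0 rfl, e1 rfl]
      have : (Finset.Icc (0 : Fin 2) 1).card = 2 := rfl
      rw [this]
      omega
    · exact absurd hij (by decide)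
    · rw [e0' rfl, e1 rfl]; simp
  · intro p hp hpL q hq
    obtain ⟨x, hx, rfl⟩ := List.mem_map.1 hq
    rw [← posOf_numOf hn p]
    change numKey A hn (numOf p) < numKey A hn x
    -- A cell in the merge but not in the answer comes after the first `k`. A cell missing from the
    -- merge is missing from its row's list, which then has `k` elements, all larger.
    by_cases hpM : numOf p ∈ M
    · rw [← List.take_append_drop k M, List.pairwise_append] at hsort
      rw [← List.take_append_drop k M, List.mem_append] at hpM
      refine hsort.2.2 x hx _ (hpM.resolve_left fun hpt => hpL ?_)
      exact List.mem_map.2 ⟨_, hpt, posOf_numOf hn p⟩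
    · rw [Finset.mem_product, Finset.mem_Icc] at hp
      rw [hmem, not_or, mem_rowNums, mem_rowNums] at hpM
      have hpa := Finset.mem_Icc.1 hp.2
      have a1 : (a : ℕ) ≤ p.2 := hpa.1
      have a2 : (p.2 : ℕ) ≤ b := hpa.2
      have a3 := p.1.isLt
      have b1 : 2 * (a : ℕ) ≤ numOf p := by simp only [numOf]; omega
      have b2 : numOf p ≤ 2 * b + 1 := by simp only [numOf]; omega
      have hp01 : p.1 = 0 ∨ p.1 = 1 := by omega
      rcases hp01 with hp0 | hp1
      · have hi : i = 0 := by have := hp.1.1; omega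
        have hnot : p.2 ∉ L₀ := fun hm => hpM.1 ⟨hp0, hm⟩
        refine lt_of_mem_take hsort hc.nodup₀ ?_ (fun y hy => (hmem y).2 (.inl hy)) ?_ hx
        · rw [hl₀, (h.zero hi).length_eq_of_not_mem hp.2 hnot]
        · exact hc.max₀ _ b1 b2 (by simp [numOf, hp0]) (fun hm => hnot (mem_rowNums.1 hm).2)
      · have hj : j ≠ 0 := by have := hp.1.2; omega
        have hnot : p.2 ∉ L₁ := fun hm => hpM.2 ⟨hp1, hm⟩
        refine lt_of_mem_take hsort hc.nodup₁ ?_ (fun y hy => (hmem y).2 (.inr hy)) ?_ hx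
        · rw [hl₁, (h.one hj).length_eq_of_not_mem hp.2 hnot]
        · exact hc.max₁ _ b1 b2 (by simp [numOf, hp1])
            (fun hm => hnot (mem_rowNums.1 hm).2)

lemma RowAnswers.flatMap_mergedAnswer (hn : 0 < n) (h : RowAnswers A k i j a b L₀ L₁) :
    (mergedAnswer A hn k L₀ L₁).flatMap (fun p => [(p.1 : ℕ), (p.2 : ℕ)]) =
      ((mergeDesc (numKey A hn) (rowNums 0 L₀) (rowNums 1 L₁)).take k).flatMap cellOf := by
  have hc := h.candidates hn
  rw [mergedAnswer, List.flatMap_map]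
  refine List.flatMap_congr fun p hp => ?_
  have hb := b.isLt
  have hp' : p ≤ 2 * b + 1 := by
    rcases List.mem_append.1 ((mergeDesc_perm _ _ _).mem_iff.1 (List.mem_of_mem_take hp)) with h | h
    · exact (hc.mem₀ p h).2
    · exact (hc.mem₁ p h).2
  simp only [posOf, cellOf]
  rw [Nat.mod_eq_of_lt (by omega : p / 2 < n)]

end

end RangeTopK

/-! ### Assembly of the data structure. -/

namespace WordRAM

/-- A position below `m` that is missing from `A.take m` is past the end of `A`, where bits count as
`0`. Hence the clamped read loses nothing. -/
lemma At.readBits_take {D A : List Bool} {p m x y : ℕ} (h : At D p (A.take m)) (hxy : x + y ≤ m) :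
    readBits D (p + x) (min y ((A.take m).length - x)) = readBits A x y := by
  obtain ⟨pre, post, rfl, rfl⟩ := h
  have hlen : (A.take m).length = min m A.length := List.length_take
  unfold readBits
  rw [← Finset.sum_subset (s₁ := Finset.range (min y ((A.take m).length - x)))
    (s₂ := Finset.range y) (Finset.range_mono (min_le_left _ _))]
  · refine Finset.sum_congr rfl fun t ht => ?_
    have ht := Finset.mem_range.1 ht
    rw [List.getD_append_right _ _ _ _ (by omega), List.getD_append _ _ _ _ (by omega),
      show pre.length + x + t - pre.length = x + t by omega, List.getD_eq_getElem?_getD,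
      List.getD_eq_getElem?_getD, List.getElem?_take_of_lt (by omega)]
  · intro t ht ht'
    have ht := Finset.mem_range.1 ht
    rw [Finset.mem_range] at ht'
    rw [List.getD_eq_default _ _ (by omega)]
    simp

/-- The size of the layout of a monotone function. -/
def layoutSize (W s g h U : ℕ) : ℕ :=
  U * (3 * W) + U * g * (4 * h) + 2 ^ h * 2 ^ (s * h) * s * h + 2 * (U * (s * g))

end WordRAM

namespace RangeTopK

open WordRAM

/-- The string consists of a header of twelve words, the layout of the profile and the strings of
the two rows. `V` bounds all words that occur in a run of `Q`. -/
theorem hasEncoding2D_queryProg {α : Type*} [LinearOrder α] {Q : Prog} {c c' n k S T : ℕ}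
    {s g h U V : ℕ} (hk : k ≤ 2 * n) (hn : 0 < n)
    (hs : 0 < s) (hg : 0 < g) (hh : 0 < h) (hsg : 2 * (s * g) < 2 ^ h)
    (hgh : g * (s * h) < 2 ^ h) (hsh : s * h < wordSize c' n)
    (hM : (k + 1) * (2 * n + 1) ≤ U * (s * g)) (hbig : 10 * ((k + 3) * (2 * n + 1)) < 2 ^ wordSize c' n)
    (hW4 : 4 ≤ wordSize c' n) (hW11 : 11 * wordSize c' n < 2 ^ wordSize c' n)
    (hwV : wordSize c n < V) (hnV : 2 * n < V) (hV : 2 ^ wordSize c n ≤ V)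
    (hV' : 5 * V + 5 < 2 ^ wordSize c' n) (hw : wordSize c n ≤ wordSize c' n)
    (hfull : 12 * wordSize c' n + layoutSize (wordSize c' n) s g h U + 2 * V + wordSize c n
      < 2 ^ wordSize c' n)
    (henc : HasEncoding1D α Q c n k S T) :
    HasEncoding2D α (queryProg Q) c' n k
      (2 * S + (12 * wordSize c' n + layoutSize (wordSize c' n) s g h U))
      (mergeProg.time k + 14 * T + 200) := by
  intro A
  have hmap : ∀ L : List (Fin n), (L.map fun p => p : List ℕ) = L.map Fin.val := fun L => by
    simp [← List.map_eq_flatMap]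
  obtain ⟨D₀, hD₀, hq₀⟩ := henc (A 0)
  obtain ⟨D₁, hD₁, hq₁⟩ := henc (A 1)
  set W := wordSize c' n with hW
  set wQ := wordSize c n with hwQ
  have hP : 0 < 2 * n + 1 := by omega
  obtain ⟨G, hG, hlay⟩ := exists_layout (profile_mono (numKey A hn) hP) (profile_le (numKey A hn) _)
    (W := W) (s := s) (g := g) (h := h) (U := U) (β := 12 * W) hs hg hsg hgh
    (by unfold layoutSize at hfull; omega)
  change G.length ≤ layoutSize W s g h U at hG
  -- No upper bound on `S` is assumed, but `Q` can read only the first `V + wQ` bits: addresses are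
  -- below `V`, and a read covers at most `wQ` bits. After truncation all positions in the data
  -- structure fit into a word.
  set E₀ := D₀.take (V + wQ) with hE₀
  set E₁ := D₁.take (V + wQ) with hE₁
  have lE₀ : E₀.length ≤ V + wQ := List.length_take_le _ _
  have lE₁ : E₁.length ≤ V + wQ := List.length_take_le _ _
  have lE₀' : E₀.length ≤ D₀.length := List.length_take_le' _ _
  have lE₁' : E₁.length ≤ D₁.length := List.length_take_le' _ _
  let fields : List ℕ := [wQ, 12 * W + G.length, E₀.length, 12 * W + G.length + E₀.length,
    E₁.length, 12 * W, 12 * W + U * (3 * W), 12 * W + U * (3 * W) + U * g * (4 * h), s, s * g, h,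
    2 ^ (s * h)]
  have hhs : h ≤ s * h := Nat.le_mul_of_pos_left h hs
  have hss : s ≤ s * h := Nat.le_mul_of_pos_right s hh
  have hWW : W < 2 ^ W := W.lt_two_pow_self
  have hpow : 2 ^ (s * h) < 2 ^ W := Nat.pow_lt_pow_right (by norm_num) hsh
  have hU : 0 < U := by
    rcases Nat.eq_zero_or_pos U with rfl | hU
    · rw [zero_mul, Nat.le_zero, Nat.mul_eq_zero] at hM
      omega
    · exact hU
  have hUsg : s * g ≤ U * (s * g) := Nat.le_mul_of_pos_left _ hU
  have hls : U * (3 * W) + U * g * (4 * h) + 2 * (U * (s * g)) ≤ layoutSize W s g h U := by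
    unfold layoutSize; omega
  have hfields : ∀ x ∈ fields, x < 2 ^ W := by
    intro x hx
    simp only [fields, List.mem_cons, List.not_mem_nil, or_false] at hx
    rcases hx with rfl | rfl | rfl | rfl | rfl | rfl | rfl | rfl | rfl | rfl | rfl | rfl <;> omega
  let hd := cat 12 fun c => natBits W (fields.getD c 0)
  have lhd : hd.length = 12 * W := cat_length_const fun _ _ => natBits_length _ _
  let D := hd ++ (G ++ (E₀ ++ E₁))
  have aD : At D 0 (hd ++ (G ++ (E₀ ++ E₁))) := ⟨[], [], by simp [D], rfl⟩
  have aG : At D (12 * W) (G ++ (E₀ ++ E₁)) := by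
    have := aD.right
    rwa [lhd, zero_add] at this
  have a₀ : At D (12 * W + G.length) E₀ := aG.right.left
  have a₁ : At D (12 * W + G.length + E₀.length) E₁ := aG.right.right
  have hread : ∀ c < 12, readBits D (c * W) W = fields.getD c 0 := fun c hc => by
    have := aD.left.nth_const hc (fun _ _ => natBits_length _ _)
    rw [zero_add] at this
    refine this.read (hfields _ ?_)
    rw [List.getD_eq_getElem _ _ (by simpa [fields] using hc)]
    exact List.getElem_mem _
  let π : Par := ⟨W, 12 * W, 12 * W + U * (3 * W), 12 * W + U * (3 * W) + U * g * (4 * h), s, g, h,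
    12 * W + G.length, U * (s * g), 2 * n + 1, k, D⟩
  have hπ : π.Good (numKey A hn) := by
    refine ⟨hlay D aG.left, ?_, hs, hg, hh, hsh, ?_, ?_, hM, hbig, ?_, hW4⟩
    · change 12 * W + G.length < 2 ^ W
      omega
    · change s * g < 2 ^ W
      omega
    · change 2 * (U * (s * g)) < 2 ^ W
      omega
    · change 2 ≤ 2 * n + 1
      omega
  refine ⟨D, ?_, ?_⟩
  · simp only [D, List.length_append, lhd]
    omega
  intro i j a b hij hab
  obtain ⟨L₀, h0, h0'⟩ : ∃ L₀ : List (Fin n), (i = 0 →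
      IsSortedTopK (key1 (A 0)) (Finset.Icc a b) k L₀ ∧
      Computes Q wQ D₀ [n, k, a, b] T (L₀.map Fin.val)) ∧ (i ≠ 0 → L₀ = []) := by
    by_cases hi : i = 0
    · obtain ⟨L, hL⟩ := hq₀ a b hab
      exact ⟨L, fun _ => hmap L ▸ hL, fun h => absurd hi h⟩
    · exact ⟨[], fun h => absurd h hi, fun _ => rfl⟩
  obtain ⟨L₁, h1, h1'⟩ : ∃ L₁ : List (Fin n), (j ≠ 0 →
      IsSortedTopK (key1 (A 1)) (Finset.Icc a b) k L₁ ∧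
      Computes Q wQ D₁ [n, k, a, b] T (L₁.map Fin.val)) ∧ (j = 0 → L₁ = []) := by
    by_cases hj : j = 0
    · exact ⟨[], fun h => absurd hj h, fun _ => rfl⟩
    · obtain ⟨L, hL⟩ := hq₁ a b hab
      exact ⟨L, fun _ => hmap L ▸ hL, fun h => absurd h hj⟩
  have hR : RowAnswers A k i j a b L₀ L₁ := ⟨fun h => (h0 h).1, h0', fun h => (h1 h).1, h1'⟩
  have l₀ : L₀.length ≤ k := by
    by_cases hi : i = 0
    · rw [(h0 hi).1.2.2.1]
      exact min_le_left _ _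
    · simp [h0' hi]
  have l₁ : L₁.length ≤ k := by
    by_cases hj : j = 0
    · simp [h1' hj]
    · rw [(h1 hj).1.2.2.1]
      exact min_le_left _ _
  refine ⟨_, hR.isSortedTopK hn hij, ?_⟩
  rw [hR.flatMap_mergedAnswer hn]
  have e₀ : rowNums 0 L₀ = (L₀.map Fin.val).map (2 * ·) := by simp [rowNums, numOf]
  have e₁ : rowNums 1 L₁ = (L₁.map Fin.val).map (2 * · + 1) := by simp [rowNums, numOf]
  have hc := hR.candidates hn
  have ha := a.isLt
  have hb := b.isLt
  rw [e₀, e₁] at hc ⊢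
  have hi2 := i.isLt
  have hj2 := j.isLt
  have hH : Header π wQ (12 * W + G.length) E₀.length (12 * W + G.length + E₀.length) E₁.length :=
    ⟨hread 0 (by norm_num), hread 1 (by norm_num), hread 2 (by norm_num), hread 3 (by norm_num),
      hread 4 (by norm_num), hread 5 (by norm_num), hread 6 (by norm_num), hread 7 (by norm_num),
      hread 8 (by norm_num), hread 9 (by norm_num), hread 10 (by norm_num),
      hread 11 (by norm_num)⟩
  refine queryProg_runs (π := π) hπ (lo := 2 * a) (hi := 2 * b + 1) (V := V) (D₀ := D₀) (D₁ := D₁)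
    rfl hH hW11 hwV (by omega) (by change k < V; omega) (by omega) (by omega) hV hV' hw (by omega)
    (by omega) ?_ ?_ ?_ ?_ hc ?_ (by simpa using l₀) (by simpa using l₁)
  · intro hi
    have hi : i = 0 := Fin.ext hi
    refine ⟨by change E₀.length < 2 ^ W; omega, by change 12 * W + G.length + V < 2 ^ W; omega,
      fun x y hx hy => a₀.readBits_take (by omega), (h0 hi).2, by simp; omega⟩
  · intro hi
    simp [h0' (fun h => hi (by rw [h]; rfl))]
  · intro hj
    have hj : j ≠ 0 := fun h => hj (by rw [h]; rfl)
    refine ⟨by change E₁.length < 2 ^ W; omega,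
      by change 12 * W + G.length + E₀.length + V < 2 ^ W; omega,
      fun x y hx hy => a₁.readBits_take (by omega), (h1 hj).2, by simp; omega⟩
  · intro hj
    simp [h1' (Fin.ext hj)]
  · change 2 * (b : ℕ) + 1 + 1 < 2 * n + 1
    omega

end RangeTopK

/-! ### Choice of the parameters and estimates of the lower-order terms. -/

namespace WordRAM

open RangeTopK

/-- The logarithm of the word length. -/
def logLog (n : ℕ) : ℕ := Nat.size (Nat.log 2 n + 2)

lemma lt_two_pow_logLog (n : ℕ) : Nat.log 2 n + 2 < 2 ^ logLog n := Nat.lt_size_self _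

lemma two_pow_logLog_le (n : ℕ) : 2 ^ logLog n ≤ 2 * (Nat.log 2 n + 2) := by
  have h : logLog n - 1 < logLog n := by
    have : 0 < logLog n := Nat.size_pos.2 (by omega)
    omega
  have := Nat.lt_size.1 h
  calc 2 ^ logLog n = 2 * 2 ^ (logLog n - 1) := by
        rw [← pow_succ']; congr 1; omega
    _ ≤ _ := by omega

lemma two_le_logLog (n : ℕ) : 2 ≤ logLog n := Nat.lt_size.2 (by norm_num)

/-- For `t = logLog n` this gives `5 * t ^ 3 ≤ 40 * (Nat.log 2 n + 2)`, so that block codes fit into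
a word. -/
lemma cube_le_two_pow (t : ℕ) : t ^ 3 ≤ 4 * 2 ^ t := by
  rcases Nat.lt_or_ge t 4 with h | h
  · interval_cases t <;> norm_num
  · induction t, h using Nat.le_induction with
    | base => norm_num
    | succ t ht ih =>
      have : (t + 1) ^ 3 ≤ 2 * t ^ 3 := by nlinarith [sq_nonneg t, mul_le_mul ht ht]
      rw [pow_succ 2]
      omega

lemma two_mul_le_two_pow {t : ℕ} (ht : 1 ≤ t) : 2 * t ≤ 2 ^ t := by
  induction t, ht using Nat.le_induction with
  | base => norm_num
  | succ t ht ih => rw [pow_succ]; omega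

lemma eleven_mul_lt_two_pow {t : ℕ} (ht : 7 ≤ t) : 11 * t < 2 ^ t := by
  induction t, ht using Nat.le_induction with
  | base => norm_num
  | succ t ht ih => rw [pow_succ]; omega

/-- The number of superblocks. -/
def superCount (n k : ℕ) : ℕ :=
  (k + 1) * (2 * n + 1) / (logLog n ^ 2 * 2 ^ logLog n) + 1

lemma superCount_mul_le (n k : ℕ) : superCount n k * (logLog n ^ 2 * 2 ^ logLog n) ≤
    (k + 1) * (2 * n + 1) + logLog n ^ 2 * 2 ^ logLog n := by
  rw [superCount, add_mul, one_mul]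
  exact Nat.add_le_add_right (Nat.div_mul_le_self _ _) _

/-- The words are long enough for all quantities. -/
lemma layout_fits (c n k : ℕ) (hk : k ≤ 2 * n) :
    12 * wordSize (c + 100) n + layoutSize (wordSize (c + 100) n) (logLog n ^ 2) (2 ^ logLog n)
      (5 * logLog n) (superCount n k) + 2 * 2 ^ wordSize (c + 1) n + wordSize c n
      < 2 ^ wordSize (c + 100) n := by
  have hsc := superCount_mul_le n k
  have h1 := lt_two_pow_logLog n
  have h2 := two_pow_logLog_le n
  have h3 := two_le_logLog n
  have h4 := cube_le_two_pow (logLog n)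
  have hn : n < 2 ^ (Nat.log 2 n + 1) := Nat.lt_pow_succ_log_self (by norm_num) n
  unfold layoutSize wordSize
  set l := Nat.log 2 n + 2 with hl
  set t := logLog n with ht
  set U := superCount n k with hU
  -- All quantities are compared with `Y` times powers of `X`. Each term is at most `Z = Y * X ^
  -- 59`, while a word of the new machine has `Y * X ^ 100` values.
  set X := 2 ^ l with hX
  set Y := 2 ^ (c * l) with hY
  have hX4 : 4 ≤ X := by
    have : 2 ^ 2 ≤ 2 ^ l := Nat.pow_le_pow_right two_pos (by omega)
    omega
  have hX1 : 1 ≤ X := by omega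
  have hY1 : 1 ≤ Y := Nat.one_le_two_pow
  have hlX : 2 * l ≤ X := two_mul_le_two_pow (by omega)
  have hnX : 2 * n + 1 ≤ X := by
    have : X = 2 * 2 ^ (Nat.log 2 n + 1) := by rw [hX, hl, ← pow_succ']
    omega
  have htX : 2 ^ t ≤ X := h2.trans hlX
  have ht' : t ≤ X := t.lt_two_pow_self.le.trans htX
  have lit : ∀ j a : ℕ, a ≤ 4 ^ j → a ≤ X ^ j := fun j a h => h.trans (Nat.pow_le_pow_left hX4 j)
  have hM : (k + 1) * (2 * n + 1) ≤ X ^ 2 := by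
    rw [sq]; exact Nat.mul_le_mul (by omega) hnX
  have hsg : t ^ 2 * 2 ^ t ≤ X ^ 3 := by
    rw [pow_succ X]; exact Nat.mul_le_mul (Nat.pow_le_pow_left ht' 2) htX
  have hsg1 : 1 ≤ t ^ 2 * 2 ^ t := by have : 0 < t := by omega
                                      exact Nat.mul_pos (by positivity) (by positivity)
  have hX23 : X ^ 2 ≤ X ^ 3 := Nat.pow_le_pow_right hX1 (by norm_num)
  have hX34 : X ^ 3 * 4 ≤ X ^ 3 * X := Nat.mul_le_mul_left _ hX4
  have hUsg : U * (t ^ 2 * 2 ^ t) ≤ X ^ 4 := by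
    rw [pow_succ X]
    omega
  have hU4 : U ≤ X ^ 4 := (Nat.le_mul_of_pos_right U hsg1).trans hUsg
  have hpow : 2 ^ ((c + 100) * l) = Y * X ^ 100 := by
    rw [add_mul, pow_add, mul_comm 100 l, pow_mul 2 l 100]
  have hV : 2 ^ ((c + 1) * l) = Y * X := by
    rw [add_mul, one_mul, pow_add]
  have hcl : c * l ≤ Y := (c * l).lt_two_pow_self.le
  have hW : (c + 100) * l ≤ Y * X ^ 5 := by
    have e1 : 100 * l + 1 ≤ X ^ 5 := by
      have := lit 4 128 (by norm_num)
      have : X ^ 4 * X = X ^ 5 := (pow_succ X 4).symm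
      have : 128 * X ≤ X ^ 4 * X := Nat.mul_le_mul_right _ ‹_›
      omega
    calc (c + 100) * l = c * l + 100 * l := by ring
      _ ≤ Y + Y * (100 * l) := add_le_add hcl (Nat.le_mul_of_pos_left _ hY1)
      _ = Y * (100 * l + 1) := by ring
      _ ≤ _ := Nat.mul_le_mul_left _ e1
  have ht3 : 5 * t ^ 3 ≤ 40 * l := by omega
  have hup : ∀ j ≤ 59, Y * X ^ j ≤ Y * X ^ 59 := fun j hj =>
    Nat.mul_le_mul_left _ (Nat.pow_le_pow_right hX1 hj)
  have hup' : ∀ j ≤ 59, X ^ j ≤ Y * X ^ 59 := fun j hj =>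
    (Nat.le_mul_of_pos_left _ hY1).trans (hup j hj)
  set Z := Y * X ^ 59 with hZ
  have b1 : 12 * ((c + 100) * l) ≤ Z :=
    calc _ ≤ X ^ 2 * (Y * X ^ 5) := Nat.mul_le_mul (lit 2 12 (by norm_num)) hW
      _ = Y * X ^ 7 := by ring
      _ ≤ _ := hup _ (by norm_num)
  have b2 : U * (3 * ((c + 100) * l)) ≤ Z :=
    calc _ ≤ X ^ 4 * (X ^ 1 * (Y * X ^ 5)) :=
          Nat.mul_le_mul hU4 (Nat.mul_le_mul (lit 1 3 (by norm_num)) hW)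
      _ = Y * X ^ 10 := by ring
      _ ≤ _ := hup _ (by norm_num)
  have b3 : U * 2 ^ t * (4 * (5 * t)) ≤ Z :=
    calc _ ≤ X ^ 4 * X * (X ^ 1 * (X ^ 2 * X)) :=
          Nat.mul_le_mul (Nat.mul_le_mul hU4 htX) (Nat.mul_le_mul (lit 1 4 (by norm_num))
            (Nat.mul_le_mul (lit 2 5 (by norm_num)) ht'))
      _ = X ^ 9 := by ring
      _ ≤ _ := hup' _ (by norm_num)
  have b4 : 2 ^ (5 * t) * 2 ^ (t ^ 2 * (5 * t)) * t ^ 2 * (5 * t) ≤ Z :=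
    calc 2 ^ (5 * t) * 2 ^ (t ^ 2 * (5 * t)) * t ^ 2 * (5 * t)
        = (2 ^ t) ^ 5 * 2 ^ (5 * t ^ 3) * (5 * t ^ 3) := by
          rw [mul_comm 5 t, pow_mul]; ring_nf
      _ ≤ X ^ 5 * X ^ 40 * (X ^ 3 * X) :=
          Nat.mul_le_mul (Nat.mul_le_mul (Nat.pow_le_pow_left htX 5) (by
            rw [hX, ← pow_mul, mul_comm l 40]
            exact Nat.pow_le_pow_right two_pos ht3))
            (ht3.trans (Nat.mul_le_mul (lit 3 40 (by norm_num)) (by omega)))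
      _ = X ^ 49 := by ring
      _ ≤ _ := hup' _ (by norm_num)
  have b5 : 2 * (U * (t ^ 2 * 2 ^ t)) ≤ Z :=
    calc _ ≤ X ^ 1 * X ^ 4 := Nat.mul_le_mul (lit 1 2 (by norm_num)) hUsg
      _ = X ^ 5 := by ring
      _ ≤ _ := hup' _ (by norm_num)
  have b6 : 2 * (Y * X) ≤ Z :=
    calc _ ≤ X ^ 1 * (Y * X) := Nat.mul_le_mul_right _ (lit 1 2 (by norm_num))
      _ = Y * X ^ 2 := by ring
      _ ≤ _ := hup _ (by norm_num)
  have b7 : c * l ≤ Z := hcl.trans ((Nat.le_mul_of_pos_right _ (pow_pos hX1 0)).trans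
    (hup 0 (by norm_num)))
  have hZ1 : 1 ≤ Z := Nat.mul_pos hY1 (pow_pos hX1 _)
  rw [hpow, hV]
  calc _ ≤ 7 * Z := by omega
    _ < X ^ 2 * Z := by
        have := lit 2 8 (by norm_num)
        calc 7 * Z < 8 * Z := by omega
          _ ≤ _ := Nat.mul_le_mul_right _ this
    _ = Y * X ^ 61 := by rw [hZ]; ring
    _ ≤ _ := Nat.mul_le_mul_left _ (Nat.pow_le_pow_right hX1 (by norm_num))

/-- The lower-order term of the space bound, divided by `k`. -/
def overhead (c n : ℕ) : ℕ :=
  4 + 12 * wordSize c n +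
    (6 * n / (logLog n ^ 2 * 2 ^ logLog n) + 2) * (3 * wordSize c n + 2 ^ logLog n * (20 * logLog n)) +
    2 ^ (5 * logLog n) * 2 ^ (5 * logLog n ^ 3) * (5 * logLog n ^ 3) +
    2 * (logLog n ^ 2 * 2 ^ logLog n)

/-- The leading term is twice the number of arguments, `2 * ((k + 1) * (2 * n + 1)) = (4 * k + 4) *
n + 2 * k + 2`. The constant `4` in `overhead` absorbs `2 * k + 2`, and `3 * n` bits are to spare.
All other terms are at most `k` times a quantity independent of `k`. -/
lemma layoutSize_le (c n k : ℕ) (hk : 1 ≤ k) (hn : 1 ≤ n) :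
    12 * wordSize c n + layoutSize (wordSize c n) (logLog n ^ 2) (2 ^ logLog n)
      (5 * logLog n) (superCount n k) ≤ (4 * k + 7) * n + k * overhead c n := by
  have hsc := superCount_mul_le n k
  unfold layoutSize overhead
  set W := wordSize c n
  set t := logLog n
  set d := t ^ 2 * 2 ^ t with hd
  set u := 6 * n / d + 2 with hu
  have hU : superCount n k ≤ k * u := by
    -- Here `k + 1 ≤ 2 * k` and `2 * n + 1 ≤ 3 * n`.
    have h1 : (k + 1) * (2 * n + 1) ≤ k * (6 * n) := by nlinarith
    have hd0 : 0 < d := by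
      have : 0 < t := by have := two_le_logLog n; omega
      positivity
    have h2 : (k + 1) * (2 * n + 1) / d ≤ k * (6 * n / d + 1) := by
      refine Nat.le_of_lt_succ ((Nat.div_lt_iff_lt_mul hd0).2 (h1.trans_lt ?_))
      have h3 : 6 * n < (6 * n / d + 1) * d := by
        have := Nat.lt_div_mul_add hd0 (a := 6 * n)
        rw [add_mul, one_mul]
        omega
      calc k * (6 * n) ≤ k * ((6 * n / d + 1) * d) := Nat.mul_le_mul_left _ h3.le
        _ = k * (6 * n / d + 1) * d := by ring
        _ < _ := Nat.mul_lt_mul_of_pos_right (Nat.lt_succ_self _) hd0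
    rw [superCount, hu]
    have : k * (6 * n / d + 2) = k * (6 * n / d + 1) + k := by ring
    change (k + 1) * (2 * n + 1) / d + 1 ≤ _
    omega
  set U := superCount n k
  have e1 : U * (3 * W) + U * 2 ^ t * (4 * (5 * t)) = U * (3 * W + 2 ^ t * (20 * t)) := by ring
  have e2 : 2 ^ (5 * t) * 2 ^ (t ^ 2 * (5 * t)) * t ^ 2 * (5 * t)
      = 2 ^ (5 * t) * 2 ^ (5 * t ^ 3) * (5 * t ^ 3) := by
    rw [show t ^ 2 * (5 * t) = 5 * t ^ 3 by ring]; ring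
  rw [e2]
  set R := 2 ^ (5 * t) * 2 ^ (5 * t ^ 3) * (5 * t ^ 3)
  set q := 3 * W + 2 ^ t * (20 * t)
  have f1 : U * q ≤ k * (u * q) := by
    rw [← mul_assoc]; exact Nat.mul_le_mul_right _ hU
  have f2 : R ≤ k * R := Nat.le_mul_of_pos_left _ hk
  have f3 : W ≤ k * W := Nat.le_mul_of_pos_left _ hk
  have f4 : d ≤ k * d := Nat.le_mul_of_pos_left _ hk
  have f5 : k * (4 + 12 * W + u * q + R + 2 * d)
      = 4 * k + 12 * (k * W) + k * (u * q) + k * R + 2 * (k * d) := by ring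
  have f6 : 2 * ((k + 1) * (2 * n + 1)) + 3 * n = (4 * k + 7) * n + 2 * k + 2 := by ring
  rw [f5]
  omega

lemma exists_logLog_large (K : ℕ) : ∃ t₀, ∀ t ≥ t₀, 2 * (K * t ^ 3) ≤ 2 ^ t := by
  have h := isLittleO_pow_const_const_pow_of_one_lt (R := ℝ) 3 (r := 2) (by norm_num)
  have h2 := h.def (c := 1 / (2 * K + 1)) (by positivity)
  obtain ⟨t₀, ht⟩ := Filter.eventually_atTop.1 h2
  refine ⟨t₀, fun t htt => ?_⟩
  have h3 := ht t htt
  simp only [Real.norm_eq_abs, abs_pow, Nat.abs_cast] at h3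
  rw [abs_of_pos (by norm_num : (0 : ℝ) < 2), div_mul_eq_mul_div, le_div_iff₀ (by positivity)] at h3
  have h4 : t ^ 3 * (2 * K + 1) ≤ 1 * 2 ^ t := by exact_mod_cast h3
  nlinarith [Nat.zero_le (t ^ 3)]

/-- With `t = logLog n`, a superblock has `t ^ 2 * 2 ^ t` arguments and records of `O(2 ^ t * t)`
bits, that is `O(1 / t)` bits per argument. The table has about `2 ^ (5 * t ^ 3)` entries up to
smaller factors, which is far below `n` because `t` is about `log log n`. -/
lemma overhead_mul_le (c : ℕ) : ∃ t₀, ∀ n, 1 ≤ n → t₀ ≤ logLog n →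
    overhead c n * logLog n ≤ (121 + 18 * c) * n := by
  set K := 51 + 18 * c with hK
  obtain ⟨t₀, h₀⟩ := exists_logLog_large (K + 16)
  refine ⟨t₀, fun n hn ht₀ => ?_⟩
  have hbig := h₀ _ ht₀
  have h1 := lt_two_pow_logLog n
  have h2 := two_pow_logLog_le n
  have h3 := two_le_logLog n
  have hlog : 2 ^ Nat.log 2 n ≤ n := Nat.pow_log_le_self 2 (by omega)
  unfold overhead wordSize
  set t := logLog n
  set l := Nat.log 2 n + 2 with hl
  have hW : c * l ≤ c * 2 ^ t := Nat.mul_le_mul_left _ h1.le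
  set p := 2 ^ t with hp
  set d := t ^ 2 * p with hd
  set u := 6 * n / d + 2 with hu
  have ht1 : 1 ≤ t := by omega
  have hp1 : 1 ≤ p := Nat.one_le_two_pow
  have hud : u * d ≤ 6 * n + 2 * d := by
    rw [hu, add_mul]
    exact Nat.add_le_add_right (Nat.div_mul_le_self _ _) _
  set B := 2 ^ (5 * t) * 2 ^ (5 * t ^ 3) with hB
  have hpB : p ≤ B := by
    rw [hp, hB, ← pow_add]
    exact Nat.pow_le_pow_right two_pos (by omega)
  have hB1 : 1 ≤ B := hp1.trans hpB
  -- every remaining term is at most a multiple of `t ^ 4 * B`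
  have t12 : t ≤ t ^ 2 := Nat.le_self_pow (by norm_num) t
  have t14 : t ≤ t ^ 4 := Nat.le_self_pow (by norm_num) t
  have t24 : t ^ 2 ≤ t ^ 4 := Nat.pow_le_pow_right ht1 (by norm_num)
  have t34 : t ^ 3 ≤ t ^ 4 := Nat.pow_le_pow_right ht1 (by norm_num)
  have g0 : t ≤ t ^ 4 * B := t14.trans (Nat.le_mul_of_pos_right _ hB1)
  have g1 : t * p ≤ t ^ 4 * B := Nat.mul_le_mul t14 hpB
  have g2 : t ^ 2 * p ≤ t ^ 4 * B := Nat.mul_le_mul t24 hpB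
  have g3 : t ^ 3 * p ≤ t ^ 4 * B := Nat.mul_le_mul t34 hpB
  -- Record size times `t` is at most a constant times the superblock size `d`, and `u * d` is at
  -- most `6 * n + 2 * d`.
  have hq : u * (3 * (c * l) + p * (20 * t)) * t ≤ (20 + 3 * c) * (u * d) :=
    calc _ ≤ u * (3 * (c * p) + p * (20 * t)) * t := by gcongr
      _ = 3 * c * (u * (t * p)) + 20 * (u * (t ^ 2 * p)) := by ring
      _ ≤ 3 * c * (u * (t ^ 2 * p)) + 20 * (u * (t ^ 2 * p)) := by gcongr
      _ = _ := by rw [hd]; ring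
  have hmain : (4 + 12 * (c * l) + u * (3 * (c * l) + p * (20 * t)) + B * (5 * t ^ 3) + 2 * d) * t
      ≤ (120 + 18 * c) * n + K * (t ^ 4 * B) :=
    calc _ = 4 * t + 12 * (c * l) * t + u * (3 * (c * l) + p * (20 * t)) * t + 5 * (t ^ 4 * B)
          + 2 * (t ^ 3 * p) := by rw [hd]; ring
      _ ≤ 4 * (t ^ 4 * B) + 12 * (c * p) * t + (20 + 3 * c) * (6 * n + 2 * d) + 5 * (t ^ 4 * B)
          + 2 * (t ^ 4 * B) := by
          have := hq.trans (Nat.mul_le_mul_left (20 + 3 * c) hud)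
          gcongr
      _ = (120 + 18 * c) * n + (11 * (t ^ 4 * B) + 12 * c * (t * p) + (40 + 6 * c) * (t ^ 2 * p)) := by
          rw [hd]; ring
      _ ≤ (120 + 18 * c) * n + (11 * (t ^ 4 * B) + 12 * c * (t ^ 4 * B) + (40 + 6 * c) * (t ^ 4 * B)) := by
          gcongr
      _ = _ := by rw [hK]; ring
  refine hmain.trans ?_
  have hrest : K * (t ^ 4 * B) ≤ n := by
    -- The exponent below is `K + 9 * t + 5 * t ^ 3 ≤ K + 14 * t ^ 3`, and `l` exceeds `Nat.log 2 n`
    -- by `2`.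
    have h5 : K + 14 * t ^ 3 + 2 ≤ l := by
      have : 1 ≤ t ^ 3 := Nat.one_le_pow _ _ ht1
      have : K ≤ K * t ^ 3 := Nat.le_mul_of_pos_right _ this
      have : (K + 16) * t ^ 3 = K * t ^ 3 + 16 * t ^ 3 := by ring
      omega
    have h6 : t ≤ t ^ 3 := Nat.le_self_pow (by norm_num) t
    calc K * (t ^ 4 * B) ≤ 2 ^ K * ((2 ^ t) ^ 4 * B) :=
          Nat.mul_le_mul K.lt_two_pow_self.le (Nat.mul_le_mul_right _
            (Nat.pow_le_pow_left t.lt_two_pow_self.le 4))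
      _ = 2 ^ (K + (t * 4 + (5 * t + 5 * t ^ 3))) := by
          rw [hB, ← pow_mul, ← pow_add, ← pow_add, ← pow_add]
      _ ≤ 2 ^ Nat.log 2 n := Nat.pow_le_pow_right two_pos (by omega)
      _ ≤ n := hlog
  have : (121 + 18 * c) * n = (120 + 18 * c) * n + n := by ring
  omega

lemma le_logLog {b n : ℕ} (h : 2 ^ 2 ^ b ≤ n) : b ≤ logLog n := by
  have h1 : 2 ^ b ≤ Nat.log 2 n := Nat.le_log_of_pow_le (by norm_num) h
  exact (Nat.lt_size.2 (by omega)).le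

lemma overhead_isLittleO (c : ℕ) :
    (fun n : ℕ => (overhead c n : ℝ)) =o[Filter.atTop] (fun n : ℕ => (n : ℝ)) := by
  rw [Asymptotics.isLittleO_iff]
  intro ε hε
  obtain ⟨t₀, h₀⟩ := overhead_mul_le c
  obtain ⟨m, hm⟩ := exists_nat_gt ((121 + 18 * c : ℕ) / ε)
  refine Filter.eventually_atTop.2 ⟨2 ^ 2 ^ (max t₀ (m + 1)), fun n hn => ?_⟩
  have hle := le_logLog hn
  have h1 := h₀ n (Nat.one_le_two_pow.trans hn) ((le_max_left _ _).trans hle)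
  have hmt : (m : ℝ) ≤ logLog n := by
    have : m ≤ logLog n := by have := (le_max_right t₀ (m + 1)).trans hle; omega
    exact_mod_cast this
  have h2 : (overhead c n : ℝ) * logLog n ≤ (121 + 18 * c : ℕ) * n := by exact_mod_cast h1
  rw [Real.norm_natCast, Real.norm_natCast]
  rw [div_lt_iff₀ hε] at hm
  have ht0 : (0 : ℝ) < logLog n := by
    have := two_le_logLog n
    exact_mod_cast (by omega : 0 < logLog n)
  have h3 : ((121 + 18 * c : ℕ) : ℝ) ≤ ε * logLog n := by nlinarith
  have h4 : (overhead c n : ℝ) * logLog n ≤ ε * n * logLog n :=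
    h2.trans (by nlinarith [mul_le_mul_of_nonneg_right h3 (Nat.cast_nonneg (α := ℝ) n)])
  exact le_of_mul_le_mul_right h4 ht0

/-- High parts of values, less than twice the superblock size, fit into fields of `5 * t` bits. -/
lemma superblock_lt {t : ℕ} (ht : 2 ≤ t) : 2 * (t ^ 2 * 2 ^ t) < 2 ^ (5 * t) := by
  have h1 := two_mul_le_two_pow (by omega : 1 ≤ t)
  rw [mul_comm 5 t, pow_mul]
  generalize 2 ^ t = p at h1 ⊢
  have hp : 1 ≤ p := by omega
  calc 2 * (t ^ 2 * p) < (2 * t) ^ 2 * p := by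
        have : 0 < t ^ 2 * p := by positivity
        have : (2 * t) ^ 2 * p = 4 * (t ^ 2 * p) := by ring
        omega
    _ ≤ p ^ 2 * p := by gcongr
    _ = p ^ 3 := by ring
    _ ≤ p ^ 5 := Nat.pow_le_pow_right hp (by norm_num)

/-- The position of a block's code within its superblock also fits into `5 * t` bits: there are `2 ^
t` codes of at most `t ^ 2 * (5 * t)` bits. -/
lemma codes_lt {t : ℕ} (ht : 2 ≤ t) : 2 ^ t * (t ^ 2 * (5 * t)) < 2 ^ (5 * t) := by
  have h1 := two_mul_le_two_pow (by omega : 1 ≤ t)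
  rw [show 2 ^ (5 * t) = (2 ^ t) ^ 5 by rw [mul_comm, pow_mul]]
  generalize 2 ^ t = p at h1 ⊢
  have hp : 1 ≤ p := by omega
  calc p * (t ^ 2 * (5 * t)) < p * (2 * t) ^ 3 := by
        have : 0 < p * t ^ 3 := by positivity
        have : p * (2 * t) ^ 3 = 8 * (p * t ^ 3) := by ring
        have : p * (t ^ 2 * (5 * t)) = 5 * (p * t ^ 3) := by ring
        omega
    _ ≤ p * p ^ 3 := by gcongr
    _ = p ^ 4 := by ring
    _ ≤ p ^ 5 := Nat.pow_le_pow_right hp (by norm_num)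

lemma clear_nesting (d : ℕ) : (clear d).nesting = 0 := by
  induction d <;> simp_all [clear, Prog.nesting]

lemma Ex.comp_nesting (e : Ex) (t : ℕ) : (e.comp t).nesting = 0 := by
  induction e generalizing t <;> simp_all [Ex.comp, Prog.nesting]

/-- The outer loop runs over the outputs; inside it, scanning and insertion are single loops over
the known positions. -/
lemma mergeProg_nesting : mergeProg.nesting = 2 := by
  simp [mergeProg, whl, cond, choose, compare, scan, scanBody, advance, insert, insertBody, set,
    put, outp, Prog.nesting, clear_nesting, Ex.comp_nesting]

lemma exists_queryProg_time : ∃ C, ∀ k T, 1 ≤ k →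
    mergeProg.time k + 14 * T + 200 ≤ C * (k ^ 2 + k * T) := by
  refine ⟨mergeProg.time 1 + 214, fun k T hk => ?_⟩
  have h1 := Prog.time_le hk mergeProg
  rw [mergeProg_nesting] at h1
  generalize mergeProg.time 1 = x at h1 ⊢
  have h2 : 1 ≤ k ^ 2 := Nat.one_le_pow _ _ hk
  have h3 : T ≤ k * T := Nat.le_mul_of_pos_left _ hk
  have h4 : k ^ 2 * x ≤ (k ^ 2 + k * T) * x := Nat.mul_le_mul_right _ (Nat.le_add_right _ _)
  have h5 : (x + 214) * (k ^ 2 + k * T) = (k ^ 2 + k * T) * x + 214 * (k ^ 2 + k * T) := by ring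
  omega

end WordRAM

theorem mainTheorem7 (Q : WordRAM.Prog) (c : ℕ) :
    ∃ (Q' : WordRAM.Prog) (c' C : ℕ) (g : ℕ → ℕ),
      (fun n : ℕ => (g n : ℝ)) =o[Filter.atTop] (fun n : ℕ => (n : ℝ)) ∧
      ∀ (α : Type*) [LinearOrder α] (S T : ℕ → ℕ → ℕ) (n k : ℕ), 1 ≤ k → k ≤ 2 * n →
        RangeTopK.HasEncoding1D α Q c n k (S n k) (T n k) →
        RangeTopK.HasEncoding2D α Q' c' n k
          (2 * S n k + (4 * k + 7) * n + k * g n) (C * (k ^ 2 + k * T n k)) := by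
  obtain ⟨C, hC⟩ := WordRAM.exists_queryProg_time
  refine ⟨WordRAM.queryProg Q, c + 100, C, WordRAM.overhead (c + 100),
    WordRAM.overhead_isLittleO _, fun α _ S T n k hk hkn henc A => ?_⟩
  have hn : 1 ≤ n := by omega
  have ht := WordRAM.two_le_logLog n
  have hpt := WordRAM.two_pow_logLog_le n
  have hc3 := WordRAM.cube_le_two_pow (WordRAM.logLog n)
  have hl : 2 ≤ Nat.log 2 n + 2 := by omega
  have hnl : n < 2 ^ (Nat.log 2 n + 1) := Nat.lt_pow_succ_log_self (by norm_num) n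
  have hfit := WordRAM.layout_fits c n k hkn
  have hM : (k + 1) * (2 * n + 1) ≤ WordRAM.superCount n k *
      (WordRAM.logLog n ^ 2 * 2 ^ WordRAM.logLog n) := by
    have hd : 0 < WordRAM.logLog n ^ 2 * 2 ^ WordRAM.logLog n := by
      have : 0 < WordRAM.logLog n := by omega
      positivity
    exact (Nat.lt_div_mul_add hd).le.trans_eq (Nat.succ_mul _ _).symm
  have hW : 100 * (Nat.log 2 n + 2) ≤ WordRAM.wordSize (c + 100) n := by
    unfold WordRAM.wordSize
    exact Nat.mul_le_mul_right _ (by omega)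
  have hVe : WordRAM.wordSize (c + 1) n + 4 < WordRAM.wordSize (c + 100) n := by
    unfold WordRAM.wordSize
    nlinarith
  have hn2 : 2 * n < 2 ^ (Nat.log 2 n + 2) := by rw [pow_succ]; omega
  have h5 : 2 ^ (4 + 3 * (Nat.log 2 n + 2)) < 2 ^ WordRAM.wordSize (c + 100) n :=
    Nat.pow_lt_pow_right (by norm_num) (by omega)
  have hw : WordRAM.wordSize c n ≤ WordRAM.wordSize (c + 1) n :=
    Nat.mul_le_mul_right _ (by omega)
  have hsize := WordRAM.layoutSize_le (c + 100) n k hk hn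
  set t := WordRAM.logLog n
  have ht0 : 0 < t := by omega
  have h2t : 2 * t ≤ 2 ^ t := WordRAM.two_mul_le_two_pow (by omega)
  have c1 := WordRAM.superblock_lt ht
  have c2 := WordRAM.codes_lt ht
  have c3 : t ^ 2 * (5 * t) < WordRAM.wordSize (c + 100) n := by
    have : t ^ 2 * (5 * t) = 5 * t ^ 3 := by ring
    omega
  have c4 : 10 * ((k + 3) * (2 * n + 1)) < 2 ^ WordRAM.wordSize (c + 100) n := by
    refine lt_of_le_of_lt ?_ h5
    have h6 : k + 3 ≤ 2 ^ (Nat.log 2 n + 2) * 2 ^ (Nat.log 2 n + 2) := by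
      have : 4 ≤ 2 ^ (Nat.log 2 n + 2) := Nat.pow_le_pow_right two_pos hl
      nlinarith
    have h7 : 2 * n + 1 ≤ 2 ^ (Nat.log 2 n + 2) := hn2
    calc 10 * ((k + 3) * (2 * n + 1)) ≤ 2 ^ 4 * (2 ^ (Nat.log 2 n + 2) * 2 ^ (Nat.log 2 n + 2)
          * 2 ^ (Nat.log 2 n + 2)) := Nat.mul_le_mul (by norm_num) (Nat.mul_le_mul h6 h7)
      _ = 2 ^ (4 + (Nat.log 2 n + 2 + (Nat.log 2 n + 2) + (Nat.log 2 n + 2))) := by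
        rw [← pow_add, ← pow_add, ← pow_add]
      _ = _ := by rw [show ∀ l : ℕ, l + l + l = 3 * l by intro l; ring]
  have c5 : WordRAM.wordSize c n < 2 ^ WordRAM.wordSize (c + 1) n := by
    refine (WordRAM.wordSize c n).lt_two_pow_self.trans_le (Nat.pow_le_pow_right two_pos hw)
  -- The bound `V` is `2 ^ wordSize (c + 1) n` because for `c = 0` words of length `wordSize c n`
  -- could not hold the inputs, which the initial registers of `Q` contain nevertheless.
  have c6 : 2 * n < 2 ^ WordRAM.wordSize (c + 1) n := by
    refine hn2.trans_le (Nat.pow_le_pow_right two_pos ?_)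
    unfold WordRAM.wordSize
    exact Nat.le_mul_of_pos_left _ (by omega)
  have c7 : 5 * 2 ^ WordRAM.wordSize (c + 1) n + 5 < 2 ^ WordRAM.wordSize (c + 100) n := by
    calc 5 * 2 ^ WordRAM.wordSize (c + 1) n + 5 ≤ 2 ^ WordRAM.wordSize (c + 1) n * 2 ^ 4 := by
          have : 1 ≤ 2 ^ WordRAM.wordSize (c + 1) n := Nat.one_le_two_pow
          omega
      _ = 2 ^ (WordRAM.wordSize (c + 1) n + 4) := by rw [pow_add]
      _ < _ := Nat.pow_lt_pow_right (by norm_num) hVe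
  obtain ⟨D, hD, hq⟩ := RangeTopK.hasEncoding2D_queryProg hkn hn (Nat.pow_pos ht0)
    (Nat.two_pow_pos t) (by omega) c1 c2 c3 hM c4 (by omega)
    (WordRAM.eleven_mul_lt_two_pow (by omega)) c5 c6 (Nat.pow_le_pow_right two_pos hw) c7
    (hw.trans (by omega)) hfit henc A
  refine ⟨D, hD.trans (by omega), fun i j a b hij hab => ?_⟩
  obtain ⟨L, hL, s, hs, r⟩ := hq i j a b hij hab
  exact ⟨L, hL, s, hs.trans (hC k _ hk), r⟩
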